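/- Let $X=[0,1]$ with Borel $\sigma$-algebra $\mathcal B$ and Lebesgue measure $\lambda$. A *partition* is a finite or countable collection $\mathcal A$ of intervals in $[0,1]$ with non-empty interiors in $\mathbb R$, pairwise disjoint interiors, covering $[0,1]$ up to a $\lambda$-null set. Write $(T,\mu,\mathcal A)\in\mathcal T$ if $\mu$ is a Borel probability measure on $X$ with $\frac1c\mu\le\lambda\le c\mu$ for some $c\ge1$, $T:X\to X$ is $\mu$-preserving and ergodic, and $\mathcal A$ is a partition such that 1. for each $I\in\mathcal A$, $T|_{\mathrm{int}(I)}$ is continuous and strictly monotone; 2. $\mathcal B=\bigvee_{j\ge0}T^{-j}\sigma(\mathcal A)$ modulo $\lambda$-null sets; 3. $-\sum_{I\in\mathcal A}\mu(I)\log\mu(I)<\infty$. Such a system has *property B* if there are $c>0$ and positive reals $b_n\to0$ such that $\mu(A\cap T^{-(n+l)}B)\le c\,\mu(A)\mu(B)+b_n$ for all integers $l\ge1$, $n\ge0$, all $A\in\bigvee_{j=0}^{l-1}T^{-j}\sigma(\mathcal A)$ and all $B\in\mathcal B$. **Theorem.** Let $k\ge0$ and $(T_i,\mu_i,\mathcal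 A_i)\in\mathcal T$ for $i=0,1,\dots,k$. Suppose that $(T_i,\mu_i,\mathcal A_i)$ has property B for $i=1,\dots,k$, that the Kolmogorov–Sinai entropies $h(T_i)$ (with respect to $\mu_i$) satisfy $h(T_0)<h(T_1)<\dots<h(T_k)$, and that $T_0\times\cdots\times T_k$ is ergodic on $(X^{k+1},\mu_0\otimes\cdots\otimes\mu_k)$. Then for every Borel probability measure $\nu$ on $X$ equivalent to $\lambda$ (i.e. with the same null sets), $T_0,\dots,T_k$ are uniformly jointly ergodic with respect to $(\nu;\mu_0,\dots,\mu_k)$: each $\mu_i$ is a $T_i$-invariant probability measure equivalent to $\nu$, and for all complex-valued $f_0,\dots,f_k\in L^\infty(\nu)$, $$\lim_{N-M\to\infty}\frac1{N-M}\sum_{n=M}^{N-1}\prod_{i=0}^k f_i(T_i^nx)=\prod_{i=0}^k\int f_i\,d\mu_i\quad\text{in }L^2(\nu),$$ where $M,N$ range over the non-negative integers. -/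

import Mathlib

open MeasureTheory Filter Topology Set
open scoped ENNReal NNReal

noncomputable section

/-- Shannon entropy (natural logarithm) of the finite partition of `X` into the level sets of
`ξ : X → α`. -/
def finEntropy {X α : Type*} [MeasurableSpace X] [Fintype α] (μ : Measure X) (ξ : X → α) : ℝ :=
  ∑ a, Real.negMulLog (μ.real (ξ ⁻¹' {a}))

/-- The join of the pulled back partitions `T⁻ʲ ξ`, `0 ≤ j < n`: a point is labelled by its
itinerary of length `n`. -/
def itinerary {X α : Type*} (T : X → X) (ξ : X → α) (n : ℕ) : X → (Fin n → α) :=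
  fun x j => ξ (T^[j] x)

/-- Entropy of `T` relative to a finite partition: the limit of the entropies of the `n`-fold joins
divided by `n`. For measure preserving `T` the limit exists, by subadditivity, so that writing it
as an upper limit changes nothing. -/
def partitionEntropy {X α : Type*} [MeasurableSpace X] [Fintype α] (T : X → X) (μ : Measure X)
    (ξ : X → α) : ℝ≥0∞ :=
  limsup (fun n : ℕ => ENNReal.ofReal (finEntropy μ (itinerary T ξ n) / n)) atTop

/-- Kolmogorov-Sinai entropy: the supremum of the relative entropies over all finite measurable
partitions; a partition into `m` measurable pieces (possibly empty) is a measurable map to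
`Fin m`. -/
def ksEntropy {X : Type*} [MeasurableSpace X] (T : X → X) (μ : Measure X) : ℝ≥0∞ :=
  ⨆ (m : ℕ) (ξ : X → Fin m) (_ : Measurable ξ), partitionEntropy T μ ξ

/-- The interior in `ℝ` of a subset of `[0,1]` (so that `0` and `1` are never interior). -/
def realInterior (I : Set unitInterval) : Set unitInterval :=
  Subtype.val ⁻¹' interior (Subtype.val '' I : Set ℝ)

/-- A finite or countable collection of nondegenerate intervals in `[0,1]` (open, closed or half
open), with disjoint interiors, which covers `[0,1]` up to a Lebesgue null set. -/
structure IsIntervalPartition (𝒜 : Set (Set unitInterval)) : Prop where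
  countable : 𝒜.Countable
  interval : ∀ I ∈ 𝒜, I.OrdConnected
  nonempty_interior : ∀ I ∈ 𝒜, (realInterior I).Nonempty
  disjoint_interior : 𝒜.PairwiseDisjoint realInterior
  cover : volume (⋃₀ 𝒜)ᶜ = 0

/-- The `σ`-algebra generated by the partitions `T⁻ʲ 𝒜`, `0 ≤ j < l`. -/
abbrev cylinderAlgebra (T : unitInterval → unitInterval) (𝒜 : Set (Set unitInterval)) (l : ℕ) :
    MeasurableSpace unitInterval :=
  ⨆ j < l, (MeasurableSpace.generateFrom 𝒜).comap T^[j]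

/-- The `σ`-algebra generated by the partitions `T⁻ʲ 𝒜`, `j ≥ 0`. -/
abbrev fullCylinderAlgebra (T : unitInterval → unitInterval) (𝒜 : Set (Set unitInterval)) :
    MeasurableSpace unitInterval :=
  ⨆ j : ℕ, (MeasurableSpace.generateFrom 𝒜).comap T^[j]

/-- The class `𝒯` of systems `(T, μ, 𝒜)`: the probability measure `μ` on `[0,1]` is `T`-invariant,
ergodic and comparable to Lebesgue measure, and `T` is piecewise monotone with respect to the
generating partition `𝒜`, which has finite entropy. -/
structure ClassT (T : unitInterval → unitInterval) (μ : Measure unitInterval)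
    (𝒜 : Set (Set unitInterval)) : Prop where
  prob : IsProbabilityMeasure μ
  ergodic : Ergodic T μ
  comparable : ∃ c : ℝ≥0, 1 ≤ c ∧ μ ≤ c • volume ∧ volume ≤ c • μ
  partition : IsIntervalPartition 𝒜
  continuousOn : ∀ I ∈ 𝒜, ContinuousOn T (realInterior I)
  strictMono : ∀ I ∈ 𝒜, StrictMonoOn T (realInterior I) ∨ StrictAntiOn T (realInterior I)
  generates : ∀ B : Set unitInterval, MeasurableSet B →
    ∃ B' : Set unitInterval, MeasurableSet[fullCylinderAlgebra T 𝒜] B' ∧ B =ᵐ[volume] B'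
  finite_entropy : Summable fun I : 𝒜 => Real.negMulLog (μ.real (I : Set unitInterval))

/-- Property B of a system `(T, μ, 𝒜)`. -/
def HasPropertyB (T : unitInterval → unitInterval) (μ : Measure unitInterval)
    (𝒜 : Set (Set unitInterval)) : Prop :=
  ∃ (c : ℝ) (b : ℕ → ℝ), 0 < c ∧ (∀ n, 0 < b n) ∧ Tendsto b atTop (𝓝 0) ∧
    ∀ (l n : ℕ), 1 ≤ l → ∀ A B : Set unitInterval,
      MeasurableSet[cylinderAlgebra T 𝒜 l] A → MeasurableSet B →
        μ.real (A ∩ T^[n + l] ⁻¹' B) ≤ c * μ.real A * μ.real B + b n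

/-- The filter `N - M → ∞` on pairs `(M, N)` of natural numbers. -/
def uniformFilter : Filter (ℕ × ℕ) :=
  comap (fun p : ℕ × ℕ => (p.2 : ℤ) - (p.1 : ℤ)) atTop

/-- Uniform joint ergodicity of the family `T` with respect to `(ν; μ)`: each `μ i` is
a `T i`-invariant probability measure equivalent to `ν`, and the uniform multiple ergodic averages
of any functions in `L^∞` converge in `L²(ν)` to the product of the integrals. -/
structure UniformlyJointlyErgodic {X ι : Type*} [MeasurableSpace X] [Fintype ι] (ν : Measure X)
    (μ : ι → Measure X) (T : ι → X → X) : Prop where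
  prob : ∀ i, IsProbabilityMeasure (μ i)
  measurePreserving : ∀ i, MeasurePreserving (T i) (μ i) (μ i)
  equivalent : ∀ i, μ i ≪ ν ∧ ν ≪ μ i
  tendsto : ∀ f : ι → X → ℂ, (∀ i, MemLp (f i) ∞ ν) →
    Tendsto (fun p : ℕ × ℕ =>
        eLpNorm (fun x => ((p.2 : ℂ) - (p.1 : ℂ))⁻¹ *
            (∑ n ∈ Finset.Ico p.1 p.2, ∏ i, f i ((T i)^[n] x)) - ∏ i, ∫ y, f i y ∂(μ i)) 2 ν)
      uniformFilter (𝓝 0)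

end

/-! Write `κ` for the product of the `μ i` and `λ_n` for the image of Lebesgue measure under `x ↦
(T₀ⁿ x, ..., Tₖⁿ x)`. The heart of the matter is a domination: there is one constant `C` such that,
on every rectangle and up to an error tending to zero, `λ_n ≤ C κ`.

Domination and ergodicity of the product give convergence. Let `F = ∏ fᵢ`, first with finitely many
values, and `c = ∫ F dκ`. The squared deviation from `c` of the average of `F` over a window of
length `H` is a nonnegative finite combination of indicators of rectangles, so its `λ_n`-integral is
at most `C` times its `κ`-integral plus a small error. The mean ergodic theorem for the product
makes the `κ`-integral small for a suitable `H`, chosen before `n`. All late windows of length `H`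
are then nearly constant in L², and averaging over windows gives the uniform limit. Absolute
continuity replaces Lebesgue measure by `ν`. The lemmas are `exists_window_average_small` and
`tendsto_uniform_average_zero`.

The domination is proved by induction on the number of maps, where entropy and property B enter.
Choose `η < η₁` between the entropies of the last two maps. Cylinders of a piecewise monotone map
are intervals, and about `exp (n η)` cylinders of length `n` of each earlier map carry most of the
space. Hence the set `Sₙ` cut out by the earlier maps has, up to small measure, about `exp (n η)`
endpoints (`ClassT.cutRate_preimage`). Most cylinders of length `l` of the last map have measure at
most `exp (-l η₁)`. With `n = m + l` and `m` fixed, those cut by an endpoint of `Sₙ` have negligible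
total measure, so `Sₙ` is nearly a union of cylinders of length `l`. Property B with gap `m` then
decouples it from the preimage of a set under the `n`-th iterate of the last map
(`ClassT.exists_const_measureReal_inter_preimage_le`).

The two entropy facts replace the Shannon–McMillan–Breiman theorem and need only the mean ergodic
theorem. The count of cylinders comes from a subprobability weight on words, built from conditional
probabilities of finite order (`exists_covering_words`). The bound on their size follows from that
count: too many large cylinders would leave too little entropy. -/

/-! ### The mean ergodic theorem in L². -/

theorem sq_norm_toLp_two {Y 𝕜 : Type*} [MeasurableSpace Y] [RCLike 𝕜] {κ : Measure Y}
    {f : Y → 𝕜} (hf : MemLp f 2 κ) : ‖hf.toLp f‖ ^ 2 = ∫ y, ‖f y‖ ^ 2 ∂κ := by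
  have h1 : inner 𝕜 (hf.toLp f) (hf.toLp f) = ((‖hf.toLp f‖ ^ 2 : ℝ) : 𝕜) := by
    simp [inner_self_eq_norm_sq_to_K]
  have h2 : inner 𝕜 (hf.toLp f) (hf.toLp f) = ((∫ y, ‖f y‖ ^ 2 ∂κ : ℝ) : 𝕜) := by
    rw [L2.inner_def, ← integral_ofReal]
    refine integral_congr_ae ?_
    filter_upwards [hf.coeFn_toLp] with y hy
    rw [hy]
    simp [inner_self_eq_norm_sq_to_K]
  exact_mod_cast h1.symm.trans h2

/-- The mean ergodic theorem for an ergodic map of a probability space. -/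
theorem Ergodic.tendsto_integral_norm_average_sub_sq {Y 𝕜 : Type*} [MeasurableSpace Y] [RCLike 𝕜]
    {κ : Measure Y} [IsProbabilityMeasure κ] {T : Y → Y} (hT : Ergodic T κ) {F : Y → 𝕜}
    (hF : MemLp F 2 κ) :
    Tendsto (fun H : ℕ => ∫ y, ‖(H : 𝕜)⁻¹ * ∑ h ∈ Finset.range H, F (T^[h] y) - ∫ z, F z ∂κ‖ ^ 2 ∂κ)
      atTop (𝓝 0) := by
  have hmp := hT.toMeasurePreserving
  set U := Lp.compMeasurePreservingₗᵢ (E := 𝕜) (p := 2) 𝕜 T hmp with hU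
  set x := hF.toLp F with hx
  -- The averages converge to the projection `z` onto the fixed space of the Koopman operator.
  -- Ergodicity makes `z` constant, and pairing with the function `1` identifies the constant, since
  -- every nonempty average of `F` has integral `∫ F`.
  set S := U.toContinuousLinearMap.eqLocus (1 : Lp 𝕜 2 κ →L[𝕜] Lp 𝕜 2 κ) with hS
  set z : Lp 𝕜 2 κ := (S.orthogonalProjectionOnto x).1 with hz
  have hlim : Tendsto (birkhoffAverage 𝕜 U _root_.id · x) atTop (𝓝 z) := by
    exact
    U.toContinuousLinearMap.tendsto_birkhoffAverage_orthogonalProjection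
      U.norm_toContinuousLinearMap_le x
  have hiter : ∀ n, (U : Lp 𝕜 2 κ → Lp 𝕜 2 κ)^[n] x
      = (hF.comp_measurePreserving (hmp.iterate n)).toLp (F ∘ T^[n]) := by
    intro n
    have := congrFun (Lp.compMeasurePreserving_iterate (E := 𝕜) (p := 2) hmp n) x
    refine Eq.trans this ?_
    exact Lp.toLp_compMeasurePreserving hF (hmp.iterate n)
  have hzfix : U z = z := (S.orthogonalProjectionOnto x).2
  have hinv : z ∘ T =ᵐ[κ] z := by
    have h1 := Lp.coeFn_compMeasurePreserving z hmp
    have h2 : Lp.compMeasurePreserving T hmp z = z := hzfix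
    rw [h2] at h1
    exact h1.symm
  obtain ⟨c, hc⟩ := hT.ae_eq_const_of_ae_eq_comp_ae (Lp.aestronglyMeasurable z) hinv
  have hone : ∀ g : Lp 𝕜 2 κ, inner 𝕜 (indicatorConstLp 2 MeasurableSet.univ
      (measure_ne_top κ univ) (1 : 𝕜)) g = ∫ y, g y ∂κ := by
    intro g
    rw [L2.inner_indicatorConstLp_one, setIntegral_univ]
  have hint : ∀ n : ℕ, n ≠ 0 → inner 𝕜 (indicatorConstLp 2 MeasurableSet.univ
      (measure_ne_top κ univ) (1 : 𝕜)) (birkhoffAverage 𝕜 U _root_.id n x) = ∫ y, F y ∂κ := by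
    intro n hn
    rw [birkhoffAverage, birkhoffSum, inner_smul_right, inner_sum]
    have : ∀ h ∈ Finset.range n, inner 𝕜 (indicatorConstLp 2 MeasurableSet.univ
      (measure_ne_top κ univ) (1 : 𝕜)) (_root_.id (U^[h] x)) = ∫ y, F y ∂κ := by
      intro h _
      rw [id, hiter, hone]
      rw [integral_congr_ae (MemLp.coeFn_toLp _)]
      have hm := hmp.iterate h
      have := integral_map hm.aemeasurable (f := F) (by rw [hm.map_eq]; exact hF.1)
      rw [hm.map_eq] at this
      exact this.symm
    rw [Finset.sum_congr rfl this]
    have hn' : (n : 𝕜) ≠ 0 := by exact_mod_cast hn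
    simp [hn']
  have hcint : c = ∫ y, F y ∂κ := by
    have h1 : Tendsto (fun n => inner 𝕜 (indicatorConstLp 2 MeasurableSet.univ
      (measure_ne_top κ univ) (1 : 𝕜)) (birkhoffAverage 𝕜 U _root_.id n x)) atTop
        (𝓝 (inner 𝕜 (indicatorConstLp 2 MeasurableSet.univ
      (measure_ne_top κ univ) (1 : 𝕜)) z)) := tendsto_const_nhds.inner hlim
    have h2 : inner 𝕜 (indicatorConstLp 2 MeasurableSet.univ
      (measure_ne_top κ univ) (1 : 𝕜)) z = c := by
      rw [hone, integral_congr_ae hc]; simp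
    rw [h2] at h1
    refine tendsto_nhds_unique h1 (tendsto_const_nhds.congr' ?_)
    filter_upwards [eventually_ne_atTop 0] with n hn using (hint n hn).symm
  have hnorm : ∀ H : ℕ, ‖birkhoffAverage 𝕜 U _root_.id H x - z‖ ^ 2 =
      ∫ y, ‖(H : 𝕜)⁻¹ * ∑ h ∈ Finset.range H, F (T^[h] y) - ∫ z, F z ∂κ‖ ^ 2 ∂κ := by
    intro H
    have hmem : MemLp (fun y => (H : 𝕜)⁻¹ * ∑ h ∈ Finset.range H, F (T^[h] y) - ∫ z, F z ∂κ) 2 κ := by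
      refine MemLp.sub (MemLp.const_mul (memLp_finsetSum (f := fun h y => F (T^[h] y)) _ fun h _ => ?_) _) (memLp_const _)
      exact (hF.comp_measurePreserving (hmp.iterate h) :)
    rw [← sq_norm_toLp_two hmem]
    congr 2
    have hU : ∀ᵐ y ∂κ, ∀ h : ℕ, (U^[h] x : Lp 𝕜 2 κ) y = F (T^[h] y) := by
      rw [ae_all_iff]; intro h
      rw [hiter]
      exact MemLp.coeFn_toLp _
    refine Lp.ext ?_
    refine EventuallyEq.trans ?_ (MemLp.coeFn_toLp hmem).symm
    refine (Lp.coeFn_sub _ _).trans ?_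
    rw [birkhoffAverage, birkhoffSum]
    filter_upwards [hU, hc, Lp.coeFn_smul (H : 𝕜)⁻¹ (∑ h ∈ Finset.range H, _root_.id (U^[h] x)),
      Lp.coeFn_finsetSum (Finset.range H) (fun h => _root_.id (U^[h] x))] with y h1 h2 h3 h4
    rw [Pi.sub_apply, h3, Pi.smul_apply, h4, Finset.sum_apply, h2, ← hcint, smul_eq_mul]
    simp only [id, h1, Function.const]
  simp_rw [← hnorm]
  have := (tendsto_iff_norm_sub_tendsto_zero.1 hlim).pow 2
  simpa using this

/-! ### Uniform Cesàro averages. -/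

theorem eventually_uniformFilter {p : ℕ × ℕ → Prop} (L₀ : ℕ)
    (h : ∀ M N : ℕ, M ≤ N → L₀ ≤ N - M → p (M, N)) : ∀ᶠ q in uniformFilter, p q := by
  have : ∀ᶠ z : ℤ in atTop, (L₀ : ℤ) ≤ z := eventually_ge_atTop _
  refine (this.comap _).mono ?_
  rintro ⟨M, N⟩ hMN
  simp only at hMN
  exact h M N (by omega) (by omega)

/-- Each unit shift only exchanges one boundary term for another, at cost at most `2 R`. -/
theorem norm_sum_Ico_sub_shift_le {E : Type*} [SeminormedAddCommGroup E] {v : ℕ → E} {R : ℝ}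
    (hR : ∀ n, ‖v n‖ ≤ R) {M N : ℕ} (hMN : M ≤ N) (h : ℕ) :
    ‖∑ n ∈ Finset.Ico M N, v n - ∑ n ∈ Finset.Ico M N, v (n + h)‖ ≤ 2 * h * R := by
  induction h with
  | zero => simp
  | succ h ih =>
    have h1 : ∑ n ∈ Finset.Ico M N, v (n + h) - ∑ n ∈ Finset.Ico M N, v (n + (h + 1))
        = v (M + h) - v (N + h) := by
      rw [← Finset.sum_sub_distrib, ← neg_inj, ← Finset.sum_neg_distrib]
      simp only [neg_sub, ← Nat.add_assoc, Nat.add_right_comm _ h 1]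
      exact Finset.sum_Ico_sub (fun n => v (n + h)) hMN
    have h2 : ∑ n ∈ Finset.Ico M N, v n - ∑ n ∈ Finset.Ico M N, v (n + (h + 1)) =
        (∑ n ∈ Finset.Ico M N, v n - ∑ n ∈ Finset.Ico M N, v (n + h)) + (v (M + h) - v (N + h)) := by
      rw [← h1]; abel
    rw [h2]
    refine (norm_add_le _ _).trans ?_
    have := norm_sub_le (v (M + h)) (v (N + h))
    have := hR (M + h)
    have := hR (N + h)
    push_cast
    linarith

/-- If the averages over windows of a fixed length are eventually small, so are the uniform
Cesàro averages. -/
theorem tendsto_uniform_average_zero {E : Type*} [NormedAddCommGroup E] [NormedSpace ℂ E]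
    {v : ℕ → E} {R : ℝ} (hR : ∀ n, ‖v n‖ ≤ R)
    (hv : ∀ ε > 0, ∃ H : ℕ, H ≠ 0 ∧
      ∀ᶠ n in atTop, ‖(H : ℂ)⁻¹ • ∑ h ∈ Finset.range H, v (n + h)‖ ≤ ε) :
    Tendsto (fun p : ℕ × ℕ => ((p.2 : ℂ) - (p.1 : ℂ))⁻¹ • ∑ n ∈ Finset.Ico p.1 p.2, v n)
      uniformFilter (𝓝 0) := by
  have hR0 : 0 ≤ R := (norm_nonneg _).trans (hR 0)
  rw [Metric.tendsto_nhds]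
  intro ε hε
  obtain ⟨H, hH, hev⟩ := hv (ε / 3) (by positivity)
  obtain ⟨n₀, hn₀⟩ := eventually_atTop.1 hev
  -- Two errors do not grow with the length `N - M`: the at most `n₀` early windows, each of norm at
  -- most `R`, and the cost `2 H R` of replacing `v` by its window averages `w`. Beyond `L₀` both
  -- are below `ε / 3` per term.
  obtain ⟨L₀, hL₀⟩ := exists_nat_gt ((n₀ * R + 2 * H * R) / (ε / 3))
  refine eventually_uniformFilter (L₀ + 1) fun M N hMN hL => ?_
  rw [dist_zero_right]
  set w : ℕ → E := fun n => (H : ℂ)⁻¹ • ∑ h ∈ Finset.range H, v (n + h) with hw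
  have hHc : (H : ℂ) ≠ 0 := by exact_mod_cast hH
  have hHpos : (0 : ℝ) < H := by exact_mod_cast Nat.pos_of_ne_zero hH
  have hwR : ∀ n, ‖w n‖ ≤ R := by
    intro n
    rw [hw]; simp only
    rw [norm_smul, norm_inv, Complex.norm_natCast, inv_mul_le_iff₀ hHpos]
    refine (norm_sum_le _ _).trans ((Finset.sum_le_sum fun h _ => hR (n + h)).trans ?_)
    simp
  have hdiff : ‖∑ n ∈ Finset.Ico M N, v n - ∑ n ∈ Finset.Ico M N, w n‖ ≤ 2 * H * R := by
    have h1 : ∑ n ∈ Finset.Ico M N, v n - ∑ n ∈ Finset.Ico M N, w n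
        = (H : ℂ)⁻¹ • ∑ h ∈ Finset.range H,
          (∑ n ∈ Finset.Ico M N, v n - ∑ n ∈ Finset.Ico M N, v (n + h)) := by
      rw [Finset.sum_sub_distrib, Finset.sum_const, Finset.card_range, smul_sub,
        ← Nat.cast_smul_eq_nsmul ℂ, smul_smul, inv_mul_cancel₀ hHc, one_smul, Finset.sum_comm,
        Finset.smul_sum]
    rw [h1, norm_smul, norm_inv, Complex.norm_natCast, inv_mul_le_iff₀ hHpos]
    refine (norm_sum_le _ _).trans ((Finset.sum_le_card_nsmul _ _ (2 * H * R) fun h hh => ?_).trans ?_)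
    · refine (norm_sum_Ico_sub_shift_le hR hMN h).trans ?_
      have : (h : ℝ) ≤ H := by exact_mod_cast (Finset.mem_range.1 hh).le
      gcongr
    · simp
  have hwsum : ‖∑ n ∈ Finset.Ico M N, w n‖ ≤ n₀ * R + (N - M : ℕ) * (ε / 3) := by
    refine (norm_sum_le _ _).trans ?_
    calc ∑ n ∈ Finset.Ico M N, ‖w n‖
        ≤ ∑ n ∈ Finset.Ico M N, ((if n < n₀ then R else 0) + ε / 3) := by
          refine Finset.sum_le_sum fun n _ => ?_
          split_ifs with h
          · linarith [hwR n]
          · linarith [hn₀ n (not_lt.1 h)]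
      _ ≤ n₀ * R + (N - M : ℕ) * (ε / 3) := by
          rw [Finset.sum_add_distrib, Finset.sum_const, Nat.card_Ico, nsmul_eq_mul]
          gcongr
          rw [← Finset.sum_filter, Finset.sum_const, nsmul_eq_mul]
          gcongr
          calc _ ≤ (Finset.range n₀).card := Finset.card_le_card fun n hn => by
                simp at hn; simp [hn.2]
            _ = n₀ := Finset.card_range _
  have hLpos : (0 : ℝ) < (N - M : ℕ) := by
    have : 0 < N - M := by omega
    exact_mod_cast this
  have hcast : ((N : ℂ) - (M : ℂ)) = ((N - M : ℕ) : ℂ) := by rw [Nat.cast_sub hMN]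
  simp only
  rw [hcast, norm_smul, norm_inv, Complex.norm_natCast, inv_mul_lt_iff₀ hLpos]
  have h3 : ‖∑ n ∈ Finset.Ico M N, v n‖ ≤ 2 * H * R + (n₀ * R + (N - M : ℕ) * (ε / 3)) := by
    have := norm_add_le (∑ n ∈ Finset.Ico M N, v n - ∑ n ∈ Finset.Ico M N, w n)
      (∑ n ∈ Finset.Ico M N, w n)
    rw [sub_add_cancel] at this
    linarith
  have h4 : n₀ * R + 2 * H * R < (N - M : ℕ) * (ε / 3) := by
    rw [div_lt_iff₀ (by positivity)] at hL₀
    refine hL₀.trans_le ?_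
    gcongr
    omega
  nlinarith [mul_pos hLpos hε]

/-! ### Approximation of measures and functions. -/

/-- A finite measure `ν ≪ m` integrates bounded functions up to `ε` like a multiple of `m`. -/
theorem exists_integral_le_mul_integral_add {X : Type*} [MeasurableSpace X] {m ν : Measure X}
    [IsFiniteMeasure m] [IsFiniteMeasure ν] (h : ν ≪ m) {R ε : ℝ} (hε : 0 < ε) :
    ∃ K : ℝ, 0 ≤ K ∧ ∀ g : X → ℝ, Measurable g → (∀ x, 0 ≤ g x) → (∀ x, g x ≤ R) →
      ∫ x, g x ∂ν ≤ K * ∫ x, g x ∂m + ε := by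
  rcases le_or_gt R 0 with hR | hR
  · refine ⟨0, le_rfl, fun g _ h0 h1 => ?_⟩
    have : ∀ x, g x = 0 := fun x => le_antisymm ((h1 x).trans hR) (h0 x)
    simp [this, hε.le]
  set ρ := ν.rnDeriv m with hρ
  have hρm : Measurable ρ := Measure.measurable_rnDeriv _ _
  -- Truncate the density: `ρ ≤ K + (ρ - K)`, with truncated subtraction. The excess has small
  -- integral for large `K` by dominated convergence, and it is multiplied by at most `R`, hence the
  -- threshold `ε / R` below.
  have hlim : Tendsto (fun K : ℕ => ∫⁻ x, (ρ x - K) ∂m) atTop (𝓝 0) := by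
    have : (0 : ℝ≥0∞) = ∫⁻ _, 0 ∂m := by simp
    rw [this]
    refine tendsto_lintegral_of_dominated_convergence ρ (fun K => by fun_prop)
      (fun K => ae_of_all _ fun x => tsub_le_self) ?_ ?_
    · exact (Measure.lintegral_rnDeriv_lt_top ν m).ne
    · filter_upwards [Measure.rnDeriv_lt_top ν m] with x hx
      obtain ⟨K, hK⟩ := ENNReal.exists_nat_gt hx.ne
      refine tendsto_const_nhds.congr' ?_
      filter_upwards [eventually_ge_atTop K] with n hn
      refine (tsub_eq_zero_of_le (hK.le.trans ?_)).symm
      exact_mod_cast hn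
  have hpos : (0 : ℝ≥0∞) < ENNReal.ofReal (ε / R) := by simpa using div_pos hε hR
  obtain ⟨K, hK⟩ := (hlim.eventually_lt_const hpos).exists
  refine ⟨K, K.cast_nonneg, fun g hg h0 h1 => ?_⟩
  have hgi : ∀ (m' : Measure X) [IsFiniteMeasure m'], Integrable g m' := fun m' _ =>
    Integrable.of_bound hg.aestronglyMeasurable R
      (ae_of_all _ fun x => by rw [Real.norm_eq_abs, abs_of_nonneg (h0 x)]; exact h1 x)
  have key : ∫⁻ x, ENNReal.ofReal (g x) ∂ν ≤
      ENNReal.ofReal (K * ∫ x, g x ∂m + ε) := by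
    calc ∫⁻ x, ENNReal.ofReal (g x) ∂ν
        = ∫⁻ x, ENNReal.ofReal (g x) ∂(m.withDensity ρ) := by
          rw [Measure.withDensity_rnDeriv_eq ν m h]
      _ = ∫⁻ x, ρ x * ENNReal.ofReal (g x) ∂m :=
          lintegral_withDensity_eq_lintegral_mul _ hρm (by fun_prop)
      _ ≤ ∫⁻ x, (K * ENNReal.ofReal (g x) + ENNReal.ofReal R * (ρ x - K)) ∂m := by
          refine lintegral_mono fun x => ?_
          calc ρ x * ENNReal.ofReal (g x) ≤ (K + (ρ x - K)) * ENNReal.ofReal (g x) := by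
                gcongr; exact le_add_tsub
            _ = K * ENNReal.ofReal (g x) + ENNReal.ofReal (g x) * (ρ x - K) := by ring
            _ ≤ _ := by gcongr; exact h1 x
      _ = K * ∫⁻ x, ENNReal.ofReal (g x) ∂m + ENNReal.ofReal R * ∫⁻ x, (ρ x - K) ∂m := by
          rw [lintegral_add_left (by fun_prop), lintegral_const_mul _ (by fun_prop),
            lintegral_const_mul _ (by fun_prop)]
      _ ≤ K * ENNReal.ofReal (∫ x, g x ∂m) + ENNReal.ofReal R * ENNReal.ofReal (ε / R) := by
          rw [ofReal_integral_eq_lintegral_ofReal (hgi m) (ae_of_all _ h0)]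
          gcongr
      _ = _ := by
          have hm0 : 0 ≤ ∫ x, g x ∂m := integral_nonneg h0
          rw [← ENNReal.ofReal_natCast, ← ENNReal.ofReal_mul K.cast_nonneg, ← ENNReal.ofReal_mul hR.le,
            ← ENNReal.ofReal_add (by positivity) (by positivity)]
          congr 1
          field_simp
  rw [← ofReal_integral_eq_lintegral_ofReal (hgi ν) (ae_of_all _ h0)] at key
  exact (ENNReal.ofReal_le_ofReal_iff (by
    have hm0 : 0 ≤ ∫ x, g x ∂m := integral_nonneg h0
    positivity)).1 key

/-- Functions bounded by `B` are uniformly approximated by functions with values in a common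
finite set. -/
theorem exists_finite_net (B : ℝ) {ε : ℝ} (hε : 0 < ε) : ∃ (N : ℕ) (z : Fin N → ℂ),
    ∀ {X : Type*} [MeasurableSpace X] [Nonempty X] (f : X → ℂ), Measurable f → (∀ x, ‖f x‖ ≤ B) →
      ∃ σ : X → Fin N, Measurable σ ∧ ∀ x, ‖f x - z (σ x)‖ ≤ ε := by
  obtain ⟨t, -, htf, htc⟩ := (isCompact_closedBall (0 : ℂ) B).finite_cover_balls hε
  obtain ⟨N, z, hz⟩ : ∃ (N : ℕ) (z : Fin N → ℂ), range z = t := by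
    refine ⟨_, fun i => (htf.toFinset.equivFin.symm i : ℂ), ?_⟩
    ext x
    constructor
    · rintro ⟨i, rfl⟩
      exact htf.mem_toFinset.1 (htf.toFinset.equivFin.symm i).2
    · intro hx
      exact ⟨htf.toFinset.equivFin ⟨x, htf.mem_toFinset.2 hx⟩, by simp⟩
  refine ⟨N, z, fun {X} _ _ f hf hfB => ?_⟩
  have hcov : ∀ x, ∃ i : ℕ, ∃ h : i < N, ‖f x - z ⟨i, h⟩‖ < ε := by
    intro x
    have : f x ∈ ⋃ y ∈ t, Metric.ball y ε := htc (by simpa using hfB x)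
    simp only [mem_iUnion, Metric.mem_ball, dist_eq_norm] at this
    obtain ⟨y, hy, hxy⟩ := this
    rw [← hz] at hy
    obtain ⟨i, rfl⟩ := hy
    exact ⟨i, i.2, hxy⟩
  classical
  -- Taking the least admissible index makes the selection measurable.
  have hm : Measurable fun x => Nat.find (hcov x) := by
    refine measurable_find _ fun i => ?_
    by_cases h : i < N
    · simp only [h, exists_true_left]
      exact measurableSet_lt (by fun_prop) measurable_const
    · simp [h]
  refine ⟨fun x => ⟨Nat.find (hcov x), (Nat.find_spec (hcov x)).1⟩, ?_, fun x =>
    (Nat.find_spec (hcov x)).2.le⟩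
  refine measurable_to_countable' fun i => ?_
  have : (fun x => (⟨Nat.find (hcov x), (Nat.find_spec (hcov x)).1⟩ : Fin N)) ⁻¹' {i}
      = (fun x => Nat.find (hcov x)) ⁻¹' {(i : ℕ)} := by
    ext x; simp [Fin.ext_iff]
  rw [this]
  exact hm (measurableSet_singleton _)

theorem iterate_pi_apply {ι : Type*} {X : ι → Type*} (T : ∀ i, X i → X i) (n : ℕ) (y : ∀ i, X i) :
    (fun (x : ∀ i, X i) i => T i (x i))^[n] y = fun i => (T i)^[n] (y i) := by
  induction n generalizing y with
  | zero => rfl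
  | succ n ih => simp [Function.iterate_succ_apply, ih]

theorem integral_comp_finite {Y γ : Type*} [MeasurableSpace Y] [Fintype γ] [MeasurableSpace γ]
    [MeasurableSingletonClass γ] (m : Measure Y) [IsFiniteMeasure m] {ψ : Y → γ}
    (hψ : Measurable ψ) (g : γ → ℝ) : ∫ y, g (ψ y) ∂m = ∑ w, g w * m.real (ψ ⁻¹' {w}) := by
  have hg : AEStronglyMeasurable g (m.map ψ) := (measurable_of_finite g).aestronglyMeasurable
  rw [← integral_map (f := g) hψ.aemeasurable hg, integral_fintype]
  · refine Finset.sum_congr rfl fun w _ => ?_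
    rw [map_measureReal_apply hψ (measurableSet_singleton _), smul_eq_mul, mul_comm]
  · exact Integrable.of_finite

/-! ### From domination on rectangles to joint ergodicity. -/

section Criterion

variable {X : Type*} [MeasurableSpace X] {ι : Type*} [Fintype ι] {m ν : Measure X}
  [IsFiniteMeasure m] [IsProbabilityMeasure ν] {T : ι → X → X} {μ : ι → Measure X}
  [∀ i, IsProbabilityMeasure (μ i)]

/-- A function of finitely many labels is a finite combination of indicators of rectangles.
Nonnegativity of the coefficients lets the one-sided bound pass to the sum, and the rectangle
tolerance `ε / (S + 1)` keeps the total error below `ε`. -/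
theorem integral_diagonal_le {γ : Type*} [Fintype γ] [MeasurableSpace γ]
    [MeasurableSingletonClass γ] (hT : ∀ i, Measurable (T i)) {C : ℝ}
    (hD : ∀ A : ι → Set X, (∀ i, MeasurableSet (A i)) → ∀ ε > 0,
      ∀ᶠ n in atTop, m.real (⋂ i, (T i)^[n] ⁻¹' A i) ≤ C * ∏ i, (μ i).real (A i) + ε)
    {ψ : ι → X → γ} (hψ : ∀ i, Measurable (ψ i)) {g : (ι → γ) → ℝ} (hg : ∀ w, 0 ≤ g w)
    {ε : ℝ} (hε : 0 < ε) :
    ∀ᶠ n in atTop, ∫ x, g (fun i => ψ i ((T i)^[n] x)) ∂m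
      ≤ C * ∫ y, g (fun i => ψ i (y i)) ∂(Measure.pi μ) + ε := by
  classical
  set S := ∑ w, g w with hS
  have hS0 : 0 ≤ S := Finset.sum_nonneg fun w _ => hg w
  have h1 : ∀ᶠ n in atTop, ∀ w : ι → γ, m.real (⋂ i, (T i)^[n] ⁻¹' (ψ i ⁻¹' {w i}))
      ≤ C * ∏ i, (μ i).real (ψ i ⁻¹' {w i}) + ε / (S + 1) := by
    rw [eventually_all]
    intro w
    exact hD _ (fun i => hψ i (measurableSet_singleton _)) _ (by positivity)
  filter_upwards [h1] with n hn
  have hm1 : Measurable fun x => (fun i => ψ i ((T i)^[n] x)) :=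
    measurable_pi_lambda _ fun i => (hψ i).comp ((hT i).iterate n)
  have hm2 : Measurable fun y : ι → X => (fun i => ψ i (y i)) :=
    measurable_pi_lambda _ fun i => (hψ i).comp (measurable_pi_apply i)
  rw [integral_comp_finite m hm1 g, integral_comp_finite _ hm2 g, Finset.mul_sum]
  calc ∑ w, g w * m.real ((fun x => (fun i => ψ i ((T i)^[n] x))) ⁻¹' {w})
      ≤ ∑ w, (C * (g w * (Measure.pi μ).real ((fun y : ι → X => (fun i => ψ i (y i))) ⁻¹' {w}))
          + g w * (ε / (S + 1))) := by
        refine Finset.sum_le_sum fun w _ => ?_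
        have e1 : (fun x => (fun i => ψ i ((T i)^[n] x))) ⁻¹' {w}
            = ⋂ i, (T i)^[n] ⁻¹' (ψ i ⁻¹' {w i}) := by
          ext x; simp [funext_iff]
        have e2 : (fun y : ι → X => (fun i => ψ i (y i))) ⁻¹' {w}
            = Set.pi univ fun i => ψ i ⁻¹' {w i} := by
          ext x; simp [funext_iff]
        rw [e1, e2, measureReal_def (Measure.pi μ), Measure.pi_pi, ENNReal.toReal_prod]
        have := mul_le_mul_of_nonneg_left (hn w) (hg w)
        simp only [measureReal_def] at this ⊢
        linarith
    _ ≤ _ := by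
        rw [Finset.sum_add_distrib, ← Finset.sum_mul, ← hS]
        have : S * (ε / (S + 1)) ≤ ε := by
          rw [mul_div_assoc', div_le_iff₀ (by positivity)]
          nlinarith
        linarith

variable (hν : ν ≪ m) (hT : ∀ i, Measurable (T i))
    (hprod : Ergodic (fun (x : ι → X) i => T i (x i)) (Measure.pi μ)) {C : ℝ} (hC : 0 ≤ C)
    (hD : ∀ A : ι → Set X, (∀ i, MeasurableSet (A i)) → ∀ ε > 0,
      ∀ᶠ n in atTop, m.real (⋂ i, (T i)^[n] ⁻¹' A i) ≤ C * ∏ i, (μ i).real (A i) + ε)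

include hν hT hprod hC hD

/-- The mean ergodic theorem is used on the product space, where the diagonal orbits form a null set
in general. Domination carries its L² conclusion to the diagonal, because a fixed window of a
finite-valued function has only finitely many patterns. -/
theorem exists_window_average_small {N : ℕ} (z : Fin N → ℂ) {σ : ι → X → Fin N}
    (hσ : ∀ i, Measurable (σ i)) {ε : ℝ} (hε : 0 < ε) :
    ∃ H : ℕ, H ≠ 0 ∧ ∀ᶠ n in atTop,
      ∫ x, ‖(H : ℂ)⁻¹ * ∑ h ∈ Finset.range H, (∏ i, z (σ i ((T i)^[n + h] x)))
        - ∫ y, ∏ i, z (σ i (y i)) ∂(Measure.pi μ)‖ ^ 2 ∂ν ≤ ε := by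
  set κ := Measure.pi μ with hκ
  set F : (ι → X) → ℂ := fun y => ∏ i, z (σ i (y i)) with hF
  set c := ∫ y, F y ∂κ with hc
  obtain ⟨b, hb⟩ : ∃ b : ℝ, ∀ w : ι → Fin N, ‖∏ i, z (w i)‖ ≤ b := by
    obtain ⟨b, hb⟩ := (Set.finite_range fun w : ι → Fin N => ‖∏ i, z (w i)‖).bddAbove
    exact ⟨b, fun w => hb ⟨w, rfl⟩⟩
  have hFm : Measurable F := by
    refine Finset.measurable_prod _ fun i _ => ?_
    exact (measurable_of_finite z).comp ((hσ i).comp (measurable_pi_apply i))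
  have hFL : MemLp F 2 κ := MemLp.of_bound hFm.aestronglyMeasurable b (ae_of_all _ fun y => hb _)
  have hcb : ‖c‖ ≤ b := by
    have := norm_integral_le_of_norm_le_const (μ := κ) (ae_of_all _ fun y => hb (fun i => σ i (y i)))
    simpa using this
  -- `g` reads a block of `H` labels in each coordinate. Evaluated at the diagonal point at time `n`
  -- (`e1`) and at a point of the product (`e2`), the same function gives both squared deviations.
  let g : ∀ H : ℕ, (ι → Fin H → Fin N) → ℝ := fun H w =>
    ‖(H : ℂ)⁻¹ * ∑ h : Fin H, (∏ i, z (w i h)) - c‖ ^ 2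
  have hg0 : ∀ H w, 0 ≤ g H w := fun H w => by positivity
  have hgb : ∀ H w, g H w ≤ (2 * b) ^ 2 := by
    intro H w
    have hb0 : 0 ≤ b := (norm_nonneg _).trans hcb
    refine pow_le_pow_left₀ (norm_nonneg _) ((norm_sub_le _ _).trans ?_) 2
    have : ‖(H : ℂ)⁻¹ * ∑ h : Fin H, (∏ i, z (w i h))‖ ≤ b := by
      rcases Nat.eq_zero_or_pos H with rfl | hH
      · simpa using hb0
      have hH' : (0 : ℝ) < H := by exact_mod_cast hH
      rw [norm_mul, norm_inv, Complex.norm_natCast, inv_mul_le_iff₀ hH']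
      refine (norm_sum_le _ _).trans ((Finset.sum_le_sum fun h _ => hb fun i => w i h).trans ?_)
      simp
    linarith
  obtain ⟨K, hK0, hK⟩ := exists_integral_le_mul_integral_add (R := (2 * b) ^ 2) hν
    (show 0 < ε / 3 by positivity)
  have herg := hprod.tendsto_integral_norm_average_sub_sq hFL
  -- The factor `K` comes from passing from `ν` to `m`, the factor `C` from passing from the
  -- diagonal to the product. The three thirds of `ε` pay for the first passage, the second passage
  -- and the ergodic average.
  have hpos : 0 < ε / 3 / (K * C + 1) := by positivity
  obtain ⟨H, hHε, hH0⟩ := ((herg.eventually_lt_const hpos).and (eventually_ne_atTop 0)).exists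
  refine ⟨H, hH0, ?_⟩
  have hdiag := integral_diagonal_le (m := m) (μ := μ) hT hD (ψ := fun i x (h : Fin H) => σ i ((T i)^[h] x))
    (fun i => measurable_pi_lambda _ fun h => (hσ i).comp ((hT i).iterate h)) (hg0 H)
    (show 0 < ε / 3 / (K + 1) by positivity)
  filter_upwards [hdiag] with n hn
  have e1 : ∀ x, g H (fun i h => σ i ((T i)^[h] ((T i)^[n] x))) =
      ‖(H : ℂ)⁻¹ * ∑ h ∈ Finset.range H, (∏ i, z (σ i ((T i)^[n + h] x))) - c‖ ^ 2 := by
    intro x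
    simp only [g]
    rw [Finset.sum_range (fun h => ∏ i, z (σ i ((T i)^[n + h] x)))]
    simp only [← Function.iterate_add_apply, Nat.add_comm n]
  have e2 : ∀ y, g H (fun i h => σ i ((T i)^[h] (y i))) =
      ‖(H : ℂ)⁻¹ * ∑ h ∈ Finset.range H, F ((fun (x : ι → X) i => T i (x i))^[h] y) - c‖ ^ 2 := by
    intro y
    simp only [g, hF, iterate_pi_apply]
    rw [Finset.sum_range (fun h => ∏ i, z (σ i ((T i)^[h] (y i))))]
  simp only [← e1]
  replace hHε : ∫ y, g H (fun i h => σ i ((T i)^[h] (y i))) ∂κ < ε / 3 / (K * C + 1) := by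
    rw [integral_congr_ae (ae_of_all _ e2)]; exact hHε
  have hmeas : Measurable fun x => g H (fun i h => σ i ((T i)^[h] ((T i)^[n] x))) := by
    refine (measurable_of_finite (g H)).comp ?_
    exact measurable_pi_lambda _ fun i => measurable_pi_lambda _ fun h =>
      (hσ i).comp (((hT i).iterate h).comp ((hT i).iterate n))
  refine (hK _ hmeas (fun x => hg0 _ _) (fun x => hgb _ _)).trans ?_
  have h5 := mul_le_mul_of_nonneg_left hn hK0
  have h6 : K * C * ∫ y, g H (fun i h => σ i ((T i)^[h] (y i))) ∂κ ≤ ε / 3 := by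
    have : K * C * ∫ y, g H (fun i h => σ i ((T i)^[h] (y i))) ∂κ
        ≤ K * C * (ε / 3 / (K * C + 1)) := by gcongr
    refine this.trans ?_
    rw [mul_div_assoc', div_le_iff₀ (by positivity)]
    nlinarith
  have h7 : K * (ε / 3 / (K + 1)) ≤ ε / 3 := by
    rw [mul_div_assoc', div_le_iff₀ (by positivity)]
    nlinarith
  nlinarith

theorem tendsto_uniform_average_finite {N : ℕ} (z : Fin N → ℂ) {σ : ι → X → Fin N}
    (hσ : ∀ i, Measurable (σ i)) :
    Tendsto (fun p : ℕ × ℕ => eLpNorm (fun x => ((p.2 : ℂ) - (p.1 : ℂ))⁻¹ *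
      (∑ n ∈ Finset.Ico p.1 p.2, ∏ i, z (σ i ((T i)^[n] x)))
        - ∫ y, ∏ i, z (σ i (y i)) ∂(Measure.pi μ)) 2 ν) uniformFilter (𝓝 0) := by
  set c := ∫ y, ∏ i, z (σ i (y i)) ∂(Measure.pi μ) with hc
  obtain ⟨b, hb⟩ : ∃ b : ℝ, ∀ w : ι → Fin N, ‖∏ i, z (w i)‖ ≤ b := by
    obtain ⟨b, hb⟩ := (Set.finite_range fun w : ι → Fin N => ‖∏ i, z (w i)‖).bddAbove
    exact ⟨b, fun w => hb ⟨w, rfl⟩⟩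
  have hmeas : ∀ n, Measurable fun x => ∏ i, z (σ i ((T i)^[n] x)) - c := fun n =>
    (Finset.measurable_prod _ fun i _ =>
      (measurable_of_finite z).comp ((hσ i).comp ((hT i).iterate n))).sub_const c
  have hbound : ∀ n x, ‖∏ i, z (σ i ((T i)^[n] x)) - c‖ ≤ b + ‖c‖ := fun n x =>
    (norm_sub_le _ _).trans (by gcongr; exact hb _)
  have hL : ∀ n, MemLp (fun x => ∏ i, z (σ i ((T i)^[n] x)) - c) 2 ν := fun n =>
    MemLp.of_bound (hmeas n).aestronglyMeasurable _ (ae_of_all _ (hbound n))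
  set v : ℕ → Lp ℂ 2 ν := fun n => (hL n).toLp _ with hv
  -- The reindexing `j` lets one identity serve both the windows `h ↦ n + h` and the full sums over
  -- `Ico M N`.
  have hcomb : ∀ (a : ℂ) (s : Finset ℕ) (j : ℕ → ℕ), ∃ hm : MemLp (fun x => a *
      ∑ n ∈ s, (∏ i, z (σ i ((T i)^[j n] x)) - c)) 2 ν, a • ∑ n ∈ s, v (j n) = hm.toLp _ := by
    intro a s j
    have hm : MemLp (fun x => a * ∑ n ∈ s, (∏ i, z (σ i ((T i)^[j n] x)) - c)) 2 ν :=
      (memLp_finsetSum (f := fun n x => ∏ i, z (σ i ((T i)^[j n] x)) - c) s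
        fun n _ => hL (j n)).const_mul a
    refine ⟨hm, Lp.ext ?_⟩
    refine EventuallyEq.trans ?_ hm.coeFn_toLp.symm
    have hall : ∀ᵐ x ∂ν, ∀ n, v n x = ∏ i, z (σ i ((T i)^[n] x)) - c :=
      ae_all_iff.2 fun n => (hL n).coeFn_toLp
    filter_upwards [hall, Lp.coeFn_smul a (∑ n ∈ s, v (j n)),
      Lp.coeFn_finsetSum s (fun n => v (j n))] with x h1 h2 h3
    rw [h2, Pi.smul_apply, h3, Finset.sum_apply, smul_eq_mul]
    simp only [h1]
  have hmain : Tendsto (fun p : ℕ × ℕ => ((p.2 : ℂ) - (p.1 : ℂ))⁻¹ •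
      ∑ n ∈ Finset.Ico p.1 p.2, v n) uniformFilter (𝓝 0) := by
    refine tendsto_uniform_average_zero (R := b + ‖c‖) (fun n => ?_) fun ε hε => ?_
    · have h1 := sq_norm_toLp_two (hL n)
      have h2 : ∫ x, ‖∏ i, z (σ i ((T i)^[n] x)) - c‖ ^ 2 ∂ν ≤ (b + ‖c‖) ^ 2 := by
        have := norm_integral_le_of_norm_le_const (μ := ν) (C := (b + ‖c‖) ^ 2)
          (f := fun x => ‖∏ i, z (σ i ((T i)^[n] x)) - c‖ ^ 2) (ae_of_all _ fun x => by
            rw [norm_pow, norm_norm]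
            exact pow_le_pow_left₀ (norm_nonneg _) (hbound n x) 2)
        simp only [probReal_univ, mul_one] at this
        exact (le_abs_self _).trans this
      obtain ⟨x⟩ : Nonempty X := ν.nonempty_of_neZero
      exact le_of_sq_le_sq (h1.trans_le h2) ((norm_nonneg _).trans (hbound n x))
    · obtain ⟨H, hH0, hH⟩ := exists_window_average_small hν hT hprod hC hD z hσ (pow_pos hε 2)
      refine ⟨H, hH0, hH.mono fun n hn => ?_⟩
      obtain ⟨hm, he⟩ := hcomb (H : ℂ)⁻¹ (Finset.range H) (fun h => n + h)
      rw [he]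
      refine le_of_sq_le_sq ?_ hε.le
      rw [sq_norm_toLp_two hm]
      refine le_trans (le_of_eq ?_) hn
      refine integral_congr_ae (ae_of_all _ fun x => ?_)
      have hHc : (H : ℂ) ≠ 0 := by exact_mod_cast hH0
      simp only [Finset.sum_sub_distrib, mul_sub, Finset.sum_const, Finset.card_range, nsmul_eq_mul]
      rw [inv_mul_cancel_left₀ hHc]
  have hmain' := (tendsto_iff_norm_sub_tendsto_zero.1 hmain)
  simp only [sub_zero] at hmain'
  have h0 := (ENNReal.tendsto_ofReal hmain')
  rw [ENNReal.ofReal_zero] at h0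
  refine h0.congr' (eventually_uniformFilter 1 fun M N hMN hL' => ?_)
  obtain ⟨hm, he⟩ := hcomb ((N : ℂ) - (M : ℂ))⁻¹ (Finset.Ico M N) (fun n => n)
  simp only at he ⊢
  rw [he, Lp.norm_toLp, ENNReal.ofReal_toReal hm.2.ne]
  congr 1
  ext x
  have hne : ((N : ℂ) - (M : ℂ)) ≠ 0 := by
    rw [← Nat.cast_sub hMN]; exact_mod_cast (by omega : N - M ≠ 0)
  rw [Finset.sum_sub_distrib, mul_sub, Finset.sum_const, Nat.card_Ico, nsmul_eq_mul,
    Nat.cast_sub hMN, inv_mul_cancel_left₀ hne]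

variable (hac : ∀ i, ν ≪ μ i) (hac' : ∀ i, μ i ≪ ν) (hmp : ∀ i, MeasurePreserving (T i) (μ i) (μ i))

include hac hac' hmp

/-- Asymptotic domination of the diagonal measures on rectangles together with ergodicity of the
product implies convergence of the uniform multiple ergodic averages. -/
theorem tendsto_uniform_average_of_rectangle_bound (f : ι → X → ℂ) (hf : ∀ i, MemLp (f i) ∞ ν) :
    Tendsto (fun p : ℕ × ℕ =>
        eLpNorm (fun x => ((p.2 : ℂ) - (p.1 : ℂ))⁻¹ *
            (∑ n ∈ Finset.Ico p.1 p.2, ∏ i, f i ((T i)^[n] x)) - ∏ i, ∫ y, f i y ∂(μ i)) 2 ν)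
      uniformFilter (𝓝 0) := by
  have hne : Nonempty X := ν.nonempty_of_neZero
  obtain ⟨B, hB0, hB⟩ : ∃ B : ℝ, 0 ≤ B ∧ ∀ i, (eLpNorm (f i) ∞ ν).toReal ≤ B := by
    refine ⟨∑ i, (eLpNorm (f i) ∞ ν).toReal, Finset.sum_nonneg fun _ _ => ENNReal.toReal_nonneg,
      fun i => ?_⟩
    exact Finset.single_le_sum (f := fun i => (eLpNorm (f i) ∞ ν).toReal)
      (fun _ _ => ENNReal.toReal_nonneg) (Finset.mem_univ i)
  -- Everywhere bounded measurable representatives are needed for the finite net. The exceptional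
  -- null sets stay null along orbits, because each `μ i` is invariant and equivalent to `ν`.
  have hf' : ∀ i, ∃ f' : X → ℂ, Measurable f' ∧ (∀ x, ‖f' x‖ ≤ B) ∧ f i =ᵐ[ν] f' := by
    intro i
    set g := (hf i).1.mk (f i) with hg
    have hgm : Measurable g := (hf i).1.stronglyMeasurable_mk.measurable
    refine ⟨fun x => if ‖g x‖ ≤ B then g x else 0, ?_, ?_, ?_⟩
    · exact Measurable.ite (measurableSet_le hgm.norm measurable_const) hgm measurable_const
    · intro x
      simp only
      split_ifs with h
      · exact h
      · simpa using hB0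
    · filter_upwards [(hf i).1.ae_eq_mk, ae_le_eLpNormEssSup (f := f i) (μ := ν)] with x h1 h2
      have h3 : ‖f i x‖ ≤ B := by
        rw [← eLpNorm_exponent_top] at h2
        refine le_trans ?_ (hB i)
        rw [← toReal_enorm]
        exact ENNReal.toReal_mono (hf i).2.ne h2
      rw [h1] at h3
      rw [← hg] at h1 h3
      simp [h3, h1]
  choose f' hfm hfB hff using hf'
  have hcomp : ∀ᵐ x ∂ν, ∀ (n : ℕ) i, f i ((T i)^[n] x) = f' i ((T i)^[n] x) := by
    rw [ae_all_iff]; intro n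
    rw [ae_all_iff]; intro i
    have h1 : ∀ᵐ x ∂(μ i), f i x = f' i x := (hac' i).ae_le (hff i)
    exact (hac i).ae_le (((hmp i).iterate n).quasiMeasurePreserving.ae h1)
  have hint : ∏ i, ∫ y, f i y ∂(μ i) = ∫ y, ∏ i, f' i (y i) ∂(Measure.pi μ) := by
    rw [integral_fintype_prod_eq_prod]
    exact Finset.prod_congr rfl fun i _ => integral_congr_ae ((hac' i).ae_le (hff i))
  rw [hint]
  rw [ENNReal.tendsto_nhds_zero]
  intro ε hε
  obtain ⟨δ, hδ0, hδ⟩ : ∃ δ : ℝ, 0 < δ ∧ ENNReal.ofReal δ ≤ ε / 2 := by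
    rcases eq_or_ne ε ∞ with rfl | h
    · exact ⟨1, one_pos, by simp [ENNReal.top_div]⟩
    · refine ⟨(ε / 2).toReal, ENNReal.toReal_pos (by simpa using hε.ne') ?_, ?_⟩
      · exact (ENNReal.div_lt_top h (by simp)).ne
      · rw [ENNReal.ofReal_toReal (ENNReal.div_lt_top h (by simp)).ne]
  -- The product map is uniformly continuous on the compact ball of radius `B + 1`, which also
  -- contains the approximating values once `θ ≤ 1`.
  obtain ⟨θ, hθ0, hθ⟩ : ∃ θ : ℝ, 0 < θ ∧ ∀ a b : ι → ℂ, (∀ i, ‖a i‖ ≤ B) →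
      (∀ i, ‖a i - b i‖ ≤ θ) → ‖∏ i, a i - ∏ i, b i‖ ≤ δ / 2 := by
    have huc := (isCompact_closedBall (0 : ι → ℂ) (B + 1)).uniformContinuousOn_of_continuous
      (f := fun a : ι → ℂ => ∏ i, a i) (by fun_prop)
    rw [Metric.uniformContinuousOn_iff] at huc
    obtain ⟨η, hη, h⟩ := huc (δ / 2) (by positivity)
    refine ⟨min 1 (η / 2), by positivity, fun a b ha hab => ?_⟩
    have hb : ∀ i, ‖b i‖ ≤ B + 1 := fun i => by
      have h1 := norm_sub_norm_le (b i) (a i)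
      rw [norm_sub_rev] at h1
      linarith [ha i, hab i, min_le_left 1 (η / 2)]
    have hmem : ∀ d : ι → ℂ, (∀ i, ‖d i‖ ≤ B + 1) → d ∈ Metric.closedBall (0 : ι → ℂ) (B + 1) := by
      intro d hd
      rw [mem_closedBall_zero_iff]
      exact (pi_norm_le_iff_of_nonneg (by positivity)).2 hd
    have hab' : dist a b < η := by
      rw [dist_eq_norm]
      refine lt_of_le_of_lt ((pi_norm_le_iff_of_nonneg (r := η / 2) (by positivity)).2 ?_)
        (by linarith)
      exact fun i => (hab i).trans (min_le_right _ _)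
    have := h a (hmem a fun i => (ha i).trans (by linarith)) b (hmem b hb) hab'
    rw [dist_eq_norm] at this
    exact this.le
  obtain ⟨N, z, hz⟩ := exists_finite_net B hθ0
  choose σ hσm hσ using fun i => hz (f' i) (hfm i) (hfB i)
  have hlim := tendsto_uniform_average_finite hν hT hprod hC hD z hσm
  have hclose : ∀ y : ι → X, ‖∏ i, f' i (y i) - ∏ i, z (σ i (y i))‖ ≤ δ / 2 := fun y =>
    hθ _ _ (fun i => hfB i _) fun i => hσ i _
  set c' := ∫ y, ∏ i, f' i (y i) ∂(Measure.pi μ) with hc'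
  set c := ∫ y, ∏ i, z (σ i (y i)) ∂(Measure.pi μ) with hc
  have hzm : ∀ i, Measurable fun x => z (σ i x) := fun i => (measurable_of_finite z).comp (hσm i)
  have hcc : ‖c' - c‖ ≤ δ / 2 := by
    have i1 : Integrable (fun y : ι → X => ∏ i, f' i (y i)) (Measure.pi μ) :=
      Integrable.of_bound (Finset.measurable_prod _ fun i _ =>
        (hfm i).comp (measurable_pi_apply i)).aestronglyMeasurable (∏ _i : ι, B)
        (ae_of_all _ fun y => by
          rw [norm_prod]
          exact Finset.prod_le_prod (fun _ _ => norm_nonneg _) fun i _ => hfB i _)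
    have i2 : Integrable (fun y : ι → X => ∏ i, z (σ i (y i))) (Measure.pi μ) :=
      Integrable.of_bound (Finset.measurable_prod _ fun i _ =>
        (hzm i).comp (measurable_pi_apply i)).aestronglyMeasurable ((∏ _i : ι, B) + δ / 2)
        (ae_of_all _ fun y => by
          have h1 : ‖∏ i, f' i (y i)‖ ≤ ∏ _i : ι, B := by
            rw [norm_prod]
            exact Finset.prod_le_prod (fun _ _ => norm_nonneg _) fun i _ => hfB i _
          have h2 := norm_sub_norm_le (∏ i, z (σ i (y i))) (∏ i, f' i (y i))
          rw [norm_sub_rev] at h2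
          linarith [hclose y])
    rw [hc', hc, ← integral_sub i1 i2]
    have := norm_integral_le_of_norm_le_const (μ := Measure.pi μ) (ae_of_all _ hclose)
    simpa using this
  have h2 := (ENNReal.tendsto_nhds_zero.1 hlim) (ε / 2) (by simpa using hε.ne')
  have h3 := eventually_uniformFilter (p := fun q => q.1 < q.2) 1 fun M N h1 h2 => by
    simp only; omega
  filter_upwards [h2, h3] with ⟨M, N'⟩ h2 h3
  simp only at h2 h3 ⊢
  set u : X → ℂ := fun x => ((N' : ℂ) - (M : ℂ))⁻¹ *
    (∑ n ∈ Finset.Ico M N', ∏ i, z (σ i ((T i)^[n] x))) - c with hu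
  set w : X → ℂ := fun x => ((N' : ℂ) - (M : ℂ))⁻¹ *
    (∑ n ∈ Finset.Ico M N', ∏ i, f' i ((T i)^[n] x)) - c' with hw
  have hum : Measurable u := ((Finset.measurable_sum _ fun n _ => Finset.measurable_prod _ fun i _ =>
    (hzm i).comp ((hT i).iterate n)).const_mul _).sub_const _
  have hwm : Measurable w := ((Finset.measurable_sum _ fun n _ => Finset.measurable_prod _ fun i _ =>
    (hfm i).comp ((hT i).iterate n)).const_mul _).sub_const _
  have hcongr : (fun x => ((N' : ℂ) - (M : ℂ))⁻¹ *
      (∑ n ∈ Finset.Ico M N', ∏ i, f i ((T i)^[n] x)) - c') =ᵐ[ν] w := by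
    filter_upwards [hcomp] with x hx
    simp only [hw, hx]
  rw [eLpNorm_congr_ae hcongr]
  -- The approximation error is uniform in `M` and `N'`: half of `δ` for the averaged products, half
  -- for the two constants.
  have hwu : ∀ x, ‖(w - u) x‖ ≤ δ := by
    intro x
    have hL : (0 : ℝ) < (N' - M : ℕ) := by exact_mod_cast (by omega : 0 < N' - M)
    have e : (w - u) x = ((N' : ℂ) - (M : ℂ))⁻¹ * (∑ n ∈ Finset.Ico M N',
        (∏ i, f' i ((T i)^[n] x) - ∏ i, z (σ i ((T i)^[n] x)))) - (c' - c) := by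
      simp only [Pi.sub_apply, hw, hu, Finset.sum_sub_distrib]
      ring
    rw [e]
    refine (norm_sub_le _ _).trans ?_
    have : ‖((N' : ℂ) - (M : ℂ))⁻¹ * (∑ n ∈ Finset.Ico M N',
        (∏ i, f' i ((T i)^[n] x) - ∏ i, z (σ i ((T i)^[n] x))))‖ ≤ δ / 2 := by
      rw [← Nat.cast_sub h3.le, norm_mul, norm_inv, Complex.norm_natCast, inv_mul_le_iff₀ hL]
      refine (norm_sum_le _ _).trans ((Finset.sum_le_sum fun n _ =>
        hclose fun i => (T i)^[n] x).trans ?_)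
      simp
    linarith
  calc eLpNorm w 2 ν = eLpNorm (u + (w - u)) 2 ν := by rw [add_sub_cancel]
    _ ≤ eLpNorm u 2 ν + eLpNorm (w - u) 2 ν :=
        eLpNorm_add_le hum.aestronglyMeasurable (hwm.sub hum).aestronglyMeasurable (by norm_num)
    _ ≤ ε / 2 + ε / 2 := by
        refine add_le_add h2 (le_trans ?_ hδ)
        refine (eLpNorm_le_of_ae_bound (ae_of_all _ hwu)).trans ?_
        simp
    _ = ε := ENNReal.add_halves ε

end Criterion

/-! ### Shannon entropy of finite partitions. -/

/-- For given total mass the uniform distribution maximises entropy: compare each `p a` with the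
mean `P / s.card` by `log x ≤ x - 1`, and the linear errors sum to zero. -/
theorem sum_negMulLog_le {α : Type*} (s : Finset α) (p : α → ℝ) (hp : ∀ a ∈ s, 0 ≤ p a) :
    ∑ a ∈ s, Real.negMulLog (p a)
      ≤ (∑ a ∈ s, p a) * Real.log s.card + Real.negMulLog (∑ a ∈ s, p a) := by
  set P := ∑ a ∈ s, p a with hP
  have hP0 : 0 ≤ P := Finset.sum_nonneg hp
  rcases hP0.eq_or_lt with h0 | hpos
  · have : ∀ a ∈ s, p a = 0 := (Finset.sum_eq_zero_iff_of_nonneg hp).1 h0.symm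
    rw [← h0, Finset.sum_congr rfl fun a ha => by rw [this a ha]]
    simp
  have hs : 0 < (s.card : ℝ) := by
    rcases s.eq_empty_or_nonempty with rfl | h
    · simp [hP] at hpos
    · exact_mod_cast h.card_pos
  have key : ∀ a ∈ s, Real.negMulLog (p a) ≤
      p a * (Real.log s.card - Real.log P) + (P / s.card - p a) := by
    intro a ha
    rcases (hp a ha).eq_or_lt with h | h
    · rw [← h]; simp; positivity
    have h1 := Real.log_le_sub_one_of_pos (show 0 < P / (s.card * p a) by positivity)
    rw [Real.log_div hpos.ne' (by positivity), Real.log_mul hs.ne' h.ne'] at h1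
    have h2 := mul_le_mul_of_nonneg_left h1 h.le
    have h3 : p a * (P / (s.card * p a) - 1) = P / s.card - p a := by
      field_simp
    rw [h3] at h2
    rw [Real.negMulLog]
    linarith
  refine (Finset.sum_le_sum key).trans (le_of_eq ?_)
  rw [Finset.sum_add_distrib, ← Finset.sum_mul, Finset.sum_sub_distrib, Finset.sum_const,
    nsmul_eq_mul, ← hP, mul_div_cancel₀ _ hs.ne', Real.negMulLog]
  ring

theorem negMulLog_le_one {x : ℝ} (hx : 0 ≤ x) : Real.negMulLog x ≤ 1 := by
  rcases hx.eq_or_lt with rfl | h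
  · simp
  have h1 := Real.log_le_sub_one_of_pos (inv_pos.2 h)
  rw [Real.log_inv] at h1
  have h2 := mul_le_mul_of_nonneg_left h1 h.le
  have : x * (x⁻¹ - 1) = 1 - x := by field_simp
  rw [this] at h2
  rw [Real.negMulLog]
  linarith

section FinEntropy

variable {Ω : Type*} [MeasurableSpace Ω] {μ : Measure Ω}
  {α β γ : Type*} [Fintype α] [MeasurableSpace α] [MeasurableSingletonClass α]
  [Fintype β] [MeasurableSpace β] [MeasurableSingletonClass β]
  [Fintype γ] [MeasurableSpace γ] [MeasurableSingletonClass γ]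

omit [Fintype β] [MeasurableSpace β] [MeasurableSingletonClass β] in
theorem measureReal_comp_preimage [IsFiniteMeasure μ] [DecidableEq β] {ξ : Ω → α}
    (hξ : Measurable ξ) (e : α → β) (b : β) :
    μ.real ((fun x => e (ξ x)) ⁻¹' {b}) = ∑ a with e a = b, μ.real (ξ ⁻¹' {a}) := by
  have : (fun x => e (ξ x)) ⁻¹' {b} = ⋃ a ∈ Finset.univ.filter (fun a => e a = b), ξ ⁻¹' {a} := by
    ext x; simp
  rw [this, measureReal_biUnion_finset]
  · intro a _ a' _ h
    exact Disjoint.preimage _ (by simpa using h)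
  · exact fun a _ => hξ (measurableSet_singleton a)

theorem finEntropy_comp_le [IsFiniteMeasure μ] {ξ : Ω → α} (hξ : Measurable ξ) (e : α → β) :
    finEntropy μ (fun x => e (ξ x)) ≤ finEntropy μ ξ := by
  classical
  unfold finEntropy
  rw [← Finset.sum_fiberwise Finset.univ e]
  refine Finset.sum_le_sum fun b _ => ?_
  rw [measureReal_comp_preimage hξ, Real.negMulLog, neg_mul, Finset.sum_mul, ← Finset.sum_neg_distrib]
  refine Finset.sum_le_sum fun a ha => ?_
  rw [Real.negMulLog, neg_mul, neg_le_neg_iff]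
  have h0 : 0 ≤ μ.real (ξ ⁻¹' {a}) := measureReal_nonneg
  rcases h0.eq_or_lt with h | h
  · rw [← h]; simp
  gcongr
  exact Finset.single_le_sum (f := fun a => μ.real (ξ ⁻¹' {a})) (fun _ _ => measureReal_nonneg) ha

omit [MeasurableSpace α] [MeasurableSingletonClass α] in
theorem finEntropy_nonneg [IsProbabilityMeasure μ] (ξ : Ω → α) : 0 ≤ finEntropy μ ξ :=
  Finset.sum_nonneg fun _ _ => Real.negMulLog_nonneg measureReal_nonneg measureReal_le_one

theorem MeasureTheory.MeasurePreserving.finEntropy_comp {T : Ω → Ω} (hT : MeasurePreserving T μ μ)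
    {ξ : Ω → α} (hξ : Measurable ξ) : finEntropy μ (fun x => ξ (T x)) = finEntropy μ ξ := by
  unfold finEntropy
  refine Finset.sum_congr rfl fun a _ => ?_
  rw [← hT.measureReal_preimage (hξ (measurableSet_singleton a)).nullMeasurableSet]
  rfl

/-- This is `log x ≤ x - 1` at `x = a b / (c p)`. It is the termwise form of nonnegativity of
conditional mutual information, arranged to survive vanishing masses. -/
theorem negMulLog_submodular_term {p a b c : ℝ} (hp : 0 ≤ p) (ha : p ≤ a) (hb : p ≤ b)
    (hc : a ≤ c) : Real.negMulLog p - p * Real.log c + p * Real.log a + p * Real.log b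
      ≤ a * b / c - p := by
  rcases hp.eq_or_lt with rfl | h
  · have : 0 ≤ c := ha.trans hc
    simp; positivity
  have ha' : 0 < a := by linarith
  have hb' : 0 < b := by linarith
  have hc' : 0 < c := by linarith
  have h1 := Real.log_le_sub_one_of_pos (show 0 < a * b / (c * p) by positivity)
  rw [Real.log_div (by positivity) (by positivity), Real.log_mul ha'.ne' hb'.ne',
    Real.log_mul hc'.ne' h.ne'] at h1
  have h2 := mul_le_mul_of_nonneg_left h1 h.le
  have : p * (a * b / (c * p) - 1) = a * b / c - p := by field_simp
  rw [this] at h2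
  rw [Real.negMulLog]
  linarith

/-- Strong subadditivity (submodularity) of Shannon entropy. -/
theorem finEntropy_submodular [IsFiniteMeasure μ] {ξ : Ω → α} {η : Ω → β} {ζ : Ω → γ}
    (hξ : Measurable ξ) (hη : Measurable η) (hζ : Measurable ζ) :
    finEntropy μ (fun x => (ξ x, η x, ζ x)) + finEntropy μ ζ
      ≤ finEntropy μ (fun x => (ξ x, ζ x)) + finEntropy μ (fun x => (η x, ζ x)) := by
  classical
  set p : α → β → γ → ℝ := fun a b c => μ.real ((fun x => (ξ x, η x, ζ x)) ⁻¹' {(a, b, c)}) with hp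
  set q : α → γ → ℝ := fun a c => μ.real ((fun x => (ξ x, ζ x)) ⁻¹' {(a, c)}) with hq
  set r : β → γ → ℝ := fun b c => μ.real ((fun x => (η x, ζ x)) ⁻¹' {(b, c)}) with hr
  set s : γ → ℝ := fun c => μ.real (ζ ⁻¹' {c}) with hs
  have hm : Measurable fun x => (ξ x, η x, ζ x) := by fun_prop
  have hmq : Measurable fun x => (ξ x, ζ x) := by fun_prop
  have hmr : Measurable fun x => (η x, ζ x) := by fun_prop
  have hqp : ∀ a c, q a c = ∑ b, p a b c := by
    intro a c
    have := measureReal_comp_preimage (μ := μ) hm (fun t => (t.1, t.2.2)) (a, c)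
    refine this.trans ?_
    rw [Finset.sum_filter, Fintype.sum_prod_type]
    simp only [Fintype.sum_prod_type, Prod.mk.injEq]
    rw [Finset.sum_eq_single a (by intro x _ hx; simp [hx]) (by simp)]
    simp [hp]
  have hrp : ∀ b c, r b c = ∑ a, p a b c := by
    intro b c
    have := measureReal_comp_preimage (μ := μ) hm (fun t => (t.2.1, t.2.2)) (b, c)
    refine this.trans ?_
    rw [Finset.sum_filter, Fintype.sum_prod_type]
    refine Finset.sum_congr rfl fun a _ => ?_
    simp [hp]
  have hsq : ∀ c, s c = ∑ a, q a c := by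
    intro c
    have := measureReal_comp_preimage (μ := μ) hmq (fun t => t.2) c
    refine this.trans ?_
    rw [Finset.sum_filter, Fintype.sum_prod_type]
    simp [hq]
  have hsr : ∀ c, s c = ∑ b, r b c := by
    intro c
    have := measureReal_comp_preimage (μ := μ) hmr (fun t => t.2) c
    refine this.trans ?_
    rw [Finset.sum_filter, Fintype.sum_prod_type]
    simp [hr]
  have p0 : ∀ a b c, 0 ≤ p a b c := fun _ _ _ => measureReal_nonneg
  have q0 : ∀ a c, 0 ≤ q a c := fun _ _ => measureReal_nonneg
  have r0 : ∀ b c, 0 ≤ r b c := fun _ _ => measureReal_nonneg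
  have e1 : finEntropy μ (fun x => (ξ x, η x, ζ x)) = ∑ c, ∑ a, ∑ b, Real.negMulLog (p a b c) := by
    simp only [finEntropy, Fintype.sum_prod_type]
    refine Eq.trans (Finset.sum_congr rfl fun a _ => Finset.sum_comm) Finset.sum_comm
  have e2 : finEntropy μ ζ = ∑ c, ∑ a, ∑ b, -(p a b c * Real.log (s c)) := by
    rw [finEntropy]
    refine Finset.sum_congr rfl fun c _ => ?_
    change Real.negMulLog (s c) = _
    simp only [Finset.sum_neg_distrib, ← Finset.sum_mul, ← hqp, ← hsq]
    rw [Real.negMulLog, neg_mul]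
  have e3 : finEntropy μ (fun x => (ξ x, ζ x)) = ∑ c, ∑ a, ∑ b, -(p a b c * Real.log (q a c)) := by
    rw [finEntropy, Fintype.sum_prod_type, Finset.sum_comm]
    refine Finset.sum_congr rfl fun c _ => Finset.sum_congr rfl fun a _ => ?_
    change Real.negMulLog (q a c) = _
    simp only [Finset.sum_neg_distrib, ← Finset.sum_mul, ← hqp]
    rw [Real.negMulLog, neg_mul]
  have e4 : finEntropy μ (fun x => (η x, ζ x)) = ∑ c, ∑ a, ∑ b, -(p a b c * Real.log (r b c)) := by
    rw [finEntropy, Fintype.sum_prod_type, Finset.sum_comm]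
    refine Finset.sum_congr rfl fun c _ => ?_
    rw [Finset.sum_comm]
    refine Finset.sum_congr rfl fun b _ => ?_
    change Real.negMulLog (r b c) = _
    simp only [Finset.sum_neg_distrib, ← Finset.sum_mul, ← hrp]
    rw [Real.negMulLog, neg_mul]
  -- Making `ξ` and `η` conditionally independent given `ζ` does not change the total mass, so the
  -- linear errors cancel.
  have e5 : ∑ c, ∑ a, ∑ b, (q a c * r b c / s c - p a b c) = 0 := by
    refine Finset.sum_eq_zero fun c _ => ?_
    simp only [Finset.sum_sub_distrib, ← hqp, ← hsq, ← Finset.sum_div, ← Finset.mul_sum, ← hsr,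
      ← Finset.sum_mul]
    rcases eq_or_ne (s c) 0 with h | h
    · simp [h]
    · rw [mul_div_assoc, div_self h]; simp
  have key : ∑ c, ∑ a, ∑ b, (Real.negMulLog (p a b c) - p a b c * Real.log (s c)
      + p a b c * Real.log (q a c) + p a b c * Real.log (r b c)) ≤
      ∑ c, ∑ a, ∑ b, (q a c * r b c / s c - p a b c) := by
    refine Finset.sum_le_sum fun c _ => Finset.sum_le_sum fun a _ => Finset.sum_le_sum fun b _ => ?_
    refine negMulLog_submodular_term (p0 a b c) ?_ ?_ ?_
    · rw [hqp]; exact Finset.single_le_sum (fun b _ => p0 a b c) (Finset.mem_univ b)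
    · rw [hrp]
      exact Finset.single_le_sum (f := fun a => p a b c) (fun a _ => p0 a b c) (Finset.mem_univ a)
    · rw [hsq]
      exact Finset.single_le_sum (f := fun a => q a c) (fun a _ => q0 a c) (Finset.mem_univ a)
  rw [e5] at key
  simp only [Finset.sum_add_distrib, Finset.sum_sub_distrib] at key
  rw [e1, e2, e3, e4]
  simp only [Finset.sum_neg_distrib]
  linarith

theorem finEntropy_prod_le [IsProbabilityMeasure μ] {ξ : Ω → α} {η : Ω → β}
    (hξ : Measurable ξ) (hη : Measurable η) :
    finEntropy μ (fun x => (ξ x, η x)) ≤ finEntropy μ ξ + finEntropy μ η := by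
  have h := finEntropy_submodular (μ := μ) hξ hη (measurable_const (a := ()))
  have h1 := finEntropy_comp_le (μ := μ) (ξ := fun x => (ξ x, η x, ())) (by fun_prop)
    (fun t => (t.1, t.2.1))
  have h2 := finEntropy_comp_le hξ (μ := μ) (fun t => (t, ()))
  have h3 := finEntropy_comp_le hη (μ := μ) (fun t => (t, ()))
  have h4 := finEntropy_nonneg (μ := μ) (fun _ : Ω => ())
  linarith

end FinEntropy

/-! ### Entropy rates of partitions. -/

section Itinerary

variable {Ω : Type*} [MeasurableSpace Ω] {μ : Measure Ω} {T : Ω → Ω}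
  {α β : Type*} [MeasurableSpace α] [MeasurableSpace β]

theorem measurable_itinerary (hT : Measurable T) {ξ : Ω → α} (hξ : Measurable ξ) (n : ℕ) :
    Measurable (itinerary T ξ n) :=
  measurable_pi_lambda _ fun j => hξ.comp (hT.iterate j)

variable [Fintype α] [MeasurableSingletonClass α] [Fintype β] [MeasurableSingletonClass β]
  [IsProbabilityMeasure μ]

theorem subadditive_finEntropy_itinerary (hT : MeasurePreserving T μ μ) {ξ : Ω → α}
    (hξ : Measurable ξ) : Subadditive fun n => finEntropy μ (itinerary T ξ n) := by
  intro m n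
  have hm := measurable_itinerary hT.measurable hξ
  have h1 := finEntropy_comp_le (μ := μ)
    (ξ := fun x => (itinerary T ξ m x, itinerary T ξ n (T^[m] x)))
    ((hm m).prodMk ((hm n).comp (hT.measurable.iterate m)))
    (fun t => (Fin.append t.1 t.2 : Fin (m + n) → α))
  have h2 := finEntropy_prod_le (μ := μ) (hm m) ((hm n).comp (hT.measurable.iterate m))
  have h3 := (hT.iterate m).finEntropy_comp (hm n)
  have h4 : itinerary T ξ (m + n) =
      fun x => Fin.append (itinerary T ξ m x) (itinerary T ξ n (T^[m] x)) := by
    funext x j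
    refine Fin.addCases (fun i => ?_) (fun i => ?_) j
    · simp [itinerary]
    · simp [itinerary, ← Function.iterate_add_apply, Nat.add_comm]
  simp only [h4]
  refine h1.trans (h2.trans ?_)
  simp only [Function.comp_def]
  rw [h3]

/-- Fekete's lemma applied to the subadditive sequence of entropies of itineraries. The lower bound
at every `n` holds because the limit is also the infimum. -/
theorem exists_entropy_rate (hT : MeasurePreserving T μ μ) {ξ : Ω → α} (hξ : Measurable ξ) :
    ∃ L : ℝ, 0 ≤ L ∧ partitionEntropy T μ ξ = ENNReal.ofReal L ∧
      (∀ n : ℕ, n * L ≤ finEntropy μ (itinerary T ξ n)) ∧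
      Tendsto (fun n : ℕ => finEntropy μ (itinerary T ξ n) / n) atTop (𝓝 L) := by
  have hsub := subadditive_finEntropy_itinerary hT hξ
  have hbdd : BddBelow (range fun n : ℕ => finEntropy μ (itinerary T ξ n) / n) := by
    refine ⟨0, ?_⟩
    rintro _ ⟨n, rfl⟩
    exact div_nonneg (finEntropy_nonneg _) n.cast_nonneg
  have hlim := hsub.tendsto_lim hbdd
  refine ⟨hsub.lim, ?_, ?_, fun n => ?_, hlim⟩
  · exact ge_of_tendsto' hlim fun n => div_nonneg (finEntropy_nonneg _) n.cast_nonneg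
  · exact (ENNReal.tendsto_ofReal hlim).limsup_eq
  · rcases Nat.eq_zero_or_pos n with rfl | hn
    · simpa using finEntropy_nonneg (μ := μ) (itinerary T ξ 0)
    have := hsub.lim_le_div hbdd hn.ne'
    have hn' : (0 : ℝ) < n := by exact_mod_cast hn
    rw [le_div_iff₀ hn'] at this
    linarith

/-- The last factor is the conditional entropy of `ξ` given `η`. By invariance each time step costs
at most this much, so close partitions have close entropy rates. -/
theorem finEntropy_itinerary_le_add (hT : MeasurePreserving T μ μ) {ξ : Ω → α} {η : Ω → β}
    (hξ : Measurable ξ) (hη : Measurable η) (n : ℕ) :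
    finEntropy μ (itinerary T ξ n) ≤ finEntropy μ (itinerary T η n) +
      n * (finEntropy μ (fun x => (ξ x, η x)) - finEntropy μ η) := by
  have hX := measurable_itinerary hT.measurable hξ
  have hY := measurable_itinerary hT.measurable hη
  have key : finEntropy μ (fun x => (itinerary T ξ n x, itinerary T η n x)) ≤
      finEntropy μ (itinerary T η n) +
      n * (finEntropy μ (fun x => (ξ x, η x)) - finEntropy μ η) := by
    induction n with
    | zero =>
      have := finEntropy_comp_le (μ := μ) (hY 0) (fun t => ((Fin.elim0 : Fin 0 → α), t))
      have e : (fun x => (itinerary T ξ 0 x, itinerary T η 0 x)) =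
          fun x => ((Fin.elim0 : Fin 0 → α), itinerary T η 0 x) := by
        funext x
        exact Prod.ext (Subsingleton.elim _ _) rfl
      rw [e]
      simpa using this
    | succ n ih =>
      set X := itinerary T ξ n
      set Y := itinerary T η n
      have hXn : Measurable X := hX n
      have hYn : Measurable Y := hY n
      set x' : Ω → α := fun x => ξ (T^[n] x) with hx'
      set y' : Ω → β := fun x => η (T^[n] x) with hy'
      have mx : Measurable x' := hξ.comp (hT.measurable.iterate n)
      have my : Measurable y' := hη.comp (hT.measurable.iterate n)
      -- Together these give `H(X, x' | Y, y') ≤ H(X | Y) + H(x' | y')`: `s1` splits the left side,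
      -- while `s2` and `s3` drop `y'` and `Y` from the conditions.
      have s1 := finEntropy_submodular (μ := μ) hXn mx (hYn.prodMk my)
      have s2 := finEntropy_submodular (μ := μ) hXn my hYn
      have s3 := finEntropy_submodular (μ := μ) mx hYn my
      have c1 := finEntropy_comp_le (μ := μ) (ξ := fun x => (X x, x' x, Y x, y' x))
        (by fun_prop) (fun t => ((Fin.snoc t.1 t.2.1 : Fin (n + 1) → α),
          (Fin.snoc t.2.2.1 t.2.2.2 : Fin (n + 1) → β)))
      have e1 : (fun x => (itinerary T ξ (n + 1) x, itinerary T η (n + 1) x)) =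
          fun x => ((Fin.snoc (X x) (x' x) : Fin (n + 1) → α),
            (Fin.snoc (Y x) (y' x) : Fin (n + 1) → β)) := by
        funext x
        refine Prod.ext ?_ ?_ <;> funext j <;> refine Fin.lastCases ?_ (fun i => ?_) j <;>
          simp [itinerary, X, Y, x', y']
      rw [← e1] at c1
      have c2 := finEntropy_comp_le (μ := μ) (ξ := fun x => (X x, y' x, Y x))
        (by fun_prop) (fun t => (t.1, t.2.2, t.2.1))
      have c3 := finEntropy_comp_le (μ := μ) (ξ := fun x => (y' x, Y x))
        (by fun_prop) (fun t => (t.2, t.1))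
      have c4 := finEntropy_comp_le (μ := μ) (hY (n + 1))
        (fun t => ((Fin.init t : Fin n → β), t (Fin.last n)))
      have e4 : (fun x => ((Fin.init (itinerary T η (n + 1) x) : Fin n → β),
          itinerary T η (n + 1) x (Fin.last n))) = fun x => (Y x, y' x) := by
        funext x
        rfl
      rw [e4] at c4
      have c5 := finEntropy_comp_le (μ := μ) (ξ := fun x => (Y x, y' x))
        (by fun_prop) (fun t => (t.2, t.1))
      have i1 := (hT.iterate n).finEntropy_comp (hξ.prodMk hη)
      have i2 := (hT.iterate n).finEntropy_comp hη
      push_cast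
      simp only [hx', hy'] at *
      linarith
  refine le_trans ?_ key
  exact finEntropy_comp_le (μ := μ) ((hX n).prodMk (hY n)) Prod.fst

end Itinerary

/-! ### Counting typical words. -/

/-- The product of conditional weights along a word. -/
noncomputable def wordWeight {α : Type*} (q : ∀ n : ℕ, (Fin n → α) → α → ℝ≥0∞) :
    ∀ n : ℕ, (Fin n → α) → ℝ≥0∞
  | 0, _ => 1
  | n + 1, w => wordWeight q n (Fin.init w) * q n (Fin.init w) (w (Fin.last n))

/-- Sum over the last letter first. The weights form a subprobability on words, so at most `1 / θ`
words have weight at least `θ`, even over an infinite alphabet. -/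
theorem tsum_wordWeight_le_one {α : Type*} {q : ∀ n : ℕ, (Fin n → α) → α → ℝ≥0∞}
    (hq : ∀ n v, ∑' c, q n v c ≤ 1) (n : ℕ) : ∑' w, wordWeight q n w ≤ 1 := by
  induction n with
  | zero =>
    rw [tsum_fintype]
    simp [wordWeight]
  | succ n ih =>
    rw [← (Fin.snocEquiv fun _ : Fin (n + 1) => α).tsum_eq, ENNReal.tsum_prod', ENNReal.tsum_comm]
    refine le_trans (ENNReal.tsum_le_tsum fun v => ?_) ih
    have : ∀ c : α, wordWeight q (n + 1) ((Fin.snocEquiv fun _ : Fin (n + 1) => α) (c, v))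
        = wordWeight q n v * q n v c := by
      intro c
      simp [wordWeight, Fin.snocEquiv]
    simp only [this]
    rw [ENNReal.tsum_mul_left]
    exact mul_le_of_le_one_right' (hq n v)

theorem wordWeight_pos {α : Type*} {q : ∀ n : ℕ, (Fin n → α) → α → ℝ≥0∞} {n : ℕ}
    (hq : ∀ j < n, ∀ v c, 0 < q j v c) (w : Fin n → α) : 0 < wordWeight q n w := by
  induction n with
  | zero => simp [wordWeight]
  | succ n ih =>
    exact ENNReal.mul_pos (ih (fun j hj => hq j (hj.trans n.lt_succ_self)) _).ne'
      (hq n n.lt_succ_self _ _).ne'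

section Covering

variable {Ω : Type*} [MeasurableSpace Ω] {μ : Measure Ω} [IsProbabilityMeasure μ] {T : Ω → Ω}

/-- Chebyshev's inequality turns the mean ergodic theorem into convergence in measure. -/
theorem Ergodic.eventually_measureReal_sum_gt_le (hT : Ergodic T μ) {g : Ω → ℝ} (hg : Measurable g)
    {B : ℝ} (hB : ∀ x, |g x| ≤ B) {δ ε : ℝ} (hδ : 0 < δ) (hε : 0 < ε) :
    ∀ᶠ m : ℕ in atTop,
      μ.real {x | m * (∫ y, g y ∂μ + δ) < ∑ j ∈ Finset.range m, g (T^[j] x)} ≤ ε := by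
  have hL : MemLp g 2 μ := MemLp.of_bound hg.aestronglyMeasurable B (ae_of_all _ hB)
  have h := hT.tendsto_integral_norm_average_sub_sq hL
  filter_upwards [h.eventually_lt_const (show 0 < δ ^ 2 * ε by positivity), eventually_gt_atTop 0]
    with m hm hm0
  have hm0' : (0 : ℝ) < m := by exact_mod_cast hm0
  have hint : Integrable (fun y => ‖(m : ℝ)⁻¹ * ∑ h ∈ Finset.range m, g (T^[h] y)
      - ∫ z, g z ∂μ‖ ^ 2) μ := by
    have : MemLp (fun y => (m : ℝ)⁻¹ * ∑ h ∈ Finset.range m, g (T^[h] y) - ∫ z, g z ∂μ) 2 μ := by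
      refine MemLp.sub (MemLp.const_mul (memLp_finsetSum (f := fun h y => g (T^[h] y)) _
        fun h _ => ?_) _) (memLp_const _)
      exact (hL.comp_measurePreserving (hT.toMeasurePreserving.iterate h) :)
    exact this.integrable_norm_pow (by norm_num)
  have hmk := mul_meas_ge_le_integral_of_nonneg (ae_of_all _ fun y => by positivity) hint (δ ^ 2)
  have hsub : {x | m * (∫ y, g y ∂μ + δ) < ∑ j ∈ Finset.range m, g (T^[j] x)} ⊆
      {x | δ ^ 2 ≤ ‖(m : ℝ)⁻¹ * ∑ h ∈ Finset.range m, g (T^[h] x) - ∫ z, g z ∂μ‖ ^ 2} := by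
    intro x hx
    simp only [mem_ofPred_eq] at hx ⊢
    refine pow_le_pow_left₀ hδ.le ?_ 2
    refine le_trans ?_ (Real.le_norm_self _)
    rw [le_sub_iff_add_le, le_inv_mul_iff₀ hm0']
    linarith
  have h2 := measureReal_mono (μ := μ) hsub
  have h3 : δ ^ 2 * μ.real {x | m * (∫ y, g y ∂μ + δ) < ∑ j ∈ Finset.range m, g (T^[j] x)}
      ≤ δ ^ 2 * ε := le_trans (by gcongr) (hmk.trans hm.le)
  exact le_of_mul_le_mul_left h3 (by positivity)

variable {β : Type*} [Fintype β] [MeasurableSpace β] [MeasurableSingletonClass β]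

/-- If every increment were at least `h`, telescoping would force an entropy rate of at least `h`.
-/
theorem exists_entropy_increment_lt (hT : MeasurePreserving T μ μ) {ξ : Ω → β} (hξ : Measurable ξ)
    {h : ℝ} (hh : partitionEntropy T μ ξ < ENNReal.ofReal h) :
    ∃ r : ℕ, finEntropy μ (itinerary T ξ (r + 1)) - finEntropy μ (itinerary T ξ r) < h := by
  obtain ⟨L, hL0, hL, -, hlim⟩ := exists_entropy_rate hT hξ
  rw [hL, ENNReal.ofReal_lt_ofReal_iff_of_nonneg hL0] at hh
  by_contra! hcon
  have hge : ∀ n : ℕ, n * h ≤ finEntropy μ (itinerary T ξ n) := by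
    intro n
    induction n with
    | zero => simpa using finEntropy_nonneg (μ := μ) (itinerary T ξ 0)
    | succ n ih =>
      have := hcon n
      push_cast
      linarith
  have : h ≤ L := by
    refine ge_of_tendsto hlim ?_
    filter_upwards [eventually_gt_atTop 0] with n hn
    have hn' : (0 : ℝ) < n := by exact_mod_cast hn
    rw [le_div_iff₀ hn']
    linarith [hge n]
  linarith

/-- The chain rule: the integrand is the information of the last letter given the previous `r`.
Atoms of measure zero contribute nothing. -/
theorem integral_conditional_information (hT : MeasurePreserving T μ μ) {ξ : Ω → β}
    (hξ : Measurable ξ) (r : ℕ) :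
    ∫ x, -Real.log (μ.real (itinerary T ξ (r + 1) ⁻¹' {itinerary T ξ (r + 1) x}) /
        μ.real (itinerary T ξ r ⁻¹' {itinerary T ξ r x})) ∂μ =
      finEntropy μ (itinerary T ξ (r + 1)) - finEntropy μ (itinerary T ξ r) := by
  classical
  have hm := measurable_itinerary hT.measurable hξ
  set P : (Fin (r + 1) → β) → ℝ := fun u => μ.real (itinerary T ξ (r + 1) ⁻¹' {u}) with hP
  set P' : (Fin r → β) → ℝ := fun v => μ.real (itinerary T ξ r ⁻¹' {v}) with hP'
  have hmarg : ∀ v, P' v = ∑ u with Fin.init u = v, P u := by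
    intro v
    exact measureReal_comp_preimage (μ := μ) (hm (r + 1)) (fun u => (Fin.init u : Fin r → β)) v
  have h1 := integral_comp_finite μ (hm (r + 1)) (fun u => -Real.log (P u / P' (Fin.init u)))
  refine Eq.trans h1 ?_
  have h2 : ∀ u, -Real.log (P u / P' (Fin.init u)) * P u
      = Real.negMulLog (P u) + P u * Real.log (P' (Fin.init u)) := by
    intro u
    rcases eq_or_ne (P u) 0 with h | h
    · simp [h]
    have h0 : 0 < P u := lt_of_le_of_ne measureReal_nonneg h.symm
    have h3 : P u ≤ P' (Fin.init u) := by
      rw [hmarg]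
      exact Finset.single_le_sum (f := P) (fun _ _ => measureReal_nonneg) (by simp)
    rw [Real.log_div h (by linarith), Real.negMulLog]
    ring
  have h4 : ∑ u, P u * Real.log (P' (Fin.init u)) = - finEntropy μ (itinerary T ξ r) := by
    rw [← Finset.sum_fiberwise Finset.univ (fun u : Fin (r + 1) → β => (Fin.init u : Fin r → β)),
      finEntropy, ← Finset.sum_neg_distrib]
    refine Finset.sum_congr rfl fun v _ => ?_
    rw [Real.negMulLog, neg_mul, neg_neg]
    change _ = P' v * Real.log (P' v)
    conv_rhs => rw [hmarg v, Finset.sum_mul, ← hmarg v]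
    refine Finset.sum_congr rfl fun u hu => ?_
    rw [(Finset.mem_filter.1 hu).2]
  calc ∑ u, -Real.log (P u / P' (Fin.init u)) * P u
      = ∑ u, (Real.negMulLog (P u) + P u * Real.log (P' (Fin.init u))) :=
        Finset.sum_congr rfl fun u _ => h2 u
    _ = _ := by rw [Finset.sum_add_distrib, h4]; rfl

variable {α : Type*} [Countable α] [MeasurableSpace α] [MeasurableSingletonClass α]

/-- Words are weighted by a Markov measure of order `r` on the finite alphabet `β`, times a weight
`ρ` that resolves a letter of `α` within its fibre under `τ`. Along a typical orbit the first factor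
costs less than `h + δ` per step and the second less than `δ`, so typical words have weight at least
a constant times `exp (-n (h + 2δ))` and there are few of them. -/
theorem exists_covering_words (hT : Ergodic T μ) {a : Ω → α} (ha : Measurable a) (τ : α → β)
    (ρ : α → ℝ≥0) (hρ : ∀ b, ∑' c : {c // τ c = b}, (ρ c : ℝ≥0∞) ≤ 1)
    (hρ1 : ∀ c, ρ c ≤ 1)
    (hρpos : ∀ᵐ x ∂μ, 0 < ρ (a x)) {h δ ε : ℝ} (hδ : 0 < δ) (hε : 0 < ε)
    (hφi : Integrable (fun x => -Real.log (ρ (a x))) μ)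
    (hφ : ∫ x, -Real.log (ρ (a x)) ∂μ ≤ δ * (ε / 3))
    (hh : partitionEntropy T μ (fun x => τ (a x)) < ENNReal.ofReal h) :
    ∃ C : ℝ, 0 ≤ C ∧ ∀ᶠ n : ℕ in atTop, ∃ Q : Finset (Fin n → α),
      (Q.card : ℝ) ≤ C * Real.exp (n * (h + 2 * δ)) ∧
      μ.real {x | itinerary T a n x ∉ Q} ≤ ε := by
  classical
  have hmp := hT.toMeasurePreserving
  set ξ : Ω → β := fun x => τ (a x) with hξdef
  have hτ : Measurable τ := measurable_of_countable _
  have hξ : Measurable ξ := hτ.comp ha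
  have hh0 : 0 < h := by
    by_contra hcon
    rw [ENNReal.ofReal_of_nonpos (not_lt.1 hcon)] at hh
    exact not_lt_bot hh
  obtain ⟨r, hr⟩ := exists_entropy_increment_lt hmp hξ hh
  have hmξ := measurable_itinerary hmp.measurable hξ
  have hma := measurable_itinerary hmp.measurable ha
  -- The first `r` letters have no complete past. Any positive summable weights do for them, since
  -- they only affect the constant `C`.
  obtain ⟨ρ₀, hρ₀pos, hρ₀⟩ := ENNReal.exists_pos_sum_of_countable one_ne_zero α
  -- the conditional weights: a Markov measure of order `r`, times the tail weights
  set cond : (Fin r → β) → β → ℝ≥0∞ := fun u b =>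
    μ (itinerary T ξ (r + 1) ⁻¹' {(Fin.snoc u b : Fin (r + 1) → β)}) / μ (itinerary T ξ r ⁻¹' {u})
    with hcond
  have hcond1 : ∀ u, ∑ b, cond u b ≤ 1 := by
    intro u
    simp only [hcond, ENNReal.div_eq_inv_mul]
    rw [← Finset.mul_sum, ← ENNReal.div_eq_inv_mul]
    have : ∑ b, μ (itinerary T ξ (r + 1) ⁻¹' {(Fin.snoc u b : Fin (r + 1) → β)})
        = μ (itinerary T ξ r ⁻¹' {u}) := by
      rw [← measure_biUnion_finset]
      · congr 1
        ext x
        simp only [Finset.mem_univ, iUnion_true, mem_iUnion, mem_preimage, mem_singleton_iff]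
        constructor
        · rintro ⟨b, hb⟩
          have : itinerary T ξ r x = Fin.init (itinerary T ξ (r + 1) x) := rfl
          rw [this, hb, Fin.init_snoc]
        · intro hx
          refine ⟨itinerary T ξ (r + 1) x (Fin.last r), ?_⟩
          rw [← hx]
          exact (Fin.snoc_init_self _).symm
      · intro b _ b' _ hbb
        refine Disjoint.preimage _ ?_
        simp only [disjoint_singleton]
        intro h
        exact hbb (by simpa using congrFun h (Fin.last r))
      · exact fun b _ => hmξ _ (measurableSet_singleton _)
    rw [this]
    exact ENNReal.div_self_le_one
  set q : ∀ n : ℕ, (Fin n → α) → α → ℝ≥0∞ := fun n v c =>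
    if hn : r ≤ n then
      cond (fun i : Fin r => τ (v ⟨n - r + i, by omega⟩)) (τ c) * ρ c
    else ρ₀ c with hq
  have hq1 : ∀ n v, ∑' c, q n v c ≤ 1 := by
    intro n v
    by_cases hn : r ≤ n
    · simp only [hq, hn, dif_pos]
      set u := fun i : Fin r => τ (v ⟨n - r + i, by omega⟩)
      rw [← (Equiv.sigmaFiberEquiv τ).tsum_eq, ENNReal.tsum_sigma', tsum_fintype]
      refine le_trans (Finset.sum_le_sum fun b _ => ?_) (hcond1 u)
      have : ∀ c : {c // τ c = b}, cond u (τ ((Equiv.sigmaFiberEquiv τ) ⟨b, c⟩)) *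
          (ρ ((Equiv.sigmaFiberEquiv τ) ⟨b, c⟩) : ℝ≥0∞) = cond u b * ρ c := by
        rintro ⟨c, rfl⟩; rfl
      simp only [this]
      rw [ENNReal.tsum_mul_left]
      exact mul_le_of_le_one_right' (hρ b)
    · simp only [hq, hn, dif_neg, not_false_eq_true]
      exact hρ₀.le
  set W := wordWeight q with hW
  set P : Ω → ℝ := fun x => μ.real (itinerary T ξ (r + 1) ⁻¹' {itinerary T ξ (r + 1) x}) with hP
  set P' : Ω → ℝ := fun x => μ.real (itinerary T ξ r ⁻¹' {itinerary T ξ r x}) with hP'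
  set g : Ω → ℝ := fun x => -Real.log (P x / P' x) with hg
  set φ : Ω → ℝ := fun x => -Real.log (ρ (a x)) with hφdef
  -- the conditional weights along an orbit
  have hstep : ∀ x (m : ℕ), W (r + (m + 1)) (itinerary T a (r + (m + 1)) x) =
      W (r + m) (itinerary T a (r + m) x) *
        (ENNReal.ofReal (P (T^[m] x) / P' (T^[m] x)) * ρ (a (T^[r + m] x))) := by
    intro x m
    have e1 : W (r + (m + 1)) (itinerary T a (r + (m + 1)) x) =
      W (r + m) (itinerary T a (r + m) x) *
        q (r + m) (itinerary T a (r + m) x) (a (T^[r + m] x)) := rfl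
    rw [e1]
    congr 1
    simp only [hq, Nat.le_add_right, dif_pos]
    congr 1
    have e2 : (fun i : Fin r => τ (itinerary T a (r + m) x ⟨r + m - r + i, by omega⟩))
        = itinerary T ξ r (T^[m] x) := by
      funext i
      simp only [itinerary, hξdef, ← Function.iterate_add_apply]
      congr 3
      omega
    rw [e2]
    have e3 : (Fin.snoc (itinerary T ξ r (T^[m] x)) (τ (a (T^[r + m] x))) : Fin (r + 1) → β)
        = itinerary T ξ (r + 1) (T^[m] x) := by
      rw [Function.iterate_add_apply]
      exact Fin.snoc_init_self (itinerary T ξ (r + 1) (T^[m] x))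
    simp only [hcond]
    rw [e3]
    -- On a null cylinder the quotients are `0 / 0`, which is zero both in `ℝ≥0∞` and in `ℝ`.
    by_cases h0 : μ (itinerary T ξ r ⁻¹' {itinerary T ξ r (T^[m] x)}) = 0
    · have h1 : μ (itinerary T ξ (r + 1) ⁻¹' {itinerary T ξ (r + 1) (T^[m] x)}) = 0 := by
        refine measure_mono_null ?_ h0
        intro y hy
        simp only [mem_preimage, mem_singleton_iff] at hy ⊢
        exact congrArg (fun w => (Fin.init w : Fin r → β)) hy
      simp [hP, measureReal_def, h1]
    · have hpos : 0 < P' (T^[m] x) :=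
        ENNReal.toReal_pos h0 (measure_ne_top _ _)
      rw [ENNReal.ofReal_div_of_pos hpos]
      simp only [hP, hP']
      rw [ofReal_measureReal (measure_ne_top _ _), ofReal_measureReal (measure_ne_top _ _)]
  have hPpos : ∀ᵐ x ∂μ, 0 < P x := by
    have h1 : ∀ u, ∀ᵐ x ∂μ, itinerary T ξ (r + 1) x = u → 0 < P x := by
      intro u
      by_cases h0 : μ (itinerary T ξ (r + 1) ⁻¹' {u}) = 0
      · filter_upwards [measure_eq_zero_iff_ae_notMem.1 h0] with x hx hxu
        exact absurd hxu hx
      · refine ae_of_all _ fun x hx => ?_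
        simp only [hP, hx]
        exact ENNReal.toReal_pos h0 (measure_ne_top _ _)
    filter_upwards [ae_all_iff.2 h1] with x hx using hx _ rfl
  have hPP' : ∀ x, P x ≤ P' x := by
    intro x
    refine measureReal_mono fun y hy => ?_
    simp only [mem_preimage, mem_singleton_iff] at hy ⊢
    exact congrArg (fun w => (Fin.init w : Fin r → β)) hy
  have hgood : ∀ᵐ x ∂μ, ∀ j, 0 < P (T^[j] x) ∧ 0 < ρ (a (T^[j] x)) := by
    rw [ae_all_iff]
    intro j
    exact (hmp.iterate j).quasiMeasurePreserving.ae (hPpos.and hρpos)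
  have hlower : ∀ᵐ x ∂μ, ∀ m : ℕ, W (r + m) (itinerary T a (r + m) x) =
      W r (itinerary T a r x) * ENNReal.ofReal (Real.exp
        (-(∑ j ∈ Finset.range m, g (T^[j] x) + ∑ j ∈ Finset.range m, φ (T^[r + j] x)))) := by
    filter_upwards [hgood] with x hx m
    induction m with
    | zero => simp
    | succ m ih =>
      rw [hstep, ih, mul_assoc]
      congr 1
      have h1 : 0 < P (T^[m] x) / P' (T^[m] x) := div_pos (hx m).1 ((hx m).1.trans_le (hPP' _))
      have h2 : (0 : ℝ) < ρ (a (T^[r + m] x)) := by exact_mod_cast (hx (r + m)).2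
      rw [← ENNReal.ofReal_coe_nnreal, ← ENNReal.ofReal_mul h1.le,
        ← ENNReal.ofReal_mul (Real.exp_pos _).le]
      congr 1
      rw [Finset.sum_range_succ, Finset.sum_range_succ]
      have e1 : P (T^[m] x) / P' (T^[m] x) = Real.exp (-g (T^[m] x)) := by
        simp only [hg]; rw [neg_neg, Real.exp_log h1]
      have e2 : (ρ (a (T^[r + m] x)) : ℝ) = Real.exp (-φ (T^[r + m] x)) := by
        simp only [hφdef]; rw [neg_neg, Real.exp_log h2]
      rw [e1, e2, ← Real.exp_add, ← Real.exp_add]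
      congr 1
      ring
  -- the exceptional events
  have hgm : Measurable g := (measurable_of_finite (fun u : Fin (r + 1) → β =>
    -Real.log (μ.real (itinerary T ξ (r + 1) ⁻¹' {u}) /
        μ.real (itinerary T ξ r ⁻¹' {(Fin.init u : Fin r → β)})))).comp (hmξ (r + 1))
  obtain ⟨B, hB⟩ : ∃ B : ℝ, ∀ x, |g x| ≤ B := by
    obtain ⟨B, hB⟩ := (Set.finite_range fun u : Fin (r + 1) → β =>
      |-Real.log (μ.real (itinerary T ξ (r + 1) ⁻¹' {u}) /
        μ.real (itinerary T ξ r ⁻¹' {(Fin.init u : Fin r → β)}))|).bddAbove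
    exact ⟨B, fun x => hB ⟨itinerary T ξ (r + 1) x, rfl⟩⟩
  have hgint : ∫ x, g x ∂μ < h := by
    have := integral_conditional_information hmp hξ r
    exact this.trans_lt hr
  -- The initial weight is positive everywhere, so these sets decrease to the empty set.
  have hE1 : ∃ K : ℕ, μ.real {x | W r (itinerary T a r x) < ENNReal.ofReal (Real.exp (-K))} ≤ ε / 3 := by
    have hWm : Measurable fun x => W r (itinerary T a r x) :=
      (measurable_of_countable (W r)).comp (hma r)
    have hlim := tendsto_measure_iInter_atTop (μ := μ)
      (s := fun K : ℕ => {x | W r (itinerary T a r x) < ENNReal.ofReal (Real.exp (-K))})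
      (fun K => (measurableSet_lt hWm measurable_const).nullMeasurableSet)
      (fun K K' hK x hx => lt_of_lt_of_le (b := ENNReal.ofReal (Real.exp (-K'))) hx
        (ENNReal.ofReal_le_ofReal (by gcongr))) ⟨0, measure_ne_top _ _⟩
    have hempty : ⋂ K : ℕ, {x | W r (itinerary T a r x) < ENNReal.ofReal (Real.exp (-K))} = ∅ := by
      rw [eq_empty_iff_forall_notMem]
      intro x hx
      simp only [mem_iInter, mem_ofPred_eq] at hx
      have hpos : 0 < W r (itinerary T a r x) := by
        refine wordWeight_pos (fun j hj v c => ?_) _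
        simp only [hq, not_le.2 hj, dif_neg, not_false_eq_true]
        exact_mod_cast hρ₀pos c
      have hl : Tendsto (fun K : ℕ => ENNReal.ofReal (Real.exp (-K))) atTop (𝓝 0) := by
        rw [← ENNReal.ofReal_zero]
        exact ENNReal.tendsto_ofReal (Real.tendsto_exp_neg_atTop_nhds_zero.comp
          tendsto_natCast_atTop_atTop)
      exact not_lt.2 (ge_of_tendsto' hl fun K => (hx K).le) hpos
    rw [hempty, measure_empty] at hlim
    have := (ENNReal.tendsto_toReal ENNReal.zero_ne_top).comp hlim
    obtain ⟨K, hK⟩ := (this.eventually_lt_const (show (0 : ℝ≥0∞).toReal < ε / 3 by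
      simpa using hε)).exists
    exact ⟨K, hK.le⟩
  obtain ⟨K, hK⟩ := hE1
  have hE2 := hT.eventually_measureReal_sum_gt_le hgm hB hδ (show 0 < ε / 3 by positivity)
  -- `φ` may be unbounded and is only known to be integrable, so Markov's inequality takes the place
  -- of the ergodic theorem. This is why its integral is assumed to be at most `δ * (ε / 3)`.
  have hE3 : ∀ m : ℕ, 0 < m →
      μ.real {x | m * δ ≤ ∑ j ∈ Finset.range m, φ (T^[r + j] x)} ≤ ε / 3 := by
    intro m hm
    have hm' : (0 : ℝ) < m := by exact_mod_cast hm
    have hφj : ∀ j, Integrable (fun x => φ (T^[j] x)) μ := fun j =>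
      (hmp.iterate j).integrable_comp_of_integrable hφi
    have hφ0 : ∀ x, 0 ≤ φ x := fun x => by
      simp only [hφdef]
      rw [neg_nonneg]
      exact Real.log_nonpos (by positivity) (by exact_mod_cast hρ1 _)
    have h1 := mul_meas_ge_le_integral_of_nonneg (μ := μ)
      (f := fun x => ∑ j ∈ Finset.range m, φ (T^[r + j] x))
      (ae_of_all _ fun x => Finset.sum_nonneg fun j _ => hφ0 _)
      (integrable_finsetSum _ fun j _ => hφj (r + j)) (m * δ)
    rw [integral_finsetSum _ fun j _ => hφj (r + j)] at h1
    have h2 : ∀ j, ∫ x, φ (T^[j] x) ∂μ = ∫ x, φ x ∂μ := by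
      intro j
      have hm := hmp.iterate j
      have := integral_map hm.aemeasurable (f := φ) (by rw [hm.map_eq]; exact hφi.1)
      rw [hm.map_eq] at this
      exact this.symm
    simp only [h2, Finset.sum_const, Finset.card_range, nsmul_eq_mul] at h1
    have h3 : (m * δ) * μ.real {x | m * δ ≤ ∑ j ∈ Finset.range m, φ (T^[r + j] x)} ≤
        (m * δ) * (ε / 3) := by
      refine h1.trans ?_
      rw [mul_assoc]
      gcongr
    exact le_of_mul_le_mul_left h3 (by positivity)
  refine ⟨Real.exp K, (Real.exp_pos _).le, ?_⟩
  have hev : ∀ᶠ m : ℕ in atTop, ∃ Q : Finset (Fin (r + m) → α),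
      (Q.card : ℝ) ≤ Real.exp K * Real.exp ((r + m : ℕ) * (h + 2 * δ)) ∧
      μ.real {x | itinerary T a (r + m) x ∉ Q} ≤ ε := by
    filter_upwards [hE2, eventually_gt_atTop 0] with m hm2 hm0
    have hm0' : (0 : ℝ) < m := by exact_mod_cast hm0
    set θ : ℝ := Real.exp (-K) * Real.exp (-(m * (h + 2 * δ))) with hθ
    have hθ0 : 0 < θ := by positivity
    obtain ⟨hfin, hcard⟩ := ENNReal.finset_card_const_le_le_of_tsum_le (a := W (r + m))
      ENNReal.one_ne_top (tsum_wordWeight_le_one hq1 (r + m)) (ε := ENNReal.ofReal θ)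
      (by simpa using hθ0)
    refine ⟨hfin.toFinset, ?_, ?_⟩
    · rw [one_div, ← ENNReal.ofReal_inv_of_pos hθ0, ← ENNReal.ofReal_natCast,
        ENNReal.ofReal_le_ofReal_iff (by positivity)] at hcard
      refine hcard.trans ?_
      rw [hθ, mul_inv, ← Real.exp_neg, ← Real.exp_neg, neg_neg, neg_neg]
      gcongr
      omega
    · have hsub : ∀ᵐ x ∂μ, x ∈ {x | itinerary T a (r + m) x ∉ hfin.toFinset} → x ∈
          {x | W r (itinerary T a r x) < ENNReal.ofReal (Real.exp (-K))} ∪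
          ({x | m * (∫ y, g y ∂μ + δ) < ∑ j ∈ Finset.range m, g (T^[j] x)} ∪
          {x | m * δ ≤ ∑ j ∈ Finset.range m, φ (T^[r + j] x)}) := by
        filter_upwards [hlower] with x hx hxQ
        by_contra hcon
        have hcon' : ¬ (W r (itinerary T a r x) < ENNReal.ofReal (Real.exp (-K)) ∨
          (m * (∫ y, g y ∂μ + δ) < ∑ j ∈ Finset.range m, g (T^[j] x)) ∨
          (m * δ ≤ ∑ j ∈ Finset.range m, φ (T^[r + j] x))) := hcon
        push Not at hcon'
        obtain ⟨c1, c2, c3⟩ := hcon'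
        refine hxQ ?_
        -- Off the exceptional events the exponent is at most `m (∫ g + δ) + m δ`, and `∫ g < h`.
        have hgoal : ENNReal.ofReal θ ≤ W (r + m) (itinerary T a (r + m) x) := by
          rw [hx m, hθ, ENNReal.ofReal_mul (Real.exp_pos _).le]
          gcongr
          nlinarith
        simpa using hgoal
      have hμ : μ.real {x | itinerary T a (r + m) x ∉ hfin.toFinset} ≤
          μ.real ({x | W r (itinerary T a r x) < ENNReal.ofReal (Real.exp (-K))} ∪
          ({x | m * (∫ y, g y ∂μ + δ) < ∑ j ∈ Finset.range m, g (T^[j] x)} ∪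
          {x | m * δ ≤ ∑ j ∈ Finset.range m, φ (T^[r + j] x)} : Set Ω)) :=
        ENNReal.toReal_mono (measure_ne_top _ _) (measure_mono_ae hsub)
      have u1 := measureReal_union_le (μ := μ)
        {x | W r (itinerary T a r x) < ENNReal.ofReal (Real.exp (-K))}
        ({x | m * (∫ y, g y ∂μ + δ) < ∑ j ∈ Finset.range m, g (T^[j] x)} ∪
          {x | m * δ ≤ ∑ j ∈ Finset.range m, φ (T^[r + j] x)})
      have u2 := measureReal_union_le (μ := μ)
        {x | m * (∫ y, g y ∂μ + δ) < ∑ j ∈ Finset.range m, g (T^[j] x)}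
        {x | m * δ ≤ ∑ j ∈ Finset.range m, φ (T^[r + j] x)}
      have := hE3 m hm0
      linarith
  obtain ⟨m₀, hm₀⟩ := eventually_atTop.1 hev
  filter_upwards [eventually_ge_atTop (r + m₀)] with n hn
  obtain ⟨m, rfl⟩ : ∃ m, n = r + m := ⟨n - r, by omega⟩
  exact hm₀ m (by omega)

end Covering

/-! ### Number and size of cylinders in terms of entropy. -/

section Entropy

variable {Ω : Type*} [MeasurableSpace Ω] {μ : Measure Ω} [IsProbabilityMeasure μ] {T : Ω → Ω}

theorem ae_pos_measureReal_fiber {α : Type*} [Countable α] (a : Ω → α) :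
    ∀ᵐ x ∂μ, 0 < μ.real (a ⁻¹' {a x}) := by
  have h1 : ∀ c, ∀ᵐ x ∂μ, a x = c → 0 < μ.real (a ⁻¹' {a x}) := by
    intro c
    by_cases h0 : μ (a ⁻¹' {c}) = 0
    · filter_upwards [measure_eq_zero_iff_ae_notMem.1 h0] with x hx hxc
      exact absurd hxc hx
    · refine ae_of_all _ fun x hx => ?_
      rw [hx]
      exact ENNReal.toReal_pos h0 (measure_ne_top _ _)
  filter_upwards [ae_all_iff.2 h1] with x hx using hx _ rfl

/-- For a countable partition of finite entropy, most of the space is covered by about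
`exp (n h)` cylinders of length `n`, for every `h` above the Kolmogorov-Sinai entropy. -/
theorem exists_covering_words_of_ksEntropy_lt (hT : Ergodic T μ) {a : Ω → ℕ} (ha : Measurable a)
    (hsum : Summable fun c => Real.negMulLog (μ.real (a ⁻¹' {c}))) {h : ℝ}
    (hh : ksEntropy T μ < ENNReal.ofReal h) {ε : ℝ} (hε : 0 < ε) :
    ∃ C : ℝ, 0 ≤ C ∧ ∀ᶠ n : ℕ in atTop, ∃ Q : Finset (Fin n → ℕ),
      (Q.card : ℝ) ≤ C * Real.exp (n * h) ∧ μ.real {x | itinerary T a n x ∉ Q} ≤ ε := by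
  obtain ⟨h₁', hh1, hh2⟩ := exists_between hh
  set h₁ := h₁'.toReal with hh₁
  have hfin : h₁' ≠ ∞ := (hh2.trans ENNReal.ofReal_lt_top).ne
  have h1h : h₁ < h := by
    rw [← ENNReal.ofReal_toReal hfin] at hh2
    exact (ENNReal.ofReal_lt_ofReal_iff_of_nonneg ENNReal.toReal_nonneg).1 hh2
  set δ := (h - h₁) / 2 with hδ
  have hδ0 : 0 < δ := by rw [hδ]; linarith
  set P : ℕ → ℝ := fun c => μ.real (a ⁻¹' {c}) with hP
  have hP0 : ∀ c, 0 ≤ P c := fun c => measureReal_nonneg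
  have hP1 : ∀ c, P c ≤ 1 := fun c => measureReal_le_one
  set f : ℕ → ℝ := fun c => Real.negMulLog (P c) with hf
  have hf0 : ∀ c, 0 ≤ f c := fun c => Real.negMulLog_nonneg (hP0 c) (hP1 c)
  -- Finite entropy is used here: the letters from `p` on carry so little entropy that merging them
  -- costs at most `δ` per step outside a set of measure `ε / 3`.
  obtain ⟨p, hp⟩ : ∃ p : ℕ, ∑' c, f c - ∑ c ∈ Finset.range p, f c < δ * (ε / 3) := by
    have h1 := hsum.hasSum.tendsto_sum_nat
    have h2 := (tendsto_const_nhds (x := ∑' c, f c)).sub h1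
    rw [sub_self] at h2
    exact (h2.eventually_lt_const (by positivity)).exists
  -- All letters from `p` on are merged into the single letter `p`. Within that fibre `ρ` is their
  -- measure, so the integral of `-log ρ` is exactly the entropy tail.
  set τ : ℕ → Fin (p + 1) := fun c => ⟨min c p, by omega⟩ with hτ
  set ρ : ℕ → ℝ≥0 := fun c => if c < p then 1 else (P c).toNNReal with hρdef
  have hρlt : ∀ c, c < p → ρ c = 1 := fun c hc => if_pos hc
  have hρge : ∀ c, ¬ c < p → ρ c = (P c).toNNReal := fun c hc => if_neg hc
  have hPsum : ∑' c, ENNReal.ofReal (P c) = 1 := by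
    have h1 : ∀ c, ENNReal.ofReal (P c) = μ (a ⁻¹' {c}) := fun c => ofReal_measureReal
    simp only [h1]
    rw [← measure_iUnion (fun c c' hcc => Disjoint.preimage _ (by simpa using hcc))
      (fun c => ha (measurableSet_singleton c)), ← preimage_iUnion]
    have : (⋃ i : ℕ, {i}) = (univ : Set ℕ) := by ext; simp
    rw [this, preimage_univ, measure_univ]
  have hρ : ∀ b, ∑' c : {c // τ c = b}, (ρ c : ℝ≥0∞) ≤ 1 := by
    intro b
    by_cases hb : (b : ℕ) < p
    · have h1 : ∀ c : {c // τ c = b}, c = ⟨b, by ext; simp [hτ]; omega⟩ := by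
        rintro ⟨c, hc⟩
        have := congrArg Fin.val hc
        simp only [hτ] at this
        ext
        simp only
        omega
      rw [tsum_eq_single ⟨b, by ext; simp [hτ]; omega⟩ (fun c hc => absurd (h1 c) hc)]
      rw [hρlt _ hb]; simp
    · rw [← hPsum]
      refine le_trans (ENNReal.tsum_le_tsum (g := fun c : {c // τ c = b} => ENNReal.ofReal (P c))
        ?_) (ENNReal.tsum_comp_le_tsum_of_injective Subtype.val_injective _)
      rintro ⟨c, hc⟩
      have := congrArg Fin.val hc
      simp only [hτ] at this
      have hcp : ¬ c < p := by omega
      rw [hρge _ hcp]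
      rfl
  have hρ1 : ∀ c, ρ c ≤ 1 := by
    intro c
    by_cases hc : c < p
    · rw [hρlt c hc]
    · rw [hρge c hc]; simpa using hP1 c
  have hρpos : ∀ᵐ x ∂μ, 0 < ρ (a x) := by
    filter_upwards [ae_pos_measureReal_fiber (μ := μ) a] with x hx
    by_cases hc : a x < p
    · rw [hρlt _ hc]; exact one_pos
    · rw [hρge _ hc]; simpa using hx
  have hterm : ∀ c, ENNReal.ofReal (-Real.log (ρ c)) * μ (a ⁻¹' {c})
      = ENNReal.ofReal (if c < p then 0 else f c) := by
    intro c
    have h1 : μ (a ⁻¹' {c}) = ENNReal.ofReal (P c) := (ofReal_measureReal (measure_ne_top _ _)).symm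
    by_cases hc : c < p
    · rw [hρlt _ hc, if_pos hc]; simp
    · rw [hρge _ hc, if_neg hc, Real.coe_toNNReal _ (hP0 c), h1, mul_comm, ← ENNReal.ofReal_mul (hP0 c)]
      congr 1
      simp only [hf, Real.negMulLog]
      ring
  have htail : ∑' c, ENNReal.ofReal (if c < p then 0 else f c) ≤ ENNReal.ofReal (δ * (ε / 3)) := by
    have e1 : (fun c => if c < p then 0 else f c) = fun c => f c - if c < p then f c else 0 := by
      funext c; split_ifs <;> simp
    have s2 : HasSum (fun c => if c < p then f c else 0) (∑ c ∈ Finset.range p, f c) := by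
      have h1 := hasSum_sum_of_ne_finset_zero (L := SummationFilter.unconditional ℕ)
        (f := fun c => if c < p then f c else 0)
        (s := Finset.range p) (fun c hc => by simp at hc; simp; omega)
      have h2 : ∑ c ∈ Finset.range p, (if c < p then f c else 0) = ∑ c ∈ Finset.range p, f c :=
        Finset.sum_congr rfl fun c hc => by simp [Finset.mem_range.1 hc]
      rwa [h2] at h1
    have s3 := hsum.hasSum.sub s2
    rw [← e1] at s3
    rw [← ENNReal.ofReal_tsum_of_nonneg _ s3.summable, s3.tsum_eq]
    · exact ENNReal.ofReal_le_ofReal hp.le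
    · intro c; split_ifs
      · exact le_rfl
      · exact hf0 c
  have hφm : Measurable fun x => -Real.log (ρ (a x)) :=
    (measurable_of_countable fun c => -Real.log (ρ c)).comp ha
  have hφ0 : ∀ x, 0 ≤ -Real.log (ρ (a x)) := fun x => by
    rw [neg_nonneg]
    exact Real.log_nonpos (by positivity) (by exact_mod_cast hρ1 _)
  have hlint : ∫⁻ x, ENNReal.ofReal (-Real.log (ρ (a x))) ∂μ ≤ ENNReal.ofReal (δ * (ε / 3)) := by
    refine le_trans (le_of_eq ?_) htail
    rw [← lintegral_map (f := fun c => ENNReal.ofReal (-Real.log (ρ c)))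
      (measurable_of_countable _) ha, lintegral_countable']
    refine tsum_congr fun c => ?_
    rw [Measure.map_apply ha (measurableSet_singleton c), hterm]
  have hφi : Integrable (fun x => -Real.log (ρ (a x))) μ := by
    refine ⟨hφm.aestronglyMeasurable, ?_⟩
    rw [hasFiniteIntegral_iff_ofReal (ae_of_all _ hφ0)]
    exact hlint.trans_lt ENNReal.ofReal_lt_top
  have hφ : ∫ x, -Real.log (ρ (a x)) ∂μ ≤ δ * (ε / 3) := by
    rw [← ENNReal.ofReal_le_ofReal_iff (by positivity), ofReal_integral_eq_lintegral_ofReal hφi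
      (ae_of_all _ hφ0)]
    exact hlint
  have hpart : partitionEntropy T μ (fun x => τ (a x)) < ENNReal.ofReal h₁ := by
    rw [hh₁, ENNReal.ofReal_toReal hfin]
    refine lt_of_le_of_lt ?_ hh1
    exact le_iSup_of_le (p + 1) (le_iSup_of_le (fun x => τ (a x)) (le_iSup_of_le
      ((measurable_of_countable τ).comp ha) le_rfl))
  have := exists_covering_words hT ha τ ρ hρ hρ1 hρpos hδ0 hε hφi hφ hpart
  have e : h₁ + 2 * δ = h := by rw [hδ]; ring
  rwa [e] at this

section Finite

variable {β : Type*} [Fintype β] [MeasurableSpace β] [MeasurableSingletonClass β]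

omit [Fintype β] in
theorem sum_measureReal_fiber {η : Ω → β} (hη : Measurable η) (s : Finset β) :
    ∑ w ∈ s, μ.real (η ⁻¹' {w}) = μ.real {x | η x ∈ s} := by
  rw [← measureReal_biUnion_finset]
  · congr 1
    ext x
    simp
  · intro a _ a' _ h
    exact Disjoint.preimage _ (by simpa using h)
  · exact fun a _ => hη (measurableSet_singleton a)

/-- For a finite partition, cylinders of length `n` of measure larger than `exp (-n h)` have small
total measure, for every `h` below the entropy of the partition. -/
theorem eventually_measureReal_large_cylinders_le_of_finite (hT : Ergodic T μ) {η : Ω → β}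
    (hη : Measurable η) {h : ℝ} (h0 : 0 ≤ h) (hh : ENNReal.ofReal h < partitionEntropy T μ η)
    {ε : ℝ} (hε : 0 < ε) : ∀ᶠ n : ℕ in atTop,
      μ.real {x | Real.exp (-(n * h)) < μ.real (itinerary T η n ⁻¹' {itinerary T η n x})} ≤ ε := by
  classical
  have hmp := hT.toMeasurePreserving
  obtain ⟨L, hL0, hL, hLn, -⟩ := exists_entropy_rate hmp hη
  have hLh : h < L := by
    rw [hL] at hh
    exact (ENNReal.ofReal_lt_ofReal_iff_of_nonneg h0).1 hh
  set D := L - h with hD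
  have hD0 : 0 < D := by rw [hD]; linarith
  set M := Real.log (Fintype.card β) with hM
  have hM0 : 0 ≤ M := Real.log_natCast_nonneg _
  -- Chosen so that `3δ + δM = ε D / 2`: the first term is the excess in the count of typical words,
  -- the second bounds the entropy per step of the uncovered words.
  set δ := ε * D / (2 * (3 + M)) with hδ
  have hδ0 : 0 < δ := by positivity
  -- Nothing is merged here, so `ρ = 1`. With `L + δ` as upper bound for the entropy, the count is
  -- about `exp (n (L + 3δ))`.
  have hcov := exists_covering_words hT hη id (fun _ => 1) (fun b => by
      rw [tsum_eq_single (⟨b, rfl⟩ : {c // id c = b}) (fun c hc => absurd (Subtype.ext c.2) hc)]; simp)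
    (fun _ => le_rfl) (ae_of_all _ fun _ => one_pos) (h := L + δ) hδ0 hδ0 (by simp)
    (by simp; positivity) (by
      simp only [id]
      change partitionEntropy T μ η < _
      rw [hL]
      exact (ENNReal.ofReal_lt_ofReal_iff_of_nonneg hL0).2 (by linarith))
  obtain ⟨C, hC0, hC⟩ := hcov
  set c := Real.log (C + 1) with hc
  have hc0 : 0 ≤ c := Real.log_nonneg (by linarith)
  have hlarge : ∀ᶠ n : ℕ in atTop, (c + 3) / (n : ℝ) ≤ ε * D / 2 := by
    have : Tendsto (fun n : ℕ => (c + 3) / (n : ℝ)) atTop (𝓝 0) :=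
      tendsto_const_nhds.div_atTop tendsto_natCast_atTop_atTop
    filter_upwards [this.eventually_lt_const (show 0 < ε * D / 2 by positivity)] with n hn
      using hn.le
  filter_upwards [hC, hlarge, eventually_gt_atTop 0] with n hn hn2 hn0
  obtain ⟨Q, hQc, hQ⟩ := hn
  have hn0' : (0 : ℝ) < n := by exact_mod_cast hn0
  have hm := measurable_itinerary hmp.measurable hη n
  set p : (Fin n → β) → ℝ := fun w => μ.real (itinerary T η n ⁻¹' {w}) with hp
  have hp0 : ∀ w, 0 ≤ p w := fun w => measureReal_nonneg
  -- Words are split into the large ones `B`, at most `exp (n h)` in number, the other covered ones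
  -- `G`, and a remainder `R` of mass at most `δ`. The total entropy is at least `n L`, yet each
  -- unit of mass in `B` can carry only about `n h`, so the mass of `B` is small.
  set B := Finset.univ.filter (fun w => Real.exp (-(n * h)) < p w) with hB
  set G := Q \ B with hG
  set R := (B ∪ Q)ᶜ with hR
  set PB := ∑ w ∈ B, p w with hPB
  have hsplit : ∀ f : (Fin n → β) → ℝ, ∑ w, f w = ∑ w ∈ B, f w + ∑ w ∈ G, f w + ∑ w ∈ R, f w := by
    intro f
    rw [← Finset.sum_union Finset.disjoint_sdiff, Finset.union_sdiff_self_eq_union,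
      Finset.sum_add_sum_compl]
  have htot : ∑ w, p w = 1 := by
    rw [sum_measureReal_fiber hm]; simp
  have hPR : ∑ w ∈ R, p w ≤ δ := by
    refine le_trans ?_ hQ
    rw [sum_measureReal_fiber hm]
    refine measureReal_mono fun x hx => ?_
    simp only [hR, Finset.mem_compl, Finset.mem_union, not_or, mem_ofPred_eq] at hx ⊢
    exact hx.2
  have hPR0 : 0 ≤ ∑ w ∈ R, p w := Finset.sum_nonneg fun w _ => hp0 w
  have hPG0 : 0 ≤ ∑ w ∈ G, p w := Finset.sum_nonneg fun w _ => hp0 w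
  have hPB0 : 0 ≤ PB := Finset.sum_nonneg fun w _ => hp0 w
  have hsum := hsplit p
  rw [htot] at hsum
  have ent : ∀ S : Finset (Fin n → β), ∑ w ∈ S, Real.negMulLog (p w) ≤
      (∑ w ∈ S, p w) * Real.log S.card + 1 := fun S =>
    (sum_negMulLog_le S p fun w _ => hp0 w).trans (by
      gcongr; exact negMulLog_le_one (Finset.sum_nonneg fun w _ => hp0 w))
  have logB : Real.log B.card ≤ n * h := by
    rcases Nat.eq_zero_or_pos B.card with h1 | h1
    · rw [h1]; simp; positivity
    rw [Real.log_le_iff_le_exp (by exact_mod_cast h1)]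
    have h2 : B.card • Real.exp (-(n * h)) ≤ PB :=
      Finset.card_nsmul_le_sum _ _ _ fun w hw => (Finset.mem_filter.1 hw).2.le
    rw [nsmul_eq_mul, Real.exp_neg, ← div_eq_mul_inv, div_le_iff₀ (Real.exp_pos _)] at h2
    refine h2.trans ?_
    have : PB ≤ 1 := by linarith
    have := Real.exp_pos (n * h)
    nlinarith
  have logG : Real.log G.card ≤ c + n * (L + 3 * δ) := by
    rcases Nat.eq_zero_or_pos G.card with h1 | h1
    · rw [h1]; simp; positivity
    rw [Real.log_le_iff_le_exp (by exact_mod_cast h1), Real.exp_add, hc,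
      Real.exp_log (by linarith)]
    have h2 : (G.card : ℝ) ≤ Q.card := by
      exact_mod_cast Finset.card_le_card Finset.sdiff_subset
    refine h2.trans (hQc.trans ?_)
    have e : L + δ + 2 * δ = L + 3 * δ := by ring
    rw [e]
    gcongr
    linarith
  have logR : Real.log R.card ≤ n * M := by
    rcases Nat.eq_zero_or_pos R.card with h1 | h1
    · rw [h1]; simp; positivity
    rw [hM, ← Real.log_pow]
    refine Real.log_le_log (by exact_mod_cast h1) ?_
    have : R.card ≤ Fintype.card (Fin n → β) := Finset.card_le_univ _
    rw [Fintype.card_fun, Fintype.card_fin] at this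
    exact_mod_cast this
  have hH := hLn n
  have hH2 : finEntropy μ (itinerary T η n) = ∑ w, Real.negMulLog (p w) := rfl
  rw [hH2, hsplit] at hH
  have b1 := ent B
  have b2 := ent G
  have b3 := ent R
  have c1 : PB * Real.log B.card ≤ PB * (n * h) := by gcongr
  have c2 : (∑ w ∈ G, p w) * Real.log G.card ≤ (1 - PB) * (c + n * (L + 3 * δ)) := by
    calc _ ≤ (∑ w ∈ G, p w) * (c + n * (L + 3 * δ)) := by gcongr
      _ ≤ _ := by
        gcongr
        linarith
  have c3 : (∑ w ∈ R, p w) * Real.log R.card ≤ δ * (n * M) :=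
    mul_le_mul hPR logR (Real.log_natCast_nonneg _) hδ0.le
  have d1 : PB * (n * D) ≤ n * (3 * δ + δ * M) + (c + 3) := by
    have : (1 - PB) * (c + n * (L + 3 * δ)) ≤ c + n * (L + 3 * δ) - PB * (n * L) := by
      have h1 : 0 ≤ PB * (c + n * (3 * δ)) := by positivity
      have h2 : (1 - PB) * (c + n * (L + 3 * δ)) =
        c + n * (L + 3 * δ) - PB * (n * L) - PB * (c + n * (3 * δ)) := by ring
      linarith
    have h3 : PB * (n * D) = PB * (n * L) - PB * (n * h) := by rw [hD]; ring
    have h4 : n * (3 * δ + δ * M) = n * (L + 3 * δ) - n * L + δ * (n * M) := by ring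
    linarith
  have d2 : 3 * δ + δ * M = ε * D / 2 := by
    rw [hδ]; field_simp
  rw [d2] at d1
  have d3 : c + 3 ≤ n * (ε * D / 2) := by
    rw [div_le_iff₀ hn0'] at hn2; linarith
  have d4 : PB * (n * D) ≤ ε * (n * D) := by
    have : ε * (n * D) = n * (ε * D / 2) + n * (ε * D / 2) := by ring
    linarith
  have d5 : PB ≤ ε := le_of_mul_le_mul_right d4 (by positivity)
  refine le_trans (le_of_eq ?_) d5
  rw [hPB, sum_measureReal_fiber hm]
  congr 1
  ext x
  simp [hB, hp]

/-- Each atom of `(ξ, η j)` and of `η j` differs from the corresponding atom of `(ξ, ξ)` and of `ξ`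
only where `ξ ≠ η j`. The joint entropy and that of `η j` therefore both tend to the entropy of `ξ`.
-/
theorem tendsto_finEntropy_prod_sub {ξ : Ω → β} (hξ : Measurable ξ) {η : ℕ → Ω → β}
    (hη : ∀ j, Measurable (η j))
    (hlim : Tendsto (fun j => μ.real {x | ξ x ≠ η j x}) atTop (𝓝 0)) :
    Tendsto (fun j => finEntropy μ (fun x => (ξ x, η j x)) - finEntropy μ (η j)) atTop (𝓝 0) := by
  have key : ∀ {s : Set Ω} {t : ℕ → Set Ω}, MeasurableSet s → (∀ j, MeasurableSet (t j)) →
      (∀ j, symmDiff (t j) s ⊆ {x | ξ x ≠ η j x}) →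
      Tendsto (fun j => Real.negMulLog (μ.real (t j))) atTop (𝓝 (Real.negMulLog (μ.real s))) := by
    intro s t hs ht hst
    refine (Real.continuous_negMulLog.tendsto _).comp ?_
    rw [tendsto_iff_dist_tendsto_zero]
    refine squeeze_zero (fun _ => dist_nonneg) (fun j => ?_) hlim
    rw [Real.dist_eq]
    exact (abs_measureReal_sub_le_measureReal_symmDiff (ht j).nullMeasurableSet
      hs.nullMeasurableSet).trans (measureReal_mono (hst j))
  have h1 : Tendsto (fun j => finEntropy μ (fun x => (ξ x, η j x))) atTop
      (𝓝 (finEntropy μ (fun x => (ξ x, ξ x)))) := by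
    refine tendsto_finsetSum _ fun b _ => ?_
    refine key ((hξ.prodMk hξ) (measurableSet_singleton b))
      (fun j => (hξ.prodMk (hη j)) (measurableSet_singleton b)) fun j x hx => ?_
    simp only [mem_ofPred_eq]
    intro hxx
    simp [mem_symmDiff, ← hxx] at hx
  have h2 : Tendsto (fun j => finEntropy μ (η j)) atTop (𝓝 (finEntropy μ ξ)) := by
    refine tendsto_finsetSum _ fun b _ => ?_
    refine key (hξ (measurableSet_singleton b))
      (fun j => (hη j) (measurableSet_singleton b)) fun j x hx => ?_
    simp only [mem_ofPred_eq]
    intro hxx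
    simp [mem_symmDiff, ← hxx] at hx
  have h3 : finEntropy μ (fun x => (ξ x, ξ x)) = finEntropy μ ξ :=
    le_antisymm (finEntropy_comp_le (μ := μ) hξ fun b => (b, b))
      (finEntropy_comp_le (μ := μ) (hξ.prodMk hξ) Prod.fst)
  have := h1.sub h2
  rwa [h3, sub_self] at this

end Finite

/-- For a generating partition, cylinders of length `n` of measure larger than `exp (-n h)` have
small total measure, for every `h` below the Kolmogorov-Sinai entropy. -/
theorem eventually_measureReal_large_cylinders_le (hT : Ergodic T μ) {a : Ω → ℕ}
    (ha : Measurable a)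
    (hgen : ∀ B : Set Ω, MeasurableSet B → ∀ ε > 0, ∃ (r : ℕ) (S : Set (Fin r → ℕ)),
      μ.real (symmDiff B (itinerary T a r ⁻¹' S)) ≤ ε)
    {h : ℝ} (h0 : 0 ≤ h) (hh : ENNReal.ofReal h < ksEntropy T μ) {ε : ℝ} (hε : 0 < ε) :
    ∀ᶠ n : ℕ in atTop,
      μ.real {x | Real.exp (-(n * h)) < μ.real (itinerary T a n ⁻¹' {itinerary T a n x})} ≤ ε := by
  classical
  have hmp := hT.toMeasurePreserving
  have hma := measurable_itinerary hmp.measurable ha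
  obtain ⟨h₁', hh1, hh2⟩ := exists_between hh
  set h₁ := h₁'.toReal with hh₁
  have hfin : h₁' ≠ ∞ := hh2.ne_top
  have h1h : h < h₁ := by
    rw [← ENNReal.ofReal_toReal hfin] at hh1
    exact (ENNReal.ofReal_lt_ofReal_iff_of_nonneg h0).1 hh1
  have hξ : ∃ (m : ℕ) (ξ : Ω → Fin m), Measurable ξ ∧ ENNReal.ofReal h₁ < partitionEntropy T μ ξ := by
    rw [hh₁, ENNReal.ofReal_toReal hfin]
    simpa [ksEntropy, lt_iSup_iff] using hh2
  obtain ⟨m, ξ, hξ, hξh⟩ := hξ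
  obtain ⟨L, hL0, hL, hLn, -⟩ := exists_entropy_rate hmp hξ
  have hLh : h₁ < L := by
    rw [hL] at hξh
    exact (ENNReal.ofReal_lt_ofReal_iff_of_nonneg ENNReal.toReal_nonneg).1 hξh
  have happ : ∀ j : ℕ, ∃ (r : ℕ) (s : (Fin r → ℕ) → Fin m),
      μ.real {x | ξ x ≠ s (itinerary T a r x)} ≤ 1 / ((j : ℝ) + 1) := by
    intro j
    have hpos : 0 < 1 / ((j : ℝ) + 1) / (m + 1) := by positivity
    choose r S hS using fun b : Fin m => hgen (ξ ⁻¹' {b}) (hξ (measurableSet_singleton b)) _ hpos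
    set r' := Finset.univ.sup r with hr'
    have hrr : ∀ b, r b ≤ r' := fun b => Finset.le_sup (Finset.mem_univ b)
    obtain ⟨x₀⟩ : Nonempty Ω := μ.nonempty_of_neZero
    -- Off the union of the approximation errors exactly one `S b` is hit, and it carries the right
    -- label. The default `ξ x₀` is used only when no `S b` is hit.
    set s : (Fin r' → ℕ) → Fin m := fun w =>
      if hw : ∃ b, (fun i : Fin (r b) => w (Fin.castLE (hrr b) i)) ∈ S b then hw.choose else ξ x₀
    refine ⟨r', s, ?_⟩
    have hsub : {x | ξ x ≠ s (itinerary T a r' x)} ⊆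
        ⋃ b ∈ (Finset.univ : Finset (Fin m)), symmDiff (ξ ⁻¹' {b}) (itinerary T a (r b) ⁻¹' S b) := by
      intro x hx
      by_contra hcon
      simp only [Finset.mem_univ, iUnion_true, mem_iUnion, not_exists, mem_symmDiff, mem_preimage,
        mem_singleton_iff, not_or, not_and, not_not] at hcon
      refine hx ?_
      have hw : ∃ b, (fun i : Fin (r b) => itinerary T a r' x (Fin.castLE (hrr b) i)) ∈ S b :=
        ⟨ξ x, (hcon (ξ x)).1 rfl⟩
      simp only [s, hw, dif_pos]
      exact (hcon hw.choose).2 hw.choose_spec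
    refine (measureReal_mono hsub (measure_ne_top _ _)).trans ((measureReal_biUnion_finset_le _ _).trans ?_)
    refine (Finset.sum_le_sum fun b _ => hS b).trans ?_
    rw [Finset.sum_const, Finset.card_univ, Fintype.card_fin, nsmul_eq_mul, mul_div_assoc',
      div_le_iff₀ (by positivity)]
    have : (0 : ℝ) ≤ 1 / ((j : ℝ) + 1) := by positivity
    nlinarith
  choose r s hs using happ
  set η : ℕ → Ω → Fin m := fun j x => s j (itinerary T a (r j) x) with hη
  have hηm : ∀ j, Measurable (η j) := fun j => (measurable_of_countable (s j)).comp (hma (r j))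
  have hlim := tendsto_finEntropy_prod_sub hξ hηm
    (squeeze_zero (fun _ => measureReal_nonneg) hs tendsto_one_div_add_atTop_nhds_zero_nat)
  obtain ⟨j, hj⟩ := (hlim.eventually_lt_const (show 0 < L - h₁ by linarith)).exists
  obtain ⟨L', hL'0, hL', -, hL'lim⟩ := exists_entropy_rate hmp (hηm j)
  have hLL' : L - (finEntropy μ (fun x => (ξ x, η j x)) - finEntropy μ (η j)) ≤ L' := by
    refine ge_of_tendsto hL'lim ?_
    filter_upwards [eventually_gt_atTop 0] with n hn
    have hn' : (0 : ℝ) < n := by exact_mod_cast hn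
    rw [le_div_iff₀ hn']
    have := finEntropy_itinerary_le_add hmp hξ (hηm j) n
    linarith [hLn n]
  have hηh : ENNReal.ofReal h₁ < partitionEntropy T μ (η j) := by
    rw [hL']
    exact (ENNReal.ofReal_lt_ofReal_iff_of_nonneg ENNReal.toReal_nonneg).2 (by linarith)
  have hev := eventually_measureReal_large_cylinders_le_of_finite hT (hηm j)
    (h0.trans h1h.le) hηh hε
  -- A cylinder of `a` of length `n + r j` lies in a cylinder of `η j` of length `n`. The gap `h₁ -
  -- h` absorbs the `r j` additional letters.
  have hlarge : ∀ᶠ n : ℕ in atTop, ((n + r j : ℕ) : ℝ) * h ≤ n * h₁ := by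
    obtain ⟨N, hN⟩ := exists_nat_ge (r j * h / (h₁ - h))
    filter_upwards [eventually_ge_atTop N] with n hn
    have h1 : (N : ℝ) ≤ n := by exact_mod_cast hn
    rw [div_le_iff₀ (by linarith)] at hN
    push_cast
    nlinarith
  obtain ⟨N, hN⟩ := eventually_atTop.1 (hev.and hlarge)
  filter_upwards [eventually_ge_atTop (N + r j)] with n' hn'
  obtain ⟨n, rfl⟩ : ∃ n, n' = n + r j := ⟨n' - r j, by omega⟩
  obtain ⟨e1, e2⟩ := hN n (by omega)
  refine le_trans (measureReal_mono fun x hx => ?_) e1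
  simp only [mem_ofPred_eq] at hx ⊢
  refine lt_of_le_of_lt (Real.exp_le_exp.2 (neg_le_neg e2)) (hx.trans_le ?_)
  refine measureReal_mono fun y hy => ?_
  simp only [mem_preimage, mem_singleton_iff] at hy ⊢
  funext i
  simp only [itinerary, hη]
  congr 1
  funext l
  have := congrFun hy ⟨i + l, by omega⟩
  simp only [itinerary] at this ⊢
  rw [← Function.iterate_add_apply, ← Function.iterate_add_apply, Nat.add_comm]
  exact this

end Entropy

/-! ### Intervals and sets with few endpoints. -/

section Interval

variable {I : Set unitInterval}

theorem convex_image_val (hI : I.OrdConnected) : Convex ℝ (Subtype.val '' I : Set ℝ) := by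
  refine OrdConnected.convex ⟨?_⟩
  rintro _ ⟨x, hx, rfl⟩ _ ⟨y, hy, rfl⟩ z ⟨hz1, hz2⟩
  exact ⟨⟨z, x.2.1.trans hz1, hz2.trans y.2.2⟩, hI.out hx hy ⟨hz1, hz2⟩, rfl⟩

theorem ordConnected_realInterior (hI : I.OrdConnected) : (realInterior I).OrdConnected :=
  (convex_image_val hI).interior.ordConnected.preimage_mono (Subtype.mono_coe _)

theorem volume_sdiff_realInterior (hI : I.OrdConnected) : volume (I \ realInterior I) = 0 := by
  rw [unitInterval.volume_apply]
  refine measure_mono_null ?_ ((convex_image_val hI).addHaar_frontier volume)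
  rintro _ ⟨x, ⟨hx, hx'⟩, rfl⟩
  exact ⟨subset_closure ⟨x, hx, rfl⟩, hx'⟩

end Interval

theorem ordConnected_inter_preimage {X Y : Type*} [Preorder X] [Preorder Y] {T : X → Y} {J : Set X}
    {K : Set Y} (hJ : J.OrdConnected) (hK : K.OrdConnected) (hT : MonotoneOn T J ∨ AntitoneOn T J) :
    (J ∩ T ⁻¹' K).OrdConnected := by
  refine ⟨fun x hx y hy z hz => ?_⟩
  have hzJ := hJ.out hx.1 hy.1 hz
  refine ⟨hzJ, ?_⟩
  rcases hT with hT | hT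
  · exact hK.out hx.2 hy.2 ⟨hT hx.1 hzJ hz.1, hT hzJ hy.1 hz.2⟩
  · exact hK.out hy.2 hx.2 ⟨hT hzJ hy.1 hz.2, hT hx.1 hzJ hz.1⟩

/-- The points whose first `n` iterates visit the sets `J (w 0), ..., J (w (n - 1))`. -/
def wordSet {X : Type*} (T : X → X) (J : ℕ → Set X) (n : ℕ) (w : Fin n → ℕ) : Set X :=
  {x | ∀ j : Fin n, T^[j] x ∈ J (w j)}

/-- Peel off the first letter: within an interval of monotonicity, the preimage of an interval is an
interval. -/
theorem ordConnected_wordSet {X : Type*} [Preorder X] {T : X → X} {J : ℕ → Set X}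
    (hJ : ∀ c, (J c).OrdConnected) (hT : ∀ c, MonotoneOn T (J c) ∨ AntitoneOn T (J c)) (n : ℕ)
    (w : Fin n → ℕ) : (wordSet T J n w).OrdConnected := by
  induction n with
  | zero =>
    have : wordSet T J 0 w = univ := eq_univ_of_forall fun x j => j.elim0
    rw [this]
    exact ordConnected_univ
  | succ n ih =>
    have : wordSet T J (n + 1) w = J (w 0) ∩ T ⁻¹' wordSet T J n (fun j => w j.succ) := by
      ext x
      simp only [wordSet, mem_ofPred_eq, Fin.forall_fin_succ, mem_inter_iff, mem_preimage]
      rfl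
    rw [this]
    exact ordConnected_inter_preimage (hJ _) (ih _) (hT _)

theorem disjoint_wordSet {X : Type*} {T : X → X} {J : ℕ → Set X}
    (hJ : Pairwise fun c d => Disjoint (J c) (J d)) {n : ℕ} {w w' : Fin n → ℕ} (h : w ≠ w') :
    Disjoint (wordSet T J n w) (wordSet T J n w') := by
  obtain ⟨j, hj⟩ := Function.ne_iff.1 h
  rw [Set.disjoint_left]
  intro x hx hx'
  exact Set.disjoint_left.1 (hJ hj) (hx j) (hx' j)

section CutBound

variable {X : Type*} [LinearOrder X]

/-- Every finite disjoint family of intervals all of which meet both `S` and its complement has at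
most `N` members. -/
def CutBound (S : Set X) (N : ℝ) : Prop :=
  ∀ F : Finset (Set X), (∀ J ∈ F, J.OrdConnected) → (F : Set (Set X)).PairwiseDisjoint id →
    (∀ J ∈ F, (J ∩ S).Nonempty ∧ (J \ S).Nonempty) → (F.card : ℝ) ≤ N

theorem CutBound.mono {S : Set X} {N N' : ℝ} (h : CutBound S N) (hN : N ≤ N') : CutBound S N' :=
  fun F h1 h2 h3 => (h F h1 h2 h3).trans hN

theorem cutBound_univ : CutBound (univ : Set X) 0 := by
  intro F _ _ h
  have : F = ∅ := Finset.eq_empty_of_forall_notMem fun J hJ => by simpa using (h J hJ).2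
  simp [this]

/-- A cut interval leaves `S` on the left or on the right, and two disjoint intervals cannot leave
it on the same side: their parts beside `S` would overlap. -/
theorem cutBound_of_ordConnected {S : Set X} (hS : S.OrdConnected) : CutBound S 2 := by
  classical
  intro F hF hd hc
  have hex : ∀ J ∈ F, ∃ x y, x ∈ J ∧ x ∈ S ∧ y ∈ J ∧ y ∉ S := fun J hJ => by
    obtain ⟨⟨x, hx⟩, ⟨y, hy⟩⟩ := hc J hJ
    exact ⟨x, y, hx.1, hx.2, hy.1, hy.2⟩
  set L := F.filter (fun J => ∃ x y, x ∈ J ∧ x ∈ S ∧ y ∈ J ∧ y ∉ S ∧ y < x) with hL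
  set R := F.filter (fun J => ∃ x y, x ∈ J ∧ x ∈ S ∧ y ∈ J ∧ y ∉ S ∧ x < y) with hR
  have hsub : F ⊆ L ∪ R := by
    intro J hJ
    obtain ⟨x, y, h1, h2, h3, h4⟩ := hex J hJ
    have hne : x ≠ y := fun h => h4 (h ▸ h2)
    rcases hne.lt_or_gt with h | h
    · exact Finset.mem_union_right _ (Finset.mem_filter.2 ⟨hJ, x, y, h1, h2, h3, h4, h⟩)
    · exact Finset.mem_union_left _ (Finset.mem_filter.2 ⟨hJ, x, y, h1, h2, h3, h4, h⟩)
  have hL1 : L.card ≤ 1 := by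
    refine Finset.card_le_one.2 fun J hJ J' hJ' => ?_
    obtain ⟨hJF, x, y, h1, h2, h3, h4, h5⟩ := Finset.mem_filter.1 hJ
    obtain ⟨hJF', x', y', h1', h2', h3', h4', h5'⟩ := Finset.mem_filter.1 hJ'
    by_contra hne
    have hdis := Set.disjoint_left.1 (hd hJF hJF' hne)
    have k1 : y < x' := by
      by_contra hcon
      exact h4 (hS.out h2' h2 ⟨not_lt.1 hcon, h5.le⟩)
    have k2 : y' < x := by
      by_contra hcon
      exact h4' (hS.out h2 h2' ⟨not_lt.1 hcon, h5'.le⟩)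
    exact hdis ((hF J hJF).out h3 h1 ⟨le_max_left y y', max_le h5.le k2.le⟩)
      ((hF J' hJF').out h3' h1' ⟨le_max_right y y', max_le k1.le h5'.le⟩)
  have hR1 : R.card ≤ 1 := by
    refine Finset.card_le_one.2 fun J hJ J' hJ' => ?_
    obtain ⟨hJF, x, y, h1, h2, h3, h4, h5⟩ := Finset.mem_filter.1 hJ
    obtain ⟨hJF', x', y', h1', h2', h3', h4', h5'⟩ := Finset.mem_filter.1 hJ'
    by_contra hne
    have hdis := Set.disjoint_left.1 (hd hJF hJF' hne)
    have k1 : x' < y := by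
      by_contra hcon
      exact h4 (hS.out h2 h2' ⟨h5.le, not_lt.1 hcon⟩)
    have k2 : x < y' := by
      by_contra hcon
      exact h4' (hS.out h2' h2 ⟨h5'.le, not_lt.1 hcon⟩)
    exact hdis ((hF J hJF).out h1 h3 ⟨le_max_left x x', max_le h5.le k1.le⟩)
      ((hF J' hJF').out h1' h3' ⟨le_max_right x x', max_le k2.le h5'.le⟩)
  have := (Finset.card_le_card hsub).trans (Finset.card_union_le L R)
  have h2 : F.card ≤ 2 := by omega
  exact_mod_cast h2

/-- An interval cut by a union is cut by one of its members: by a member that it meets, since some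
point of it avoids them all. -/
theorem CutBound.biUnion {ι : Type*} {s : Finset ι} {f : ι → Set X} {N : ℝ}
    (h : ∀ i ∈ s, CutBound (f i) N) : CutBound (⋃ i ∈ s, f i) (s.card * N) := by
  classical
  intro F hF hd hc
  set G : ι → Finset (Set X) := fun i => F.filter fun J => (J ∩ f i).Nonempty ∧ (J \ f i).Nonempty
    with hG
  have hsub : F ⊆ s.biUnion G := by
    intro J hJ
    obtain ⟨⟨x, hxJ, hx⟩, ⟨y, hyJ, hy⟩⟩ := hc J hJ
    simp only [mem_iUnion, not_exists] at hx hy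
    obtain ⟨i, hi, hxi⟩ := hx
    exact Finset.mem_biUnion.2 ⟨i, hi, Finset.mem_filter.2 ⟨hJ, ⟨x, hxJ, hxi⟩, ⟨y, hyJ, hy i hi⟩⟩⟩
  have h1 : (F.card : ℝ) ≤ ∑ i ∈ s, ((G i).card : ℝ) := by
    exact_mod_cast (Finset.card_le_card hsub).trans Finset.card_biUnion_le
  refine h1.trans ((Finset.sum_le_card_nsmul _ _ N fun i hi => ?_).trans (by simp))
  exact h i hi (G i) (fun J hJ => hF J (Finset.mem_filter.1 hJ).1)
    (hd.subset fun J hJ => (Finset.mem_filter.1 hJ).1) fun J hJ => (Finset.mem_filter.1 hJ).2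

theorem CutBound.inter {S S' : Set X} {N N' : ℝ} (h : CutBound S N) (h' : CutBound S' N') :
    CutBound (S ∩ S') (N + N') := by
  classical
  intro F hF hd hc
  set G := F.filter fun J => (J ∩ S).Nonempty ∧ (J \ S).Nonempty with hG
  set G' := F.filter fun J => (J ∩ S').Nonempty ∧ (J \ S').Nonempty with hG'
  have hsub : F ⊆ G ∪ G' := by
    intro J hJ
    obtain ⟨⟨x, hxJ, hx, hx'⟩, ⟨y, hyJ, hy⟩⟩ := hc J hJ
    by_cases hyS : y ∈ S
    · have hyS' : y ∉ S' := fun h => hy ⟨hyS, h⟩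
      exact Finset.mem_union_right _ (Finset.mem_filter.2 ⟨hJ, ⟨x, hxJ, hx'⟩, ⟨y, hyJ, hyS'⟩⟩)
    · exact Finset.mem_union_left _ (Finset.mem_filter.2 ⟨hJ, ⟨x, hxJ, hx⟩, ⟨y, hyJ, hyS⟩⟩)
  have h1 : (F.card : ℝ) ≤ G.card + G'.card := by
    exact_mod_cast (Finset.card_le_card hsub).trans (Finset.card_union_le G G')
  have h2 := h G (fun J hJ => hF J (Finset.mem_filter.1 hJ).1)
    (hd.subset fun J hJ => (Finset.mem_filter.1 hJ).1) fun J hJ => (Finset.mem_filter.1 hJ).2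
  have h3 := h' G' (fun J hJ => hF J (Finset.mem_filter.1 hJ).1)
    (hd.subset fun J hJ => (Finset.mem_filter.1 hJ).1) fun J hJ => (Finset.mem_filter.1 hJ).2
  linarith

/-- The sets `S n` are, up to small measure, cut out by about `exp (n h)` endpoints. -/
def CutRate [MeasurableSpace X] (m : Measure X) (S : ℕ → Set X) (h : ℝ) : Prop :=
  ∀ ε > 0, ∃ C : ℝ, 0 ≤ C ∧ ∀ᶠ n : ℕ in atTop, ∃ S' : Set X, MeasurableSet S' ∧
    m.real (symmDiff (S n) S') ≤ ε ∧ CutBound S' (C * Real.exp (n * h))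

variable [MeasurableSpace X] {m : Measure X} [IsFiniteMeasure m] {h : ℝ}

theorem CutRate.inter {S R : ℕ → Set X} (hS : CutRate m S h) (hR : CutRate m R h) :
    CutRate m (fun n => S n ∩ R n) h := by
  intro ε hε
  obtain ⟨C, hC0, hC⟩ := hS (ε / 2) (by positivity)
  obtain ⟨D, hD0, hD⟩ := hR (ε / 2) (by positivity)
  refine ⟨C + D, by positivity, ?_⟩
  filter_upwards [hC, hD] with n ⟨S', hS', hS1, hS2⟩ ⟨R', hR', hR1, hR2⟩
  refine ⟨S' ∩ R', hS'.inter hR', ?_, ?_⟩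
  · have hsub : symmDiff (S n ∩ R n) (S' ∩ R') ⊆ symmDiff (S n) S' ∪ symmDiff (R n) R' := by
      intro x hx
      simp only [mem_symmDiff, mem_inter_iff, mem_union] at hx ⊢
      tauto
    have := (measureReal_mono (μ := m) hsub).trans (measureReal_union_le _ _)
    linarith
  · rw [add_mul]
    exact hS2.inter hR2

theorem CutRate.iInter {ι : Type*} [Fintype ι] {S : ι → ℕ → Set X} (hS : ∀ i, CutRate m (S i) h) :
    CutRate m (fun n => ⋂ i, S i n) h := by
  classical
  have key : ∀ s : Finset ι, CutRate m (fun n => ⋂ i ∈ s, S i n) h := by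
    intro s
    induction s using Finset.induction_on with
    | empty =>
      intro ε hε
      refine ⟨0, le_rfl, Eventually.of_forall fun n => ⟨univ, MeasurableSet.univ, ?_, ?_⟩⟩
      · simpa using hε.le
      · simpa using cutBound_univ
    | insert i s _ ih =>
      simp only [Finset.set_biInter_insert]
      exact (hS i).inter ih
  simpa using key Finset.univ

end CutBound

/-! ### Symbolic coding of piecewise monotone maps. -/

/-- A symbolic coding of a piecewise monotone system by natural numbers. -/
structure IsCoding (T : unitInterval → unitInterval) (μ : Measure unitInterval)
    (𝒜 : Set (Set unitInterval)) (a : unitInterval → ℕ) (J : ℕ → Set unitInterval) : Prop where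
  measurableSet_fiber : ∀ c, MeasurableSet[MeasurableSpace.generateFrom 𝒜] (a ⁻¹' {c})
  measurable : Measurable a
  ordConnected : ∀ c, (J c).OrdConnected
  monotone : ∀ c, MonotoneOn T (J c) ∨ AntitoneOn T (J c)
  disjoint : Pairwise fun c d => Disjoint (J c) (J d)
  ae_mem : ∀ᵐ x ∂μ, x ∈ J (a x)
  summable : Summable fun c => Real.negMulLog (μ.real (a ⁻¹' {c}))
  ae_eq_fiber : ∀ I ∈ 𝒜, ∃ c, I =ᵐ[μ] a ⁻¹' {c}

section ClassT

variable {T : unitInterval → unitInterval} {μ : Measure unitInterval}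
  {𝒜 : Set (Set unitInterval)}

theorem ClassT.absolutelyContinuous (h : ClassT T μ 𝒜) : μ ≪ volume ∧ volume ≪ μ := by
  obtain ⟨c, -, h1, h2⟩ := h.comparable
  exact ⟨(Measure.absolutelyContinuous_of_le h1).trans Measure.smul_absolutelyContinuous,
    (Measure.absolutelyContinuous_of_le h2).trans Measure.smul_absolutelyContinuous⟩

theorem ClassT.exists_measureReal_le (h : ClassT T μ 𝒜) : ∃ c : ℝ, 0 ≤ c ∧
    ∀ s : Set unitInterval, μ.real s ≤ c * volume.real s ∧ volume.real s ≤ c * μ.real s := by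
  have := h.prob
  obtain ⟨c, -, h1, h2⟩ := h.comparable
  refine ⟨c, c.2, fun s => ⟨?_, ?_⟩⟩
  · have := ENNReal.toReal_mono (by finiteness) (h1 s)
    simpa [measureReal_def] using this
  · have := ENNReal.toReal_mono (by finiteness) (h2 s)
    simpa [measureReal_def] using this

theorem IsIntervalPartition.measurableSet (h : IsIntervalPartition 𝒜) {I : Set unitInterval}
    (hI : I ∈ 𝒜) : MeasurableSet I :=
  (h.interval I hI).measurableSet

/-- The fibres of `a` come from the atoms themselves, so that cylinders belong to the algebras of
property B. The sets `J c` are the interiors, where `T` is monotone. The two agree almost everywhere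
because an interval differs from its interior by a null set. -/
theorem ClassT.exists_isCoding (h : ClassT T μ 𝒜) : ∃ a J, IsCoding T μ 𝒜 a J := by
  classical
  have := h.prob
  have hcount := h.partition.countable.to_subtype
  obtain ⟨e, he⟩ := exists_injective_nat 𝒜
  set F : ℕ → Set unitInterval := fun c => ⋃ (I : 𝒜) (_ : e I = c), (I : Set unitInterval) with hF
  set J : ℕ → Set unitInterval := fun c => ⋃ (I : 𝒜) (_ : e I = c), realInterior I with hJ
  have hFe : ∀ I : 𝒜, F (e I) = I := by
    intro I
    ext x
    simp only [hF, mem_iUnion]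
    constructor
    · rintro ⟨I', h1, h2⟩
      rwa [← he h1]
    · exact fun hx => ⟨I, rfl, hx⟩
  have hJe : ∀ I : 𝒜, J (e I) = realInterior I := by
    intro I
    ext x
    simp only [hJ, mem_iUnion]
    constructor
    · rintro ⟨I', h1, h2⟩
      rwa [← he h1]
    · exact fun hx => ⟨I, rfl, hx⟩
  have hFn : ∀ c, (¬ ∃ I, e I = c) → F c = ∅ := by
    intro c hc
    ext x
    simp only [hF, mem_iUnion, mem_empty_iff_false, iff_false]
    rintro ⟨I, h1, -⟩
    exact hc ⟨I, h1⟩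
  have hJn : ∀ c, (¬ ∃ I, e I = c) → J c = ∅ := by
    intro c hc
    ext x
    simp only [hJ, mem_iUnion, mem_empty_iff_false, iff_false]
    rintro ⟨I, h1, -⟩
    exact hc ⟨I, h1⟩
  have hFm : ∀ c, MeasurableSet[MeasurableSpace.generateFrom 𝒜] (F c) := by
    intro c
    by_cases hc : ∃ I, e I = c
    · obtain ⟨I, rfl⟩ := hc
      rw [hFe]
      exact MeasurableSpace.measurableSet_generateFrom I.2
    · rw [hFn c hc]
      exact @MeasurableSet.empty _ (MeasurableSpace.generateFrom 𝒜)
  have hgm : MeasurableSpace.generateFrom 𝒜 ≤ (inferInstance : MeasurableSpace unitInterval) :=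
    MeasurableSpace.generateFrom_le fun I hI => h.partition.measurableSet hI
  have hdisj : Pairwise fun c d => Disjoint (J c) (J d) := by
    intro c d hcd
    by_cases hc : ∃ I, e I = c
    · by_cases hd : ∃ I, e I = d
      · obtain ⟨I, rfl⟩ := hc
        obtain ⟨I', rfl⟩ := hd
        rw [hJe, hJe]
        exact h.partition.disjoint_interior I.2 I'.2 fun hII => hcd (by rw [Subtype.ext hII])
      · simp [hJn d hd]
    · simp [hJn c hc]
  -- Atoms may share endpoints, so a point takes the least index of an atom containing it. A point
  -- in no atom admits every index and gets `0`.
  have hex : ∀ x, ∃ c, x ∈ F c ∪ (⋃ d, F d)ᶜ := by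
    intro x
    by_cases hx : x ∈ ⋃ d, F d
    · obtain ⟨c, hc⟩ := mem_iUnion.1 hx
      exact ⟨c, Or.inl hc⟩
    · exact ⟨0, Or.inr hx⟩
  set a : unitInterval → ℕ := fun x => Nat.find (hex x) with ha
  have ham : Measurable[MeasurableSpace.generateFrom 𝒜] a :=
    @measurable_find _ (MeasurableSpace.generateFrom 𝒜) (fun x c => x ∈ F c ∪ (⋃ d, F d)ᶜ) _ hex
      fun c => (hFm c).union (MeasurableSet.iUnion hFm).compl
  have haF : ∀ᵐ x ∂μ, x ∈ F (a x) := by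
    have : ∀ᵐ x ∂μ, x ∈ ⋃₀ 𝒜 := h.absolutelyContinuous.1.ae_le h.partition.cover
    filter_upwards [this] with x hx
    obtain ⟨I, hI, hxI⟩ := hx
    have hxF : x ∈ ⋃ d, F d := mem_iUnion.2 ⟨e ⟨I, hI⟩, by rw [hFe]; exact hxI⟩
    rcases Nat.find_spec (hex x) with h1 | h1
    · exact h1
    · exact absurd hxF h1
  have hFJ : ∀ᵐ x ∂μ, ∀ c, x ∈ F c → x ∈ J c := by
    rw [ae_all_iff]
    intro c
    by_cases hc : ∃ I, e I = c
    · obtain ⟨I, rfl⟩ := hc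
      rw [hFe, hJe]
      have h1 := h.absolutelyContinuous.1
        (volume_sdiff_realInterior (h.partition.interval I I.2))
      filter_upwards [measure_eq_zero_iff_ae_notMem.1 h1] with x hx hxI
      by_contra hcon
      exact hx ⟨hxI, hcon⟩
    · rw [hFn c hc]
      exact ae_of_all _ fun x hx => hx.elim
  have hfib : ∀ c, F c =ᵐ[μ] a ⁻¹' {c} := by
    intro c
    filter_upwards [haF, hFJ] with x h1 h2
    refine propext ⟨fun hx => ?_, fun hx => ?_⟩
    · by_contra hne
      exact Set.disjoint_left.1 (hdisj hne) (h2 _ h1) (h2 _ hx)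
    · have hx' : a x = c := hx
      rw [hx'] at h1
      exact h1
  refine ⟨a, J, ⟨fun c => ham (measurableSet_singleton c), ham.mono hgm le_rfl, ?_, ?_, hdisj, ?_,
    ?_, ?_⟩⟩
  · intro c
    by_cases hc : ∃ I, e I = c
    · obtain ⟨I, rfl⟩ := hc
      rw [hJe]
      exact ordConnected_realInterior (h.partition.interval I I.2)
    · rw [hJn c hc]
      exact ordConnected_empty
  · intro c
    by_cases hc : ∃ I, e I = c
    · obtain ⟨I, rfl⟩ := hc
      rw [hJe]
      exact (h.strictMono I I.2).imp StrictMonoOn.monotoneOn StrictAntiOn.antitoneOn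
    · rw [hJn c hc]
      exact Or.inl fun x hx => hx.elim
  · filter_upwards [haF, hFJ] with x h1 h2 using h2 _ h1
  · have h1 : ∀ c, μ.real (a ⁻¹' {c}) = μ.real (F c) := fun c => (measureReal_congr (hfib c)).symm
    simp only [h1]
    rw [← he.summable_iff (fun c hc => by rw [hFn c (by simpa using hc)]; simp)]
    simpa [Function.comp_def, hFe] using h.finite_entropy
  · intro I hI
    refine ⟨e ⟨I, hI⟩, ?_⟩
    have := hfib (e ⟨I, hI⟩)
    rwa [hFe] at this

variable {a : unitInterval → ℕ} {J : ℕ → Set unitInterval}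

theorem IsCoding.measurableSet_itinerary (hc : IsCoding T μ 𝒜 a J) (l : ℕ)
    (S : Set (Fin l → ℕ)) : MeasurableSet[cylinderAlgebra T 𝒜 l] (itinerary T a l ⁻¹' S) := by
  have h1 : ∀ w : Fin l → ℕ, MeasurableSet[cylinderAlgebra T 𝒜 l] (itinerary T a l ⁻¹' {w}) := by
    intro w
    have : itinerary T a l ⁻¹' {w} = ⋂ j : Fin l, T^[j] ⁻¹' (a ⁻¹' {w j}) := by
      ext x
      simp [itinerary, funext_iff]
    rw [this]
    refine MeasurableSet.iInter fun j => ?_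
    have hle : (MeasurableSpace.generateFrom 𝒜).comap T^[j] ≤ cylinderAlgebra T 𝒜 l :=
      le_iSup₂_of_le (j : ℕ) j.2 le_rfl
    exact hle _ ⟨_, hc.measurableSet_fiber (w j), rfl⟩
  have : itinerary T a l ⁻¹' S = ⋃ w ∈ S, itinerary T a l ⁻¹' {w} := by
    ext x
    simp
  rw [this]
  exact MeasurableSet.biUnion S.to_countable fun w _ => h1 w

end ClassT

theorem preimage_itinerary_castLE {X α : Type*} (T : X → X) (a : X → α) {r r' : ℕ} (h : r ≤ r')
    (S : Set (Fin r → α)) : itinerary T a r ⁻¹' S =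
      itinerary T a r' ⁻¹' {w | (fun i : Fin r => w (Fin.castLE h i)) ∈ S} := rfl

theorem isSetAlgebra_itinerary {X α : Type*} (T : X → X) (a : X → α) :
    IsSetAlgebra {B | ∃ (r : ℕ) (S : Set (Fin r → α)), B = itinerary T a r ⁻¹' S} where
  empty_mem := ⟨0, ∅, by simp⟩
  compl_mem := by
    rintro _ ⟨r, S, rfl⟩
    exact ⟨r, Sᶜ, rfl⟩
  union_mem := by
    rintro _ _ ⟨r, S, rfl⟩ ⟨r', S', rfl⟩
    rw [preimage_itinerary_castLE T a (le_max_left r r'),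
      preimage_itinerary_castLE T a (le_max_right r r'), ← preimage_union]
    exact ⟨_, _, rfl⟩

section ClassT

variable {T : unitInterval → unitInterval} {μ : Measure unitInterval}
  {𝒜 : Set (Set unitInterval)} {a : unitInterval → ℕ} {J : ℕ → Set unitInterval}

/-- Cylinder sets form an algebra, which is dense in the σ-algebra it generates. The generating
hypothesis makes that σ-algebra everything up to null sets. -/
theorem IsCoding.exists_itinerary_symmDiff_le (hc : IsCoding T μ 𝒜 a J) (h : ClassT T μ 𝒜)
    (B : Set unitInterval) (hB : MeasurableSet B) (ε : ℝ) (hε : ε > 0) :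
    ∃ (r : ℕ) (S : Set (Fin r → ℕ)), μ.real (symmDiff B (itinerary T a r ⁻¹' S)) ≤ ε := by
  have := h.prob
  have hmp := h.ergodic.toMeasurePreserving
  set 𝒞 : Set (Set unitInterval) := {B | ∃ (r : ℕ) (S : Set (Fin r → ℕ)), B = itinerary T a r ⁻¹' S}
    with h𝒞
  have h_le : MeasurableSpace.generateFrom 𝒞 ≤ Subtype.instMeasurableSpace := by
    refine MeasurableSpace.generateFrom_le ?_
    rintro _ ⟨r, S, rfl⟩
    exact measurable_itinerary hmp.measurable hc.measurable r S.to_countable.measurableSet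
  have hfull : fullCylinderAlgebra T 𝒜 ≤ eventuallyMeasurableSpace (MeasurableSpace.generateFrom 𝒞) (ae μ) := by
    refine iSup_le fun j => ?_
    rw [MeasurableSpace.comap_generateFrom]
    refine MeasurableSpace.generateFrom_le ?_
    rintro _ ⟨I, hI, rfl⟩
    obtain ⟨c, hcI⟩ := hc.ae_eq_fiber I hI
    refine ⟨T^[j] ⁻¹' (a ⁻¹' {c}), ?_, (hmp.iterate j).quasiMeasurePreserving.preimage_ae_eq hcI⟩
    exact MeasurableSpace.measurableSet_generateFrom
      ⟨j + 1, {w | w (Fin.last j) = c}, by ext x; simp [itinerary]⟩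
  obtain ⟨B', hB', hBB'⟩ := h.generates B hB
  obtain ⟨B'', hB'', hB'B''⟩ := hfull _ hB'
  have hae : B =ᵐ[μ] B'' := (h.absolutelyContinuous.1.ae_eq hBB').trans hB'B''
  have hdense := @Measure.MeasureDense.of_generateFrom_isSetAlgebra_finite unitInterval (MeasurableSpace.generateFrom 𝒞)
    (μ.trim h_le) 𝒞 _ (isSetAlgebra_itinerary T a) rfl
  obtain ⟨t, ⟨r, S, rfl⟩, ht⟩ := @Measure.MeasureDense.approx _ (MeasurableSpace.generateFrom 𝒞) _ _ hdense B'' hB'' (measure_ne_top _ _) ε hε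
  refine ⟨r, S, ?_⟩
  have hS : MeasurableSet[MeasurableSpace.generateFrom 𝒞] (itinerary T a r ⁻¹' S) :=
    MeasurableSpace.measurableSet_generateFrom ⟨r, S, rfl⟩
  rw [trim_measurableSet_eq h_le (@MeasurableSet.symmDiff _ (MeasurableSpace.generateFrom 𝒞) _ _ hB'' hS)] at ht
  have h1 : (symmDiff B (itinerary T a r ⁻¹' S) : Set unitInterval) =ᵐ[μ]
      (symmDiff B'' (itinerary T a r ⁻¹' S) : Set unitInterval) :=
    ae_eq_set_symmDiff hae (ae_eq_refl _)
  rw [measureReal_congr h1]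
  exact ENNReal.toReal_le_of_le_ofReal hε.le ht.le

/-- Almost every point follows its itinerary through the intervals of monotonicity. -/
theorem IsCoding.ae_forall_mem (hc : IsCoding T μ 𝒜 a J) (h : ClassT T μ 𝒜) :
    ∀ᵐ x ∂μ, ∀ j, T^[j] x ∈ J (a (T^[j] x)) :=
  ae_all_iff.2 fun j =>
    (h.ergodic.toMeasurePreserving.iterate j).quasiMeasurePreserving.ae hc.ae_mem

theorem IsCoding.mem_wordSet_iff (hc : IsCoding T μ 𝒜 a J) {x : unitInterval}
    (hx : ∀ j, T^[j] x ∈ J (a (T^[j] x))) (n : ℕ) (w : Fin n → ℕ) :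
    x ∈ wordSet T J n w ↔ itinerary T a n x = w := by
  constructor
  · intro hxw
    funext j
    by_contra hne
    exact Set.disjoint_left.1 (hc.disjoint hne) (hx j) (hxw j)
  · rintro rfl j
    exact hx j

/-- Preimages of a fixed set under `T^n` are cut out by about `exp (n h)` endpoints, for every `h`
above the entropy. -/
theorem ClassT.cutRate_preimage (h : ClassT T μ 𝒜) {η : ℝ}
    (hη : ksEntropy T μ < ENNReal.ofReal η) {A : Set unitInterval} (hA : MeasurableSet A) :
    CutRate volume (fun n => T^[n] ⁻¹' A) η := by
  classical
  have := h.prob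
  have hmp := h.ergodic.toMeasurePreserving
  obtain ⟨a, J, hc⟩ := h.exists_isCoding
  obtain ⟨c, hc0, hcμ⟩ := h.exists_measureReal_le
  intro ε hε
  -- Two errors of size `δ` arise, from approximating `A` and from the uncovered words, and
  -- comparing Lebesgue measure with `μ` costs a factor `c`.
  set δ := ε / (2 * (c + 1)) with hδ
  have hδ0 : 0 < δ := by positivity
  obtain ⟨r, S, hS⟩ := hc.exists_itinerary_symmDiff_le h A hA δ hδ0
  obtain ⟨C, hC0, hC⟩ := exists_covering_words_of_ksEntropy_lt h.ergodic hc.measurable hc.summable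
    hη hδ0
  refine ⟨2 * C * Real.exp (r * η), by positivity, ?_⟩
  have hshift : Tendsto (fun n : ℕ => n + r) atTop atTop := tendsto_add_atTop_nat r
  filter_upwards [hshift.eventually hC] with n ⟨Q, hQc, hQ⟩
  -- The last `r` letters of a word of length `n + r` are the itinerary of `Tⁿ x`, so they decide
  -- membership in the approximation of the preimage of `A`.
  set Q' := Q.filter (fun w => (fun i : Fin r => w (Fin.natAdd n i)) ∈ S) with hQ'
  set S' := ⋃ w ∈ Q', wordSet T J (n + r) w with hS'
  have hord := ordConnected_wordSet hc.ordConnected hc.monotone (n + r)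
  refine ⟨S', ?_, ?_, ?_⟩
  · exact Finset.measurableSet_biUnion _ fun w _ => (hord w).measurableSet
  · have hsub : symmDiff (T^[n] ⁻¹' A) S' ≤ᵐ[μ]
        (T^[n] ⁻¹' (symmDiff A (itinerary T a r ⁻¹' S)) ∪
          {x | itinerary T a (n + r) x ∉ Q} : Set unitInterval) := by
      filter_upwards [hc.ae_forall_mem h] with x hx hxS
      by_contra hcon
      have hcon' : ¬ (x ∈ T^[n] ⁻¹' (symmDiff A (itinerary T a r ⁻¹' S)) ∨
        x ∈ {x | itinerary T a (n + r) x ∉ Q}) := hcon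
      simp only [not_or, mem_ofPred_eq, not_not] at hcon'
      obtain ⟨h1, h2⟩ := hcon'
      have e1 : x ∈ S' ↔ itinerary T a r (T^[n] x) ∈ S := by
        simp only [hS', mem_iUnion, exists_prop, hc.mem_wordSet_iff hx]
        have e2 : (fun i : Fin r => itinerary T a (n + r) x (Fin.natAdd n i)) =
            itinerary T a r (T^[n] x) := by
          funext i
          simp [itinerary, ← Function.iterate_add_apply, Nat.add_comm]
        constructor
        · rintro ⟨w, hw, rfl⟩
          rw [← e2]
          exact (Finset.mem_filter.1 hw).2
        · intro hw
          rw [← e2] at hw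
          exact ⟨_, Finset.mem_filter.2 ⟨h2, hw⟩, rfl⟩
      have hxS' : x ∈ symmDiff (T^[n] ⁻¹' A) S' := hxS
      rw [mem_symmDiff, e1] at hxS'
      exact h1 hxS'
    have h1 : μ.real (symmDiff (T^[n] ⁻¹' A) S') ≤ δ + δ := by
      refine (ENNReal.toReal_mono (measure_ne_top _ _) (measure_mono_ae hsub)).trans ?_
      refine (measureReal_union_le _ _).trans (add_le_add ?_ hQ)
      rw [(hmp.iterate n).measureReal_preimage]
      · exact hS
      · exact (hA.symmDiff (measurable_itinerary hmp.measurable hc.measurable r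
          S.to_countable.measurableSet)).nullMeasurableSet
    refine (hcμ _).2.trans ((mul_le_mul_of_nonneg_left h1 hc0).trans ?_)
    have : c * (δ + δ) = ε * (c / (c + 1)) := by rw [hδ]; field_simp; ring
    rw [this]
    refine mul_le_of_le_one_right hε.le ?_
    rw [div_le_one (by positivity)]
    linarith
  · refine (CutBound.biUnion fun w _ => cutBound_of_ordConnected (hord w)).mono ?_
    have h1 : (Q'.card : ℝ) ≤ Q.card := by exact_mod_cast Finset.card_filter_le _ _
    have h2 : Real.exp ((n + r : ℕ) * η) = Real.exp (r * η) * Real.exp (n * η) := by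
      rw [← Real.exp_add]; push_cast; ring_nf
    rw [h2] at hQc
    calc (Q'.card : ℝ) * 2 ≤ (C * (Real.exp (r * η) * Real.exp (n * η))) * 2 := by
          gcongr; exact h1.trans hQc
      _ = _ := by ring

/-! ### Property B against sets with few endpoints. -/

theorem finite_card_le_of_forall_finset {α : Type*} {K : Set α} {N : ℝ}
    (h : ∀ F : Finset α, (F : Set α) ⊆ K → (F.card : ℝ) ≤ N) :
    ∃ hK : K.Finite, (hK.toFinset.card : ℝ) ≤ N := by
  have hK : K.Finite := by
    by_contra hinf
    obtain ⟨k, hk⟩ := exists_nat_gt N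
    obtain ⟨F, hF, hFk⟩ := Set.Infinite.exists_subset_card_eq hinf k
    have := h F hF
    rw [hFk] at this
    linarith
  exact ⟨hK, h _ (by simp)⟩

/-- Cylinders of length `l` which are cut by a set with few endpoints and are not too large have
small total measure. -/
theorem IsCoding.measureReal_cut_cylinders_le (hc : IsCoding T μ 𝒜 a J) (h : ClassT T μ 𝒜)
    {S : Set unitInterval} {N : ℝ} (hS : CutBound S N) (l : ℕ) {θ : ℝ} (hθ : 0 ≤ θ) :
    μ.real {x | μ.real (itinerary T a l ⁻¹' {itinerary T a l x}) ≤ θ ∧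
      (wordSet T J l (itinerary T a l x) ∩ S).Nonempty ∧
      (wordSet T J l (itinerary T a l x) \ S).Nonempty} ≤ N * θ := by
  classical
  have := h.prob
  set K : Set (Fin l → ℕ) := {w | μ.real (itinerary T a l ⁻¹' {w}) ≤ θ ∧
    (wordSet T J l w ∩ S).Nonempty ∧ (wordSet T J l w \ S).Nonempty} with hK
  have hord := ordConnected_wordSet hc.ordConnected hc.monotone l
  have hcard : ∀ F : Finset (Fin l → ℕ), (F : Set (Fin l → ℕ)) ⊆ K → (F.card : ℝ) ≤ N := by
    intro F hF
    -- Each of these word sets meets `S`, and distinct words have disjoint word sets, so counting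
    -- words is counting intervals.
    have hinj : Set.InjOn (wordSet T J l) F := by
      intro w hw w' _ hww
      by_contra hne
      obtain ⟨x, hx, -⟩ := (hF hw).2.1
      exact Set.disjoint_left.1 (disjoint_wordSet hc.disjoint hne) hx (hww ▸ hx)
    rw [← Finset.card_image_of_injOn hinj]
    refine hS _ ?_ ?_ ?_
    · intro I hI
      obtain ⟨w, -, rfl⟩ := Finset.mem_image.1 hI
      exact hord w
    · intro I hI I' hI' hne
      obtain ⟨w, -, rfl⟩ := Finset.mem_image.1 hI
      obtain ⟨w', -, rfl⟩ := Finset.mem_image.1 hI'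
      exact disjoint_wordSet hc.disjoint fun hww => hne (by rw [hww])
    · intro I hI
      obtain ⟨w, hw, rfl⟩ := Finset.mem_image.1 hI
      exact (hF hw).2
  obtain ⟨hfin, hcard'⟩ := finite_card_le_of_forall_finset hcard
  have hsub : {x | μ.real (itinerary T a l ⁻¹' {itinerary T a l x}) ≤ θ ∧
      (wordSet T J l (itinerary T a l x) ∩ S).Nonempty ∧
      (wordSet T J l (itinerary T a l x) \ S).Nonempty} ⊆
      ⋃ w ∈ hfin.toFinset, itinerary T a l ⁻¹' {w} := by
    intro x hx
    simp only [mem_iUnion]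
    exact ⟨itinerary T a l x, hfin.mem_toFinset.2 hx, rfl⟩
  refine (measureReal_mono hsub (measure_ne_top _ _)).trans
    ((measureReal_biUnion_finset_le _ _).trans ?_)
  refine (Finset.sum_le_card_nsmul _ _ θ fun w hw => (hfin.mem_toFinset.1 hw).1).trans ?_
  rw [nsmul_eq_mul]
  gcongr

/-- A system with property B decorrelates `T^{-n} A` from sets cut out by fewer endpoints than its
entropy allows. -/
theorem ClassT.exists_const_measureReal_inter_preimage_le (h : ClassT T μ 𝒜)
    (hB : HasPropertyB T μ 𝒜) {η : ℝ} (hη0 : 0 ≤ η) (hη : ENNReal.ofReal η < ksEntropy T μ) :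
    ∃ C : ℝ, 0 ≤ C ∧ ∀ (S : ℕ → Set unitInterval), CutRate volume S η →
      ∀ A : Set unitInterval, MeasurableSet A → ∀ ε > 0, ∀ᶠ n in atTop,
        volume.real (S n ∩ T^[n] ⁻¹' A) ≤ C * (volume.real (S n) * μ.real A) + ε := by
  classical
  have := h.prob
  have hmp := h.ergodic.toMeasurePreserving
  obtain ⟨a, J, hc⟩ := h.exists_isCoding
  obtain ⟨c, hc0, hcμ⟩ := h.exists_measureReal_le
  obtain ⟨cB, b, hcB, hb0, hb, hmix⟩ := hB
  obtain ⟨η₁', hη1, hη2⟩ := exists_between hη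
  set η₁ := η₁'.toReal with hη₁
  have hfin : η₁' ≠ ∞ := hη2.ne_top
  have hηη : η < η₁ := by
    rw [← ENNReal.ofReal_toReal hfin] at hη1
    exact (ENNReal.ofReal_lt_ofReal_iff_of_nonneg hη0).1 hη1
  refine ⟨c * cB * c, by positivity, fun S hS A hA ε hε => ?_⟩
  -- Collects all errors in units of `δ`: `1` from `b m`, `c` from replacing `Sₙ` by `S'`, `cB * (c
  -- + 2)` from comparing `P` with `Sₙ`, all times `c` for the return to Lebesgue measure.
  set M := c * (1 + c + cB * (c + 2)) + 1 with hM
  have hM0 : 0 < M := by positivity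
  set δ := ε / M with hδ
  have hδ0 : 0 < δ := by positivity
  obtain ⟨m, hm⟩ := (hb.eventually_lt_const hδ0).exists
  obtain ⟨C, hC0, hC⟩ := hS δ hδ0
  have hlarge := eventually_measureReal_large_cylinders_le h.ergodic hc.measurable
    (hc.exists_itinerary_symmDiff_le h) (hη0.trans hηη.le)
    (by rw [hη₁, ENNReal.ofReal_toReal hfin]; exact hη2) hδ0
  -- The number of endpoints at time `m + l` times the size of a typical cylinder of length `l`
  -- tends to zero because `η < η₁`. The gap `m` is fixed before, by property B, and only
  -- contributes a constant factor.
  have hlim : ∀ᶠ l : ℕ in atTop,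
      (C * Real.exp ((m + l : ℕ) * η)) * Real.exp (-(l * η₁)) ≤ δ := by
    have h1 : Tendsto (fun l : ℕ => C * Real.exp (m * η) * Real.exp (-((η₁ - η) * l))) atTop
        (𝓝 (C * Real.exp (m * η) * 0)) := by
      refine Tendsto.const_mul _ (Real.tendsto_exp_neg_atTop_nhds_zero.comp ?_)
      exact tendsto_natCast_atTop_atTop.const_mul_atTop (by linarith)
    rw [mul_zero] at h1
    filter_upwards [h1.eventually_lt_const hδ0] with l hl
    refine le_of_eq_of_le ?_ hl.le
    rw [mul_assoc, mul_assoc, ← Real.exp_add, ← Real.exp_add]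
    push_cast
    ring_nf
  have hshift : Tendsto (fun l : ℕ => m + l) atTop atTop := by
    simpa [Nat.add_comm] using tendsto_add_atTop_nat m
  obtain ⟨L, hL⟩ := eventually_atTop.1 ((hshift.eventually hC).and
    (hlarge.and (hlim.and (eventually_ge_atTop 1))))
  filter_upwards [eventually_ge_atTop (m + L)] with n hn
  obtain ⟨l, rfl⟩ : ∃ l, n = m + l := ⟨n - m, by omega⟩
  obtain ⟨⟨S', hS'm, hS'1, hS'2⟩, hbad, hθ, hl1⟩ := hL l (by omega)
  set V : Set (Fin l → ℕ) := {w | (wordSet T J l w ∩ S').Nonempty} with hV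
  set P := itinerary T a l ⁻¹' V with hP
  have hSP : S' ≤ᵐ[μ] P := by
    filter_upwards [hc.ae_forall_mem h] with x hx hxS
    exact ⟨x, (hc.mem_wordSet_iff hx l _).2 rfl, hxS⟩
  -- A typical point of `P` outside `S'` lies in a cylinder meeting both `S'` and its complement.
  -- That cylinder is either too large, which is rare by entropy, or one of the few that are cut.
  have hPS : μ.real (P \ S') ≤ 2 * δ := by
    set bad := {x | Real.exp (-(l * η₁)) < μ.real (itinerary T a l ⁻¹' {itinerary T a l x})}
    set cut := {x | μ.real (itinerary T a l ⁻¹' {itinerary T a l x}) ≤ Real.exp (-(l * η₁)) ∧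
      (wordSet T J l (itinerary T a l x) ∩ S').Nonempty ∧
      (wordSet T J l (itinerary T a l x) \ S').Nonempty}
    have hsub : (P \ S' : Set unitInterval) ≤ᵐ[μ] (bad ∪ cut : Set unitInterval) := by
      filter_upwards [hc.ae_forall_mem h] with x hx hxP
      have hxP' : x ∈ P \ S' := hxP
      by_cases hxb : x ∈ bad
      · exact Or.inl hxb
      · exact Or.inr ⟨not_lt.1 hxb, hxP'.1, ⟨x, (hc.mem_wordSet_iff hx l _).2 rfl, hxP'.2⟩⟩
    refine (ENNReal.toReal_mono (measure_ne_top _ _) (measure_mono_ae hsub)).trans ?_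
    refine (measureReal_union_le _ _).trans ?_
    have := hc.measureReal_cut_cylinders_le h hS'2 l (Real.exp_pos (-(l * η₁))).le
    have h2 := this.trans hθ
    linarith
  set X := S (m + l) with hX
  have d1 : μ.real (symmDiff X S') ≤ c * δ :=
    (hcμ _).1.trans (mul_le_mul_of_nonneg_left hS'1 hc0)
  have d2 : μ.real S' ≤ μ.real X + c * δ := by
    have : S' ⊆ X ∪ symmDiff X S' := by
      intro x hx
      by_cases hxX : x ∈ X
      · exact Or.inl hxX
      · exact Or.inr (Or.inr ⟨hx, hxX⟩)
    have := (measureReal_mono (μ := μ) this (measure_ne_top _ _)).trans (measureReal_union_le _ _)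
    linarith
  have d3 : μ.real P ≤ μ.real S' + 2 * δ := by
    have : P ⊆ S' ∪ P \ S' := by
      intro x hx
      by_cases hxX : x ∈ S'
      · exact Or.inl hxX
      · exact Or.inr ⟨hx, hxX⟩
    have := (measureReal_mono (μ := μ) this (measure_ne_top _ _)).trans (measureReal_union_le _ _)
    linarith
  have d4 : μ.real (X ∩ T^[m + l] ⁻¹' A) ≤ μ.real (P ∩ T^[m + l] ⁻¹' A) + c * δ := by
    have hsub : (X ∩ T^[m + l] ⁻¹' A : Set unitInterval) ≤ᵐ[μ]
        ((P ∩ T^[m + l] ⁻¹' A) ∪ symmDiff X S' : Set unitInterval) := by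
      filter_upwards [hSP] with x hx hxX
      have hxX' : x ∈ X ∩ T^[m + l] ⁻¹' A := hxX
      by_cases hxS : x ∈ S'
      · exact Or.inl ⟨hx hxS, hxX'.2⟩
      · exact Or.inr (Or.inl ⟨hxX'.1, hxS⟩)
    have := (ENNReal.toReal_mono (measure_ne_top _ _) (measure_mono_ae hsub)).trans
      (measureReal_union_le (μ := μ) _ _)
    exact this.trans (by linarith)
  have d5 := hmix l m hl1 P A (hc.measurableSet_itinerary l V) hA
  have d6 : μ.real X ≤ c * volume.real X := (hcμ X).1
  have hA1 : μ.real A ≤ 1 := measureReal_le_one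
  have hA0 : 0 ≤ μ.real A := measureReal_nonneg
  have d7 : cB * μ.real P * μ.real A ≤ cB * (c * (volume.real X * μ.real A)) + cB * (c + 2) * δ := by
    have h1 : μ.real P ≤ c * volume.real X + (c + 2) * δ := by linarith
    have h2 : cB * μ.real P * μ.real A ≤ cB * (c * volume.real X + (c + 2) * δ) * μ.real A := by
      gcongr
    have h3 : cB * ((c + 2) * δ) * μ.real A ≤ cB * ((c + 2) * δ) :=
      mul_le_of_le_one_right (by positivity) hA1
    nlinarith
  have d8 : μ.real (X ∩ T^[m + l] ⁻¹' A) ≤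
      cB * (c * (volume.real X * μ.real A)) + (1 + c + cB * (c + 2)) * δ := by nlinarith
  have d9 := (hcμ (X ∩ T^[m + l] ⁻¹' A)).2.trans (mul_le_mul_of_nonneg_left d8 hc0)
  have d10 : c * ((1 + c + cB * (c + 2)) * δ) ≤ ε := by
    have : M * δ = ε := by rw [hδ]; field_simp
    nlinarith
  refine d9.trans ?_
  rw [mul_add]
  nlinarith

end ClassT

/-! ### Domination on rectangles and conclusion. -/

/-- Asymptotic domination on rectangles of the images of Lebesgue measure under
`x ↦ (T₀ⁿ x, ..., Tₖⁿ x)` by a multiple of the product measure. -/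
theorem exists_const_measureReal_iInter_preimage_le (k : ℕ)
    (T : Fin (k + 1) → unitInterval → unitInterval) (μ : Fin (k + 1) → Measure unitInterval)
    (𝒜 : Fin (k + 1) → Set (Set unitInterval)) (hT : ∀ i, ClassT (T i) (μ i) (𝒜 i))
    (hB : ∀ i : Fin k, HasPropertyB (T i.succ) (μ i.succ) (𝒜 i.succ))
    (hent : StrictMono fun i => ksEntropy (T i) (μ i)) :
    ∃ C : ℝ, 0 ≤ C ∧ ∀ A : Fin (k + 1) → Set unitInterval, (∀ i, MeasurableSet (A i)) →
      ∀ ε > 0, ∀ᶠ n in atTop,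
        volume.real (⋂ i, (T i)^[n] ⁻¹' A i) ≤ C * ∏ i, (μ i).real (A i) + ε := by
  induction k with
  | zero =>
    obtain ⟨c, hc0, hc⟩ := (hT 0).exists_measureReal_le
    refine ⟨c, hc0, fun A hA ε hε => Eventually.of_forall fun n => ?_⟩
    have e : (⋂ i : Fin 1, (T i)^[n] ⁻¹' A i) = (T 0)^[n] ⁻¹' A 0 := by
      ext x; simp
    -- For a single map, invariance and comparability with Lebesgue measure suffice.
    have h1 := (hc ((T 0)^[n] ⁻¹' A 0)).2
    rw [((hT 0).ergodic.toMeasurePreserving.iterate n).measureReal_preimage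
      (hA 0).nullMeasurableSet] at h1
    rw [e]
    simp only [Nat.reduceAdd, Finset.univ_unique, Fin.default_eq_zero, Fin.isValue,
      Finset.prod_singleton]
    linarith
  | succ k ih =>
    have hlt : ksEntropy (T (Fin.last k).castSucc) (μ (Fin.last k).castSucc) <
        ksEntropy (T (Fin.last (k + 1))) (μ (Fin.last (k + 1))) :=
      hent (Fin.castSucc_lt_last (Fin.last k))
    -- A rate above the entropies of all the earlier maps and below that of the last one: the
    -- earlier preimages are cut out at rate `η'`, and the last map decorrelates from sets of that
    -- rate.
    obtain ⟨η', hη1, hη2⟩ := exists_between hlt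
    have hfin : η' ≠ ∞ := hη2.ne_top
    rw [← ENNReal.ofReal_toReal hfin] at hη1 hη2
    obtain ⟨C, hC0, hC⟩ := ih (fun i => T i.castSucc) (fun i => μ i.castSucc)
      (fun i => 𝒜 i.castSucc) (fun i => hT _) (fun i => hB i.castSucc)
      (hent.comp Fin.strictMono_castSucc)
    obtain ⟨D, hD0, hD⟩ := (hT (Fin.last (k + 1))).exists_const_measureReal_inter_preimage_le
      (hB (Fin.last k)) ENNReal.toReal_nonneg hη2
    refine ⟨D * C, by positivity, fun A hA ε hε => ?_⟩
    have hcut : CutRate volume (fun n => ⋂ i : Fin (k + 1), (T i.castSucc)^[n] ⁻¹' A i.castSucc)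
        η'.toReal := by
      refine CutRate.iInter fun i => (hT _).cutRate_preimage ?_ (hA _)
      refine lt_of_le_of_lt (hent.monotone ?_) hη1
      exact Fin.castSucc_le_castSucc_iff.2 (Fin.le_last i)
    have h1 := hC (fun i => A i.castSucc) (fun i => hA _) (ε / (2 * (D + 1))) (by positivity)
    have h2 := hD _ hcut _ (hA (Fin.last (k + 1))) (ε / 2) (by positivity)
    filter_upwards [h1, h2] with n h1 h2
    have e : (⋂ i : Fin (k + 1 + 1), (T i)^[n] ⁻¹' A i) =
        (⋂ i : Fin (k + 1), (T i.castSucc)^[n] ⁻¹' A i.castSucc) ∩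
          (T (Fin.last (k + 1)))^[n] ⁻¹' A (Fin.last (k + 1)) := by
      ext x
      simp [Fin.forall_fin_succ']
    have := (hT (Fin.last (k + 1))).prob
    have hA0 : 0 ≤ (μ (Fin.last (k + 1))).real (A (Fin.last (k + 1))) := measureReal_nonneg
    have hA1 : (μ (Fin.last (k + 1))).real (A (Fin.last (k + 1))) ≤ 1 := measureReal_le_one
    rw [e, Fin.prod_univ_castSucc]
    refine h2.trans ?_
    have h3 := mul_le_mul_of_nonneg_left (mul_le_mul_of_nonneg_right h1 hA0) hD0
    have h4 : D * (ε / (2 * (D + 1)) * (μ (Fin.last (k + 1))).real (A (Fin.last (k + 1)))) ≤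
        ε / 2 := by
      calc _ ≤ D * (ε / (2 * (D + 1)) * 1) := by gcongr
        _ = ε / 2 * (D / (D + 1)) := by field_simp
        _ ≤ ε / 2 := by
          refine mul_le_of_le_one_right (by positivity) ?_
          rw [div_le_one (by positivity)]
          linarith
    rw [add_mul, mul_add] at h3
    linarith

theorem theorem1p8 (k : ℕ) (T : Fin (k + 1) → unitInterval → unitInterval)
    (μ : Fin (k + 1) → Measure unitInterval) [∀ i, IsProbabilityMeasure (μ i)]
    (𝒜 : Fin (k + 1) → Set (Set unitInterval))
    (hT : ∀ i, ClassT (T i) (μ i) (𝒜 i))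
    (hB : ∀ i : Fin k, HasPropertyB (T i.succ) (μ i.succ) (𝒜 i.succ))
    (hent : StrictMono fun i => ksEntropy (T i) (μ i))
    (hprod : Ergodic (fun (x : Fin (k + 1) → unitInterval) i => T i (x i)) (Measure.pi μ))
    (ν : Measure unitInterval) [IsProbabilityMeasure ν]
    (hν : ν ≪ volume ∧ volume ≪ ν) :
    UniformlyJointlyErgodic ν μ T := by
  have hmp : ∀ i, MeasurePreserving (T i) (μ i) (μ i) := fun i => (hT i).ergodic.toMeasurePreserving
  have hac : ∀ i, ν ≪ μ i := fun i => hν.1.trans (hT i).absolutelyContinuous.2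
  have hac' : ∀ i, μ i ≪ ν := fun i => (hT i).absolutelyContinuous.1.trans hν.2
  obtain ⟨C, hC0, hC⟩ := exists_const_measureReal_iInter_preimage_le k T μ 𝒜 hT hB hent
  exact ⟨fun i => inferInstance, hmp, fun i => ⟨hac' i, hac i⟩,
    tendsto_uniform_average_of_rectangle_bound hν.1 (fun i => (hmp i).measurable) hprod hC0 hC
      hac hac' hmp⟩
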